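/- Let $\zeta$ be a probability law on $\mathbb{R}$ with $\int z\,\zeta(dz)=0$ and $\int z^2\,\zeta(dz)\in(0,\infty)$, and let $(z_n)_{n\ge 1}$ be i.i.d. random variables with law $\zeta$. Let $Y$ be the Markov chain on $[0,\infty)$ given by $Y_{n+1}=\max(Y_n+z_{n+1},0)$, where $Y_0$ is independent of $(z_n)_{n\ge1}$. Put $T_n=z_1+\dots+z_n$ ($T_0=0$), $\alpha_1=\inf\{n\ge 1: T_n>0\}$ and $H_1=T_{\alpha_1}$. The chain $Y$ has a nonzero $\sigma$-finite invariant measure $\nu$ on $[0,\infty)$, and it is unique among $\sigma$-finite measures up to a multiplicative constant. It satisfies $\nu([0,x])<\infty$ for every $x\ge 0$ and $\nu([0,\infty))=\infty$. Moreover $Y$ is recurrent: if $O\subset[0,\infty)$ is (relatively) open with $\nu(O)>0$, then, for any $Y_0$, $\mathbb{P}(Y_n\in O \text{ for infinitely many } n)=1$. Assume furthermore that there is an integer $n_0\ge 1$ such that $z_1+\dots+z_{n_0}$ has a density with respect to Lebesgue measure. (i) If $\xi>3$ and $\int (z^+)^{\xi}\,\zeta(dz)<\infty$, where $z^+=\max(z,0)$,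 then there are constants $c_\nu>0$ and $d_\nu\in\mathbb{R}$ such that $$\nu([0,x])=c_\nu x+d_\nu+O\big(x^{-(\xi-3)}\big)\qquad (x\to\infty).$$ (ii) If $\int e^{bz}\,\zeta(dz)<\infty$ for some $b>0$, then there are constants $c_\nu>0$, $d_\nu\in\mathbb{R}$ and $\delta>0$ such that $$\nu([0,x])=c_\nu x+d_\nu+O\big(e^{-\delta x}\big)\qquad (x\to\infty).$$ In both cases $\alpha_1<\infty$ almost surely, $0<\mathbb{E}[H_1]<\infty$, $\mathbb{E}[H_1^2]<\infty$, and $$\frac{d_\nu}{c_\nu}=\frac{\mathbb{E}[H_1^2]}{2\,\mathbb{E}[H_1]}.$$ -/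

import Mathlib

open MeasureTheory ProbabilityTheory Filter Asymptotics
open scoped NNReal ENNReal

/-- The transition kernel on `[0, ∞)` of the chain `Y ↦ max (Y + z) 0`, where `z` has law `ζ`.
Recall that `Real.toNNReal r` is `max r 0`. -/
noncomputable def lindleyKernel (ζ : Measure ℝ) [IsProbabilityMeasure ζ] : Kernel ℝ≥0 ℝ≥0 where
  toFun y := ζ.map (fun t : ℝ => ((y : ℝ) + t).toNNReal)
  measurable' := by
    refine Measure.measurable_of_measurable_coe _ fun s hs => ?_
    have hf : Measurable (fun p : ℝ≥0 × ℝ => ((p.1 : ℝ) + p.2).toNNReal) := by fun_prop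
    have h := measurable_measure_prodMk_left (ν := ζ) (hf hs)
    have e : (fun y : ℝ≥0 => (ζ.map (fun t : ℝ => ((y : ℝ) + t).toNNReal)) s) =
        fun y => ζ (Prod.mk y ⁻¹' ((fun p : ℝ≥0 × ℝ => ((p.1 : ℝ) + p.2).toNNReal) ⁻¹' s)) := by
      funext y
      rw [Measure.map_apply (by fun_prop) hs]
      rfl
    rw [e]
    exact h

theorem lindleyKernel_apply (ζ : Measure ℝ) [IsProbabilityMeasure ζ] (y : ℝ≥0) :
    lindleyKernel ζ y = ζ.map (fun t : ℝ => ((y : ℝ) + t).toNNReal) := rfl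

instance (ζ : Measure ℝ) [IsProbabilityMeasure ζ] : IsMarkovKernel (lindleyKernel ζ) where
  isProbabilityMeasure y := by
    rw [lindleyKernel_apply]
    exact Measure.isProbabilityMeasure_map (by fun_prop)

/-- The chain started at `Y₀` and driven by the increments `z`: `Yₙ₊₁ = max (Yₙ + zₙ₊₁) 0`.
The increments are numbered from `0`, so that `z n` stands for the increment of index `n + 1`. -/
noncomputable def lindleyChain {Ω : Type*} (z : ℕ → Ω → ℝ) (Y₀ : Ω → ℝ≥0) : ℕ → Ω → ℝ≥0
  | 0, ω => Y₀ ω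
  | n + 1, ω => ((lindleyChain z Y₀ n ω : ℝ) + z n ω).toNNReal

/-- The random walk started at `0` with increments `z`: the sum of the first `n` of them. -/
noncomputable def walk {Ω : Type*} (z : ℕ → Ω → ℝ) (n : ℕ) (ω : Ω) : ℝ :=
  ∑ i ∈ Finset.range n, z i ω

/-- The first strictly ascending ladder time of the walk, `inf {n ≥ 1 | Tₙ > 0}`
(with the value `0` if there is no such time). -/
noncomputable def ladderTime {Ω : Type*} (z : ℕ → Ω → ℝ) (ω : Ω) : ℕ :=
  sInf {n : ℕ | 1 ≤ n ∧ 0 < walk z n ω}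

/-- The first strictly ascending ladder height of the walk, its value at the first strictly
ascending ladder time. -/
noncomputable def ladderHeight {Ω : Type*} (z : ℕ → Ω → ℝ) (ω : Ω) : ℝ :=
  walk z (ladderTime z ω) ω

/-- The law of the ladder height makes the quotient `E[H₁ ^ 2] / (2 * E[H₁])` meaningful (the ladder
time is almost surely finite, `H₁` and `H₁ ^ 2` are integrable, and `E[H₁]` is positive), and this
quotient is equal to `r`. -/
def IsLadderRatio {Ω : Type*} [MeasurableSpace Ω] (P : Measure Ω) (z : ℕ → Ω → ℝ) (r : ℝ) : Prop :=
  (∀ᵐ ω ∂P, ∃ n : ℕ, 1 ≤ n ∧ 0 < walk z n ω) ∧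
  Integrable (fun ω => ladderHeight z ω) P ∧
  Integrable (fun ω => ladderHeight z ω ^ 2) P ∧
  0 < ∫ ω, ladderHeight z ω ∂P ∧
  r = (∫ ω, ladderHeight z ω ^ 2 ∂P) / (2 * ∫ ω, ladderHeight z ω ∂P)

open scoped Topology
open Finset.HasAntidiagonal (antidiagonal)

/-! The invariant measure ν is the occupation measure of one excursion of the chain away from `0`.
Until it first enters `(-∞, 0]` at a positive time, the walk started at `0` moves like the chain, so
ν is `green ζ (Set.Ioi 0)` carried to `[0, ∞)`. It is invariant because the excursion ends almost
surely and its exit position is collapsed to `0` (`invariant_excursionMeasure`). An invariant π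
dominates `π {0} • ν`; the difference is invariant without mass at `0`, hence zero, since negative
steps bring mass down to `0` (`eq_smul_excursionMeasure`). For recurrence, the chain reaches `0`
from everywhere, and each excursion has the same positive chance to visit the open set
(`iInf_stayProb_eq_zero`). All this rests on the centered walk leaving every half-line almost surely
(`tendsto_reflectedLaw_Iic`).

By duality, `green ζ (Set.Ioi 0)` is also the renewal measure U of the law G of the strict ascending
ladder height (`green_Ioi_eq`). So ν([0, x]) is a renewal function, and the asymptotics are a
renewal theorem with rate. With μ the mean of G, the defect Z(x) = U([0, x]) - x⁺/μ is bounded, and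
Z(y) - ∫ Z(y - s) G(ds) = ∫ (s - y)⁺ G(ds) / μ for y ≥ 0. Running a renewal process from y down to a
level t writes Z(y) as the accumulated right-hand sides plus the mean of Z(t - overshoot)
(`overshoot_identity`). The first term is O(1/w(t)) for every weight w with ∫ (1 + s)² w(s) G(ds)
finite. In the second, the overshoot laws from two starting points share a fixed part ψ, so
differences of Z contract, by the factor w(u₀) (1 - |ψ| + 2C ∫ (w - 1)(1 + s) dG) (`contraction`).
It is below 1 once w is flattened by rescaling its argument, which costs a constant for powers and a
smaller exponent for exponentials. Iterating gives a limit of Z with error O(1/w).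

The common part ψ comes from the density assumption: U then dominates a multiple of Lebesgue measure
near infinity (`exists_smul_volume_Ici_le`). The ladder height loses one moment with respect to the
step (`integrable_ladderLaw`); together with the factor (1 + s)² this explains the exponent ξ - 3.
The limit of Z is identified by integrating its renewal equation (`tendsto_renewalDefect_eq`). -/

/-- The law of the walk with step law `ζ` at time `n`, restricted to the event that the walk is in
`S` at the times `1, …, n`. -/
noncomputable def killed (ζ : Measure ℝ) (S : Set ℝ) : ℕ → Measure ℝ
  | 0 => Measure.dirac 0
  | n + 1 => (killed ζ S n ∗ ζ).restrict S

/-- The law of the position of the walk at the time `n + 1`, restricted to the event that this is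
the first positive time at which the walk is outside `S`. -/
noncomputable def exitLaw (ζ : Measure ℝ) (S : Set ℝ) (n : ℕ) : Measure ℝ :=
  (killed ζ S n ∗ ζ).restrict Sᶜ

/-- The occupation measure of the walk until its first exit from `S` at a positive time. -/
noncomputable def green (ζ : Measure ℝ) (S : Set ℝ) : Measure ℝ := Measure.sum (killed ζ S)

/-- The law of the position of the walk at its first exit from `S` at a positive time. -/
noncomputable def ladderLaw (ζ : Measure ℝ) (S : Set ℝ) : Measure ℝ := Measure.sum (exitLaw ζ S)

/-! ### Convolution of measures on the line. -/

section Conv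

theorem conv_Iic_zero {a b : Measure ℝ} [SFinite a] [SFinite b] (ha : a (Set.Iic 0) = 0)
    (hb : b (Set.Iio 0) = 0) : (a ∗ b) (Set.Iic 0) = 0 := by
  have h1 : ∀ᵐ x ∂a, 0 < x := by
    rw [ae_iff]; simpa [Set.Iic] using ha
  have h2 : ∀ᵐ x ∂b, 0 ≤ x := by
    rw [ae_iff]; simpa [Set.Iio] using hb
  rw [← lintegral_indicator_one measurableSet_Iic,
    Measure.lintegral_conv (measurable_one.indicator measurableSet_Iic)]
  refine lintegral_eq_zero_of_ae_eq_zero ?_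
  filter_upwards [h1] with x hx
  refine lintegral_eq_zero_of_ae_eq_zero ?_
  filter_upwards [h2] with y hy
  simp only [Pi.zero_apply, Set.indicator_apply_eq_zero, Set.mem_Iic]
  intro h; linarith

theorem conv_Ioi_zero {a b : Measure ℝ} [SFinite a] [SFinite b] (ha : a (Set.Ioi 0) = 0)
    (hb : b (Set.Ioi 0) = 0) : (a ∗ b) (Set.Ioi 0) = 0 := by
  have h1 : ∀ᵐ x ∂a, x ≤ 0 := by
    rw [ae_iff]; simpa [Set.Ioi] using ha
  have h2 : ∀ᵐ x ∂b, x ≤ 0 := by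
    rw [ae_iff]; simpa [Set.Ioi] using hb
  rw [← lintegral_indicator_one measurableSet_Ioi,
    Measure.lintegral_conv (measurable_one.indicator measurableSet_Ioi)]
  refine lintegral_eq_zero_of_ae_eq_zero ?_
  filter_upwards [h1] with x hx
  refine lintegral_eq_zero_of_ae_eq_zero ?_
  filter_upwards [h2] with y hy
  simp only [Pi.zero_apply, Set.indicator_apply_eq_zero, Set.mem_Ioi]
  intro h; linarith

instance sFinite_finsetSum {α ι : Type*} [MeasurableSpace α] (s : Finset ι) (b : ι → Measure α)
    [∀ i, SFinite (b i)] : SFinite (∑ i ∈ s, b i) := by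
  classical
  induction s using Finset.induction_on with
  | empty => rw [Finset.sum_empty]; infer_instance
  | insert i s hi ih => rw [Finset.sum_insert hi]; infer_instance

theorem conv_finset_sum {ι : Type*} (s : Finset ι) (a : Measure ℝ) [SFinite a]
    (b : ι → Measure ℝ) [∀ i, SFinite (b i)] : a ∗ (∑ i ∈ s, b i) = ∑ i ∈ s, a ∗ b i := by
  classical
  induction s using Finset.induction_on with
  | empty => simp
  | insert i s hi ih => rw [Finset.sum_insert hi, Finset.sum_insert hi, Measure.conv_add, ih]

theorem sum_conv_sum (a b : ℕ → Measure ℝ) [∀ i, SFinite (a i)] [∀ i, SFinite (b i)] :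
    Measure.sum a ∗ Measure.sum b =
      Measure.sum fun n => ∑ p ∈ antidiagonal n, a p.1 ∗ b p.2 := by
  unfold Measure.conv
  rw [Measure.prod_sum, Measure.map_sum (by fun_prop)]
  ext s hs
  rw [Measure.sum_apply _ hs, Measure.sum_apply _ hs,
    ← Finset.HasAntidiagonal.sigmaAntidiagonalEquivProd.tsum_eq,
    ENNReal.tsum_sigma']
  refine tsum_congr fun n => ?_
  rw [Measure.coe_finsetSum, Finset.sum_apply, tsum_fintype]
  exact (Finset.sum_coe_sort (antidiagonal n)
    fun p => (Measure.map (fun x : ℝ × ℝ => x.1 + x.2) ((a p.1).prod (b p.2))) s)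

theorem Measure.conv_mono {a a' b b' : Measure ℝ} [SFinite b] [SFinite b']
    (ha : a ≤ a') (hb : b ≤ b') : a ∗ b ≤ a' ∗ b' := by
  refine Measure.le_iff.2 fun s hs => ?_
  rw [← lintegral_indicator_one hs, ← lintegral_indicator_one hs,
    Measure.lintegral_conv (measurable_one.indicator hs),
    Measure.lintegral_conv (measurable_one.indicator hs)]
  exact lintegral_mono' ha fun x => lintegral_mono' hb le_rfl

theorem restrict_eq_of_compl_zero {a : Measure ℝ} {s : Set ℝ} (h : a sᶜ = 0) :
    a.restrict s = a := by
  rw [Measure.restrict_eq_self_of_ae_mem]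
  rw [ae_iff]; exact h

end Conv

/-! ### Duality between killed walks and ladder heights. -/

section Duality

variable {ζ : Measure ℝ}

theorem killed_conv {S : Set ℝ} (hS : MeasurableSet S) (n : ℕ) :
    killed ζ S n ∗ ζ = killed ζ S (n + 1) + exitLaw ζ S n :=
  (Measure.restrict_add_restrict_compl hS).symm

theorem killed_Ioi_Iio (n : ℕ) : killed ζ (Set.Ioi 0) n (Set.Iio 0) = 0 := by
  cases n with
  | zero => simp [killed]
  | succ n =>
    rw [killed, Measure.restrict_apply measurableSet_Iio]
    convert measure_empty (μ := killed ζ (Set.Ioi 0) n ∗ ζ)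
    ext x; simp; intro h; exact h.le

theorem killed_Iic_Ioi (n : ℕ) : killed ζ (Set.Iic 0) n (Set.Ioi 0) = 0 := by
  cases n with
  | zero => simp [killed]
  | succ n =>
    rw [killed, Measure.restrict_apply measurableSet_Ioi]
    convert measure_empty (μ := killed ζ (Set.Iic 0) n ∗ ζ)
    ext x; simp

theorem exitLaw_Iic_Iic (n : ℕ) : exitLaw ζ (Set.Iic 0) n (Set.Iic 0) = 0 := by
  rw [exitLaw, Measure.restrict_apply measurableSet_Iic, Set.inter_compl_self, measure_empty]

theorem exitLaw_Ioi_Ioi (n : ℕ) : exitLaw ζ (Set.Ioi 0) n (Set.Ioi 0) = 0 := by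
  rw [exitLaw, Measure.restrict_apply measurableSet_Ioi, Set.inter_compl_self, measure_empty]

variable [IsProbabilityMeasure ζ]

instance (S : Set ℝ) (n : ℕ) : IsFiniteMeasure (killed ζ S n) := by
  induction n with
  | zero => unfold killed; infer_instance
  | succ n ih => unfold killed; infer_instance

instance (S : Set ℝ) (n : ℕ) : IsFiniteMeasure (exitLaw ζ S n) := by
  unfold exitLaw; infer_instance

instance (S : Set ℝ) : SFinite (green ζ S) := by unfold green; infer_instance

/-- A finite-time Wiener–Hopf factorization. Let `T n` be the sum over p + q = n of the convolutions
of the two killed laws. In `ζ ∗ T n` the extra step can be absorbed by either factor, continuing or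
ending its killed walk; equating the two expansions gives the identity. -/
theorem killed_duality {S : Set ℝ} (hS : MeasurableSet S) (n : ℕ) :
    ∑ p ∈ antidiagonal n, exitLaw ζ Sᶜ p.1 ∗ killed ζ S p.2 + killed ζ Sᶜ (n + 1) =
      ∑ p ∈ antidiagonal n, killed ζ Sᶜ p.1 ∗ exitLaw ζ S p.2 + killed ζ S (n + 1) := by
  set T : ℕ → Measure ℝ := fun n => ∑ p ∈ antidiagonal n, killed ζ Sᶜ p.1 ∗ killed ζ S p.2
    with hT
  have hfin : IsFiniteMeasure (T (n + 1)) := by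
    rw [hT]; infer_instance
  have e1 : ζ ∗ T n + killed ζ S (n + 1) =
      T (n + 1) + ∑ p ∈ antidiagonal n, exitLaw ζ Sᶜ p.1 ∗ killed ζ S p.2 := by
    simp only [hT]
    rw [Finset.Nat.sum_antidiagonal_succ, conv_finset_sum]
    have : ∀ p : ℕ × ℕ, ζ ∗ (killed ζ Sᶜ p.1 ∗ killed ζ S p.2) =
        killed ζ Sᶜ (p.1 + 1) ∗ killed ζ S p.2 + exitLaw ζ Sᶜ p.1 ∗ killed ζ S p.2 := by
      intro p
      rw [← Measure.conv_assoc, Measure.conv_comm ζ, killed_conv hS.compl, Measure.add_conv]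
    simp only [this, Finset.sum_add_distrib]
    have h0 : killed ζ Sᶜ 0 ∗ killed ζ S (n + 1) = killed ζ S (n + 1) :=
      Measure.dirac_zero_conv _
    rw [h0]
    abel
  have e2 : ζ ∗ T n + killed ζ Sᶜ (n + 1) =
      T (n + 1) + ∑ p ∈ antidiagonal n, killed ζ Sᶜ p.1 ∗ exitLaw ζ S p.2 := by
    simp only [hT]
    rw [Finset.Nat.sum_antidiagonal_succ', conv_finset_sum]
    have : ∀ p : ℕ × ℕ, ζ ∗ (killed ζ Sᶜ p.1 ∗ killed ζ S p.2) =
        killed ζ Sᶜ p.1 ∗ killed ζ S (p.2 + 1) + killed ζ Sᶜ p.1 ∗ exitLaw ζ S p.2 := by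
      intro p
      rw [Measure.conv_comm ζ, Measure.conv_assoc, killed_conv hS, Measure.conv_add]
    simp only [this, Finset.sum_add_distrib]
    have h0 : killed ζ Sᶜ (n + 1) ∗ killed ζ S 0 = killed ζ Sᶜ (n + 1) :=
      Measure.conv_dirac_zero _
    rw [h0]
    abel
  -- Cancelling `T (n + 1)` is legitimate because it is a finite measure.
  rw [← Measure.add_right_inj (T (n + 1)), ← add_assoc, ← e1, ← add_assoc, ← e2]
  abel

/-- The duality identity restricted to `(0, ∞)`: of its four terms only these two charge that
half-line. The other two, which live on `(-∞, 0]`, give `killed_Iic_succ_eq`. -/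
theorem killed_Ioi_succ_eq (n : ℕ) : killed ζ (Set.Ioi 0) (n + 1) =
    ∑ p ∈ antidiagonal n, exitLaw ζ (Set.Iic 0) p.1 ∗ killed ζ (Set.Ioi 0) p.2 := by
  have h := congrArg (fun m => m.restrict (Set.Ioi (0 : ℝ)))
    (killed_duality (ζ := ζ) (S := Set.Ioi 0) measurableSet_Ioi n)
  simp only [Set.compl_Ioi, Measure.restrict_add] at h
  rw [Measure.restrict_eq_zero.2 (killed_Iic_Ioi (n + 1)), add_zero, restrict_eq_of_compl_zero,
    Measure.restrict_eq_zero.2, zero_add, restrict_eq_of_compl_zero] at h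
  · exact h.symm
  · rw [killed, Measure.restrict_apply measurableSet_Ioi.compl, Set.compl_inter_self, measure_empty]
  · rw [Measure.coe_finsetSum, Finset.sum_apply]
    exact Finset.sum_eq_zero fun p _ => conv_Ioi_zero (killed_Iic_Ioi _) (exitLaw_Ioi_Ioi _)
  · rw [Measure.coe_finsetSum, Finset.sum_apply, Set.compl_Ioi]
    exact Finset.sum_eq_zero fun p _ => conv_Iic_zero (exitLaw_Iic_Iic _) (killed_Ioi_Iio _)

theorem killed_Iic_succ_eq (n : ℕ) : killed ζ (Set.Iic 0) (n + 1) =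
    ∑ p ∈ antidiagonal n, killed ζ (Set.Iic 0) p.1 ∗ exitLaw ζ (Set.Ioi 0) p.2 := by
  have h := killed_duality (ζ := ζ) (S := Set.Ioi 0) measurableSet_Ioi n
  rw [Set.compl_Ioi, ← killed_Ioi_succ_eq, add_comm, Measure.add_left_inj] at h
  exact h

theorem green_Ioi_eq : green ζ (Set.Ioi 0) =
    Measure.dirac 0 + ladderLaw ζ (Set.Iic 0) ∗ green ζ (Set.Ioi 0) := by
  conv_rhs => rw [green, ladderLaw, sum_conv_sum]
  ext s hs
  rw [green, Measure.sum_apply _ hs, tsum_eq_zero_add' ENNReal.summable, Measure.add_apply,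
    Measure.sum_apply _ hs]
  congr 1
  exact tsum_congr fun n => by rw [killed_Ioi_succ_eq]

/-- Truncating the series gives finite measures that satisfy the renewal equation as an inequality,
so that masses can later be subtracted before any finiteness of the full sum is known. -/
theorem sum_range_succ_le {k e : ℕ → Measure ℝ} [∀ n, SFinite (k n)] [∀ n, SFinite (e n)]
    (h0 : k 0 = Measure.dirac 0)
    (h : ∀ n, k (n + 1) = ∑ p ∈ antidiagonal n, e p.1 ∗ k p.2) (N : ℕ) :
    ∑ n ∈ Finset.range N, k n ≤
      Measure.dirac 0 + Measure.sum e ∗ ∑ n ∈ Finset.range N, k n := by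
  have key : ∀ N, ∑ n ∈ Finset.range N, k (n + 1) ≤ Measure.sum e ∗ ∑ n ∈ Finset.range N, k n := by
    intro N
    rw [conv_finset_sum]
    have e1 : ∀ j, Measure.sum e ∗ k j = Measure.sum fun i => e i ∗ k j := fun j => by
      unfold Measure.conv
      rw [Measure.prod_sum_left, Measure.map_sum (by fun_prop)]
    refine Measure.le_iff.2 fun s hs => ?_
    simp only [e1, h, Measure.coe_finsetSum, Finset.sum_apply, Measure.sum_apply _ hs]
    rw [← Finset.sum_biUnion (f := fun p : ℕ × ℕ => (e p.1 ∗ k p.2) s)]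
    · calc _ ≤ ∑ p ∈ Finset.range N ×ˢ Finset.range N, (e p.1 ∗ k p.2) s := by
            refine Finset.sum_le_sum_of_subset fun p hp => ?_
            simp only [Finset.mem_biUnion, Finset.mem_range, Finset.HasAntidiagonal.mem_antidiagonal,
              Finset.mem_product] at hp ⊢
            omega
        _ = ∑ j ∈ Finset.range N, ∑ i ∈ Finset.range N, (e i ∗ k j) s := by
            rw [Finset.sum_product_right]
        _ ≤ _ := Finset.sum_le_sum fun j _ => ENNReal.sum_le_tsum _
    · intro i _ j _ hij
      rw [Function.onFun, Finset.disjoint_left]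
      intro p hp hp'
      rw [Finset.HasAntidiagonal.mem_antidiagonal] at hp hp'
      omega
  cases N with
  | zero => simpa using Measure.zero_le _
  | succ N =>
    conv_lhs => rw [Finset.sum_range_succ', h0, add_comm]
    refine add_le_add le_rfl ((key N).trans (Measure.conv_mono le_rfl ?_))
    rw [Finset.sum_range_succ]
    exact Measure.le_add_right le_rfl

end Duality

/-! ### Uniform bounds on the mass of bounded intervals. -/

section Window

theorem Measure.conv_apply_Iic (a b : Measure ℝ) [SFinite a] [SFinite b] (x : ℝ) :
    (a ∗ b) (Set.Iic x) = ∫⁻ y, b (Set.Iic (x - y)) ∂a := by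
  rw [← lintegral_indicator_one measurableSet_Iic,
    Measure.lintegral_conv (measurable_one.indicator measurableSet_Iic)]
  refine lintegral_congr fun y => ?_
  rw [← lintegral_indicator_one measurableSet_Iic]
  refine lintegral_congr fun t => ?_
  simp only [Set.indicator, Set.mem_Iic, Pi.one_apply, le_sub_iff_add_le']

/-- A step larger than ε from `[x - ε, x]` jumps over x, and a process with nonnegative steps jumps
over x at most once. Analytically, the mass of `(-∞, x]` is split according to whether the next step
stays below x, and compared with the renewal inequality. -/
theorem window_bound {V H : Measure ℝ} [IsFiniteMeasure V] [SFinite H] (hH : H Set.univ ≤ 1)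
    (hH0 : H (Set.Iio 0) = 0) (hV : V ≤ Measure.dirac 0 + H ∗ V) (x ε : ℝ) :
    V (Set.Icc (x - ε) x) * H (Set.Ioi ε) ≤ 1 := by
  have hm : Measurable fun y => H (Set.Iic (x - y)) := by
    have : Antitone fun y => H (Set.Iic (x - y)) := fun a b hab =>
      measure_mono (Set.Iic_subset_Iic.2 (by linarith))
    exact this.measurable
  have h1 : V (Set.Iic x) ≤ 1 + ∫⁻ y in Set.Iic x, H (Set.Iic (x - y)) ∂V := by
    calc V (Set.Iic x) ≤ (Measure.dirac 0 + H ∗ V : Measure ℝ) (Set.Iic x) := hV _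
      _ ≤ 1 + ∫⁻ y, H (Set.Iic (x - y)) ∂V := by
          rw [Measure.add_apply, Measure.conv_comm, Measure.conv_apply_Iic]
          gcongr
          exact prob_le_one
      _ = _ := by
          congr 1
          rw [← lintegral_add_compl _ (measurableSet_Iic (a := x))]
          conv_rhs => rw [← add_zero (∫⁻ y in Set.Iic x, _ ∂V)]
          congr 1
          refine setLIntegral_eq_zero measurableSet_Iic.compl fun y hy => ?_
          refine measure_mono_null (fun t ht => ?_) hH0
          simp only [Set.mem_compl_iff, Set.mem_Iic, Set.mem_Iio] at *
          linarith
  have h2 : ∫⁻ y in Set.Iic x, H (Set.Iic (x - y)) ∂V +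
      V (Set.Icc (x - ε) x) * H (Set.Ioi ε) ≤ V (Set.Iic x) := by
    calc _ ≤ ∫⁻ y in Set.Iic x, H (Set.Iic (x - y)) ∂V +
          ∫⁻ y in Set.Icc (x - ε) x, H (Set.Ioi (x - y)) ∂V := by
          gcongr
          rw [mul_comm, ← setLIntegral_const]
          refine setLIntegral_mono' measurableSet_Icc fun y hy => ?_
          exact measure_mono (Set.Ioi_subset_Ioi (by linarith [hy.1]))
      _ ≤ ∫⁻ y in Set.Iic x, H (Set.Iic (x - y)) ∂V +
          ∫⁻ y in Set.Iic x, H (Set.Ioi (x - y)) ∂V := by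
          gcongr
          exact Set.Icc_subset_Iic_self
      _ = ∫⁻ y in Set.Iic x, H Set.univ ∂V := by
          rw [← lintegral_add_left hm]
          refine lintegral_congr fun y => ?_
          rw [← measure_union _ measurableSet_Ioi, Set.Iic_union_Ioi]
          rw [Set.disjoint_left]
          intro a ha hb
          exact absurd (Set.mem_Iic.1 ha) (not_le.2 hb)
      _ ≤ ∫⁻ y in Set.Iic x, 1 ∂V := by gcongr
      _ = V (Set.Iic x) := by simp
  have h3 : ∫⁻ y in Set.Iic x, H (Set.Iic (x - y)) ∂V ≠ ∞ := by
    refine ne_top_of_le_ne_top (measure_ne_top V (Set.Iic x)) (le_trans le_self_add h2)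
  have := h2.trans h1
  rw [add_comm 1] at this
  exact (ENNReal.add_le_add_iff_left h3).1 this

theorem window_bound_sum {k e : ℕ → Measure ℝ} [∀ n, IsFiniteMeasure (k n)] [∀ n, SFinite (e n)]
    (h0 : k 0 = Measure.dirac 0)
    (h : ∀ n, k (n + 1) = ∑ p ∈ antidiagonal n, e p.1 ∗ k p.2)
    (he : Measure.sum e Set.univ ≤ 1) (he0 : Measure.sum e (Set.Iio 0) = 0) (x ε : ℝ) :
    Measure.sum k (Set.Icc (x - ε) x) * Measure.sum e (Set.Ioi ε) ≤ 1 := by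
  rw [Measure.sum_apply _ measurableSet_Icc, ENNReal.tsum_eq_iSup_nat, ENNReal.iSup_mul]
  refine iSup_le fun N => ?_
  have := window_bound he he0 (sum_range_succ_le h0 h N) x ε
  rwa [Measure.coe_finsetSum, Finset.sum_apply] at this

end Window

/-! ### Centered step laws. -/

/-- A measure on the line with mean zero and with a positive and finite second moment. -/
structure IsCentered (ζ : Measure ℝ) : Prop where
  integrable_sq : Integrable (fun t : ℝ => t ^ 2) ζ
  pos : 0 < ∫ t, t ^ 2 ∂ζ
  mean : ∫ t, t ∂ζ = 0

instance isProbabilityMeasure_map_neg (ζ : Measure ℝ) [IsProbabilityMeasure ζ] :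
    IsProbabilityMeasure (ζ.map fun t => -t) :=
  Measure.isProbabilityMeasure_map (by fun_prop)

namespace IsCentered

variable {ζ : Measure ℝ} [IsProbabilityMeasure ζ]

theorem integrable (h : IsCentered ζ) : Integrable (fun t : ℝ => t) ζ := by
  have : MemLp (fun t : ℝ => t) 2 ζ :=
    (memLp_two_iff_integrable_sq measurable_id.aestronglyMeasurable).2 h.integrable_sq
  exact this.integrable (by norm_num)

omit [IsProbabilityMeasure ζ] in
theorem map_neg (h : IsCentered ζ) : IsCentered (ζ.map fun t => -t) where
  integrable_sq := by
    rw [integrable_map_measure (by fun_prop) (by fun_prop)]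
    simpa [Function.comp_def] using h.integrable_sq
  pos := by
    rw [integral_map (by fun_prop) (by fun_prop)]
    simpa using h.pos
  mean := by
    rw [integral_map (by fun_prop) (by fun_prop), integral_neg, h.mean, neg_zero]

/-- Otherwise the step would be almost surely nonpositive with mean zero, hence almost surely zero.
-/
theorem exists_Ioi_pos (h : IsCentered ζ) : ∃ ε : ℝ, 0 < ε ∧ 0 < ζ (Set.Ioi ε) := by
  by_contra! hc
  have h0 : ζ (Set.Ioi 0) = 0 := by
    have : Set.Ioi (0 : ℝ) = ⋃ n : ℕ, Set.Ioi (1 / ((n : ℝ) + 1)) := by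
      ext x
      simp only [Set.mem_Ioi, Set.mem_iUnion]
      exact ⟨fun hx => exists_nat_one_div_lt hx, fun ⟨n, hn⟩ => lt_trans (by positivity) hn⟩
    rw [this, measure_iUnion_null_iff]
    exact fun n => le_antisymm (hc _ (by positivity)) (zero_le)
  have h1 : ∀ᵐ t ∂ζ, 0 ≤ -t := by
    rw [ae_iff]; simpa [Set.Ioi] using h0
  have h2 : (fun t : ℝ => -t) =ᵐ[ζ] 0 := by
    rw [← integral_eq_zero_iff_of_nonneg_ae h1 h.integrable.neg, integral_neg, h.mean, neg_zero]
  have h3 : ∫ t, t ^ 2 ∂ζ = 0 := by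
    rw [← integral_zero ℝ ℝ (μ := ζ)]
    refine integral_congr_ae ?_
    filter_upwards [h2] with t ht
    simp only [Pi.zero_apply, neg_eq_zero] at ht
    simp [ht]
  exact h.pos.ne' h3

end IsCentered

/-! ### The reflected walk and the persistence probability. -/

section Reflected

/-- The law at time `n` of the walk with steps `-t`, where `t` has law `ζ`, started at `0` and
reflected at `0`. -/
noncomputable def reflectedLaw (ζ : Measure ℝ) : ℕ → Measure ℝ
  | 0 => Measure.dirac 0
  | n + 1 => ((reflectedLaw ζ n).prod ζ).map fun p : ℝ × ℝ => max (p.1 - p.2) 0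

variable {ζ : Measure ℝ} [IsProbabilityMeasure ζ]

instance (n : ℕ) : IsProbabilityMeasure (reflectedLaw ζ n) := by
  induction n with
  | zero => unfold reflectedLaw; infer_instance
  | succ n ih => exact Measure.isProbabilityMeasure_map (by fun_prop)

omit [IsProbabilityMeasure ζ] in
theorem reflectedLaw_Iic_of_neg (n : ℕ) {x : ℝ} (hx : x < 0) :
    reflectedLaw ζ n (Set.Iic x) = 0 := by
  cases n with
  | zero => simp [reflectedLaw, hx]
  | succ n =>
    rw [reflectedLaw, Measure.map_apply (by fun_prop) measurableSet_Iic]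
    convert measure_empty (μ := (reflectedLaw ζ n).prod ζ)
    ext p
    simp [hx]

omit [IsProbabilityMeasure ζ] in
theorem reflectedLaw_zero_Iic {x : ℝ} (hx : 0 ≤ x) : reflectedLaw ζ 0 (Set.Iic x) = 1 := by
  simp [reflectedLaw, hx]

/-- This recursion identifies the distribution function at `x ≥ 0` with the probability that a walk
with step law `ζ`, started at `x`, is nonnegative at the times `1, …, n`. -/
theorem reflectedLaw_succ_Iic (n : ℕ) {x : ℝ} (hx : 0 ≤ x) :
    reflectedLaw ζ (n + 1) (Set.Iic x) = ∫⁻ t, reflectedLaw ζ n (Set.Iic (x + t)) ∂ζ := by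
  rw [reflectedLaw, Measure.map_apply (by fun_prop) measurableSet_Iic,
    Measure.prod_apply_symm (measurableSet_Iic.preimage (by fun_prop))]
  refine lintegral_congr fun t => congrArg _ ?_
  ext m
  simp [hx]

omit [IsProbabilityMeasure ζ] in
theorem measurable_reflectedLaw_Iic (n : ℕ) :
    Measurable fun x => reflectedLaw ζ n (Set.Iic x) :=
  (show Monotone fun x => reflectedLaw ζ n (Set.Iic x) from
    fun _ _ hab => measure_mono (Set.Iic_subset_Iic.2 hab)).measurable

theorem antitone_reflectedLaw_Iic (x : ℝ) : Antitone fun n => reflectedLaw ζ n (Set.Iic x) := by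
  refine antitone_nat_of_succ_le fun n => ?_
  induction n generalizing x with
  | zero =>
    rcases lt_or_ge x 0 with hx | hx
    · simp [reflectedLaw_Iic_of_neg _ hx]
    · rw [reflectedLaw_zero_Iic hx]; exact prob_le_one
  | succ n ih =>
    rcases lt_or_ge x 0 with hx | hx
    · simp [reflectedLaw_Iic_of_neg _ hx]
    · rw [reflectedLaw_succ_Iic _ hx, reflectedLaw_succ_Iic _ hx]
      exact lintegral_mono fun t => ih _

/-- Taking the positive part does not increase the square, and the cross term vanishes because the
steps are centered. -/
theorem reflectedLaw_moments (h : IsCentered ζ) (n : ℕ) :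
    Integrable (fun m : ℝ => m ^ 2) (reflectedLaw ζ n) ∧
      ∫ m, m ^ 2 ∂(reflectedLaw ζ n) ≤ n * ∫ t, t ^ 2 ∂ζ := by
  induction n with
  | zero => 
    refine ⟨?_, ?_⟩
    · rw [reflectedLaw]; exact integrable_dirac (by simp)
    · simp [reflectedLaw]
  | succ n ih =>
    obtain ⟨ih1, ih2⟩ := ih
    have hi : Integrable (fun m : ℝ => m) (reflectedLaw ζ n) :=
      ((memLp_two_iff_integrable_sq measurable_id.aestronglyMeasurable).2 ih1).integrable
        (by norm_num)
    have i1 : Integrable (fun p : ℝ × ℝ => p.1 ^ 2) ((reflectedLaw ζ n).prod ζ) := ih1.comp_fst ζ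
    have i2 : Integrable (fun p : ℝ × ℝ => p.1 * p.2) ((reflectedLaw ζ n).prod ζ) :=
      hi.mul_prod h.integrable
    have i3 : Integrable (fun p : ℝ × ℝ => p.2 ^ 2) ((reflectedLaw ζ n).prod ζ) :=
      h.integrable_sq.comp_snd _
    have e : (fun p : ℝ × ℝ => (p.1 - p.2) ^ 2) =
        fun p => p.1 ^ 2 - 2 * (p.1 * p.2) + p.2 ^ 2 := by ext p; ring
    have i4 : Integrable (fun p : ℝ × ℝ => (p.1 - p.2) ^ 2) ((reflectedLaw ζ n).prod ζ) := by
      rw [e]; exact (i1.sub (i2.const_mul 2)).add i3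
    have hle : ∀ p : ℝ × ℝ, (max (p.1 - p.2) 0) ^ 2 ≤ (p.1 - p.2) ^ 2 := fun p => by
      rcases max_cases (p.1 - p.2) 0 with ⟨h1, _⟩ | ⟨h1, _⟩ <;> rw [h1]
      simp [sq_nonneg]
    have i5 : Integrable (fun p : ℝ × ℝ => (max (p.1 - p.2) 0) ^ 2) ((reflectedLaw ζ n).prod ζ) :=
      i4.mono' (by fun_prop) (Eventually.of_forall fun p => by
        rw [Real.norm_of_nonneg (sq_nonneg _)]; exact hle p)
    refine ⟨?_, ?_⟩
    · rw [reflectedLaw, integrable_map_measure (by fun_prop) (by fun_prop)]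
      exact i5
    · rw [reflectedLaw, integral_map (by fun_prop) (by fun_prop)]
      calc _ ≤ ∫ p : ℝ × ℝ, (p.1 - p.2) ^ 2 ∂((reflectedLaw ζ n).prod ζ) :=
            integral_mono i5 i4 hle
        _ = ∫ m, m ^ 2 ∂(reflectedLaw ζ n) + ∫ t, t ^ 2 ∂ζ := by
            have i12 : Integrable (fun p : ℝ × ℝ => p.1 ^ 2 - 2 * (p.1 * p.2))
              ((reflectedLaw ζ n).prod ζ) :=
              i1.sub (i2.const_mul 2)
            simp only [e]
            rw [integral_add i12 i3, integral_sub i1 (i2.const_mul 2), integral_const_mul,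
              integral_prod_mul (fun x : ℝ => x) (fun y : ℝ => y), h.mean,
              integral_fun_fst (fun x : ℝ => x ^ 2), integral_fun_snd (fun x : ℝ => x ^ 2)]
            simp
        _ ≤ _ := by push_cast; linarith

theorem integrable_reflectedLaw (h : IsCentered ζ) (n : ℕ) :
    Integrable (fun m : ℝ => m) (reflectedLaw ζ n) :=
  ((memLp_two_iff_integrable_sq measurable_id.aestronglyMeasurable).2
    (reflectedLaw_moments h n).1).integrable (by norm_num)

/-- Each reflection raises the mean by the expected value of (t - m)⁺, which is at least that of (t
- ε)⁺ on m ≤ ε. The probabilities of `(-∞, ε]` decrease in time, so the last one bounds all n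
contributions. -/
theorem integral_reflectedLaw_lower (h : IsCentered ζ) (ε : ℝ) (n : ℕ) :
    n * ((∫ t, max (t - ε) 0 ∂ζ) * (reflectedLaw ζ n).real (Set.Iic ε)) ≤
      ∫ m, m ∂(reflectedLaw ζ n) := by
  have hc : 0 ≤ ∫ t, max (t - ε) 0 ∂ζ := integral_nonneg fun t => le_max_right _ _
  have iε : Integrable (fun t => max (t - ε) 0) ζ :=
    (h.integrable.sub (integrable_const ε)).pos_part
  induction n with
  | zero => simp [reflectedLaw]
  | succ n ih =>
    have hi := integrable_reflectedLaw h n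
    have j1 : Integrable (fun p : ℝ × ℝ => p.1) ((reflectedLaw ζ n).prod ζ) := hi.comp_fst ζ
    have j2 : Integrable (fun p : ℝ × ℝ => p.2) ((reflectedLaw ζ n).prod ζ) :=
      h.integrable.comp_snd _
    have j3 : Integrable (fun p : ℝ × ℝ => max (p.2 - p.1) 0) ((reflectedLaw ζ n).prod ζ) :=
      (j2.sub j1).pos_part
    have j4 : Integrable (fun p : ℝ × ℝ => (Set.Iic ε).indicator (fun _ => (1 : ℝ)) p.1 *
        max (p.2 - ε) 0) ((reflectedLaw ζ n).prod ζ) :=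
      ((integrable_const (1 : ℝ)).indicator measurableSet_Iic).mul_prod iε
    have e1 : ∫ m, m ∂(reflectedLaw ζ (n + 1)) = ∫ m, m ∂(reflectedLaw ζ n) +
        ∫ p : ℝ × ℝ, max (p.2 - p.1) 0 ∂((reflectedLaw ζ n).prod ζ) := by
      rw [reflectedLaw, integral_map (by fun_prop) (by fun_prop)]
      have : ∀ p : ℝ × ℝ, max (p.1 - p.2) 0 = (p.1 - p.2) + max (p.2 - p.1) 0 := fun p => by
        rcases le_total p.1 p.2 with hp | hp
        · rw [max_eq_right (by linarith), max_eq_left (by linarith)]; ring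
        · rw [max_eq_left (by linarith), max_eq_right (by linarith)]; ring
      simp only [this]
      have := integral_add (j1.sub j2) j3
      simp only [Pi.sub_apply] at this
      rw [this, integral_sub j1 j2, integral_fun_fst (fun x : ℝ => x),
        integral_fun_snd (fun x : ℝ => x), h.mean]
      simp
    have e2 : (reflectedLaw ζ n).real (Set.Iic ε) * (∫ t, max (t - ε) 0 ∂ζ) ≤
        ∫ p : ℝ × ℝ, max (p.2 - p.1) 0 ∂((reflectedLaw ζ n).prod ζ) := by
      calc _ = ∫ p : ℝ × ℝ, (Set.Iic ε).indicator (fun _ => (1 : ℝ)) p.1 *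
            max (p.2 - ε) 0 ∂((reflectedLaw ζ n).prod ζ) := by
            rw [integral_prod_mul ((Set.Iic ε).indicator fun _ => (1 : ℝ))
              (fun t => max (t - ε) 0), integral_indicator_const _ measurableSet_Iic]
            simp
        _ ≤ _ := by
            refine integral_mono j4 j3 fun p => ?_
            by_cases hp : p.1 ≤ ε
            · simp only [Set.indicator, Set.mem_Iic, hp, if_true, one_mul]
              exact max_le_max (by linarith) le_rfl
            · simp [Set.indicator, hp]
    have e3 : (reflectedLaw ζ (n + 1)).real (Set.Iic ε) ≤ (reflectedLaw ζ n).real (Set.Iic ε) :=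
      ENNReal.toReal_mono (measure_ne_top _ _) (antitone_reflectedLaw_Iic ε n.le_succ)
    have e4 := mul_le_mul_of_nonneg_left e3 hc
    have e5 := mul_le_mul_of_nonneg_left e4 (by positivity : (0 : ℝ) ≤ n)
    rw [e1]
    push_cast
    nlinarith

/-- The mean grows at most like √n by the second moment, but at least like n times the probability
of `(-∞, ε]`; so this probability is O(1/√n). One step larger than ε transfers the conclusion from
`y` to `y + ε`. -/
theorem tendsto_reflectedLaw_Iic (h : IsCentered ζ) (x : ℝ) :
    Tendsto (fun n => reflectedLaw ζ n (Set.Iic x)) atTop (𝓝 0) := by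
  obtain ⟨ε, hε, hpos⟩ := h.exists_Ioi_pos
  have iε : Integrable (fun t => max (t - ε) 0) ζ :=
    (h.integrable.sub (integrable_const ε)).pos_part
  have hc : 0 < ∫ t, max (t - ε) 0 ∂ζ := by
    refine (integral_pos_iff_support_of_nonneg (f := fun t => max (t - ε) 0)
      (fun t => le_max_right _ _) iε).2 ?_
    convert hpos using 2
    ext t
    simp [Function.mem_support]
  set c := ∫ t, max (t - ε) 0 ∂ζ
  set V := ∫ t, t ^ 2 ∂ζ
  have base : Tendsto (fun n => reflectedLaw ζ n (Set.Iic ε)) atTop (𝓝 0) := by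
    have hb : ∀ n : ℕ, (reflectedLaw ζ (n + 1)).real (Set.Iic ε) ≤
        (V + 1) / (2 * c) * (1 / Real.sqrt ((n : ℝ) + 1)) := by
      intro n
      have h1 := integral_reflectedLaw_lower h ε (n + 1)
      obtain ⟨h2, h3⟩ := reflectedLaw_moments h (n + 1)
      have h4 := integrable_reflectedLaw h (n + 1)
      set s := Real.sqrt ((n : ℝ) + 1) with hs
      have hs0 : 0 < s := Real.sqrt_pos.2 (by positivity)
      have hs2 : s ^ 2 = (n : ℝ) + 1 := Real.sq_sqrt (by positivity)
      push_cast at h1 h3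
      rw [← hs2] at h1 h3
      -- The inequality 2sm ≤ m² + s² with s = √(n + 1) balances both terms at order n + 1.
      have h5 : 2 * s * ∫ m, m ∂(reflectedLaw ζ (n + 1)) ≤
          ∫ m, m ^ 2 ∂(reflectedLaw ζ (n + 1)) + s ^ 2 := by
        have : ∫ m, 2 * s * m ∂(reflectedLaw ζ (n + 1)) ≤
            ∫ m, (m ^ 2 + s ^ 2) ∂(reflectedLaw ζ (n + 1)) :=
          integral_mono (h4.const_mul _) (h2.add (integrable_const _)) fun m => by
            have := sq_nonneg (m - s)
            simp only
            nlinarith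
        rw [integral_const_mul, integral_add h2 (integrable_const _)] at this
        simpa using this
      set F := (reflectedLaw ζ (n + 1)).real (Set.Iic ε)
      rw [div_mul_div_comm, mul_one, le_div_iff₀ (by positivity)]
      have h6 : 2 * s * (s ^ 2 * (c * F)) ≤ s ^ 2 * V + s ^ 2 :=
        (mul_le_mul_of_nonneg_left h1 (by positivity)).trans (h5.trans (by linarith))
      have h7 : s ^ 2 * (F * (2 * c * s)) ≤ s ^ 2 * (V + 1) := by nlinarith
      exact le_of_mul_le_mul_left h7 (by positivity)
    have hlim : Tendsto (fun n : ℕ => (V + 1) / (2 * c) * (1 / Real.sqrt ((n : ℝ) + 1))) atTop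
        (𝓝 0) := by
      rw [← mul_zero ((V + 1) / (2 * c))]
      refine Tendsto.const_mul _ ?_
      simp only [one_div]
      refine tendsto_inv_atTop_zero.comp (Real.tendsto_sqrt_atTop.comp ?_)
      exact tendsto_atTop_add_const_right _ _ tendsto_natCast_atTop_atTop
    have := squeeze_zero (fun n => measureReal_nonneg) hb hlim
    rw [← tendsto_add_atTop_iff_nat 1]
    have h8 := ENNReal.tendsto_ofReal this
    simpa [ofReal_measureReal] using h8
  have step : ∀ y : ℝ, 0 ≤ y → Tendsto (fun n => reflectedLaw ζ n (Set.Iic y)) atTop (𝓝 0) →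
      Tendsto (fun n => reflectedLaw ζ n (Set.Iic (y + ε))) atTop (𝓝 0) := by
    intro y hy hlim
    have hle : ∀ n, reflectedLaw ζ n (Set.Iic (y + ε)) ≤
        reflectedLaw ζ (n + 1) (Set.Iic y) / ζ (Set.Ioi ε) := by
      intro n
      rw [ENNReal.le_div_iff_mul_le (Or.inl hpos.ne') (Or.inl (measure_ne_top _ _)),
        reflectedLaw_succ_Iic n hy, ← setLIntegral_const]
      refine le_trans (setLIntegral_mono' measurableSet_Ioi fun t ht => ?_)
        (setLIntegral_le_lintegral (Set.Ioi ε) _)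
      refine measure_mono (Set.Iic_subset_Iic.2 ?_)
      have := Set.mem_Ioi.1 ht
      linarith
    have h1 : Tendsto (fun n => reflectedLaw ζ (n + 1) (Set.Iic y) / ζ (Set.Ioi ε))
      atTop (𝓝 0) := by
      have := ENNReal.Tendsto.div_const ((tendsto_add_atTop_iff_nat 1).2 hlim)
        (Or.inr hpos.ne')
      simpa using this
    exact tendsto_of_tendsto_of_tendsto_of_le_of_le tendsto_const_nhds h1 (fun _ => zero_le) hle
  have all : ∀ k : ℕ, Tendsto (fun n => reflectedLaw ζ n (Set.Iic ((k + 1 : ℕ) * ε))) atTop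
      (𝓝 0) := by
    intro k
    induction k with
    | zero => simpa using base
    | succ k ih =>
      have := step _ (by positivity) ih
      convert this using 4
      push_cast; ring
  obtain ⟨k, hk⟩ := exists_nat_ge (x / ε)
  refine tendsto_of_tendsto_of_tendsto_of_le_of_le tendsto_const_nhds (all k) (fun _ => zero_le)
    fun n => measure_mono (Set.Iic_subset_Iic.2 ?_)
  rw [div_le_iff₀ hε] at hk
  push_cast
  nlinarith

end Reflected

/-! ### Almost sure exit: the ladder laws are probability measures. -/

section Mass

variable {ζ : Measure ℝ}

theorem killed_mono [IsProbabilityMeasure ζ] {S T : Set ℝ} (hST : S ⊆ T) (n : ℕ) :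
    killed ζ S n ≤ killed ζ T n := by
  induction n with
  | zero => exact le_rfl
  | succ n ih => exact Measure.restrict_mono hST (Measure.conv_mono ih le_rfl)

theorem Measure.map_neg_conv (a b : Measure ℝ) [SFinite a] [SFinite b] :
    (a ∗ b).map (fun t => -t) = a.map (fun t => -t) ∗ b.map (fun t => -t) :=
  Measure.map_conv_addMonoidHom (negAddMonoidHom : ℝ →+ ℝ) measurable_neg

theorem killed_map_neg [IsProbabilityMeasure ζ] {S : Set ℝ} (hS : MeasurableSet S) (n : ℕ) :
    killed (ζ.map fun t => -t) ((fun t => -t) ⁻¹' S) n = (killed ζ S n).map fun t => -t := by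
  induction n with
  | zero => simp [killed]
  | succ n ih =>
    rw [killed, killed, ih, ← Measure.map_neg_conv, Measure.restrict_map (by fun_prop)
      (hS.preimage measurable_neg)]
    congr 2
    ext t; simp

theorem killed_compl (S : Set ℝ) (hS : (0 : ℝ) ∈ S) (n : ℕ) (hm : MeasurableSet S) :
    killed ζ S n Sᶜ = 0 := by
  cases n with
  | zero => simp [killed, hm.compl, hS]
  | succ n => rw [killed, Measure.restrict_apply hm.compl, Set.compl_inter_self, measure_empty]

variable [IsProbabilityMeasure ζ]

/-- The Markov property at time n: surviving n steps and then k more from the position reached is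
surviving n + k steps. -/
theorem lintegral_killed_le (n k : ℕ) :
    ∫⁻ x, reflectedLaw ζ k (Set.Iic x) ∂(killed ζ (Set.Ici 0) n) ≤
      reflectedLaw ζ (n + k) (Set.Iic 0) := by
  induction n generalizing k with
  | zero => simp [killed, lintegral_dirac' _ (measurable_reflectedLaw_Iic k)]
  | succ n ih =>
    calc _ ≤ ∫⁻ x, reflectedLaw ζ k (Set.Iic x) ∂(killed ζ (Set.Ici 0) n ∗ ζ) :=
          setLIntegral_le_lintegral _ _
      _ = ∫⁻ x, ∫⁻ t, reflectedLaw ζ k (Set.Iic (x + t)) ∂ζ ∂(killed ζ (Set.Ici 0) n) :=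
          Measure.lintegral_conv (measurable_reflectedLaw_Iic k)
      _ = ∫⁻ x, reflectedLaw ζ (k + 1) (Set.Iic x) ∂(killed ζ (Set.Ici 0) n) := by
          refine lintegral_congr_ae ?_
          have : ∀ᵐ x ∂(killed ζ (Set.Ici 0) n), x ∈ Set.Ici (0 : ℝ) :=
            killed_compl (Set.Ici 0) Set.self_mem_Ici n measurableSet_Ici
          filter_upwards [this] with x hx
          rw [reflectedLaw_succ_Iic k hx]
      _ ≤ _ := by
          have := ih (k + 1)
          rwa [show n + (k + 1) = n + 1 + k by ring] at this

theorem killed_Ici_univ_le (n : ℕ) :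
    killed ζ (Set.Ici 0) n Set.univ ≤ reflectedLaw ζ n (Set.Iic 0) := by
  refine le_trans ?_ (lintegral_killed_le (ζ := ζ) n 0)
  rw [← lintegral_one]
  refine lintegral_mono_ae ?_
  have : ∀ᵐ x ∂(killed ζ (Set.Ici 0) n), x ∈ Set.Ici (0 : ℝ) :=
    killed_compl (Set.Ici 0) Set.self_mem_Ici n measurableSet_Ici
  filter_upwards [this] with x hx
  rw [reflectedLaw_zero_Iic hx]

theorem tendsto_killed_Ici (h : IsCentered ζ) :
    Tendsto (fun n => killed ζ (Set.Ici 0) n Set.univ) atTop (𝓝 0) :=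
  tendsto_of_tendsto_of_tendsto_of_le_of_le tendsto_const_nhds (tendsto_reflectedLaw_Iic h 0)
    (fun _ => zero_le) killed_Ici_univ_le

theorem tendsto_killed_Ioi (h : IsCentered ζ) :
    Tendsto (fun n => killed ζ (Set.Ioi 0) n Set.univ) atTop (𝓝 0) :=
  tendsto_of_tendsto_of_tendsto_of_le_of_le tendsto_const_nhds (tendsto_killed_Ici h)
    (fun _ => zero_le) fun n => killed_mono Set.Ioi_subset_Ici_self n _

theorem tendsto_killed_Iic (h : IsCentered ζ) :
    Tendsto (fun n => killed ζ (Set.Iic 0) n Set.univ) atTop (𝓝 0) := by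
  refine (tendsto_killed_Ici h.map_neg).congr fun n => ?_
  have : Set.Ici (0 : ℝ) = (fun t => -t) ⁻¹' Set.Iic 0 := by ext t; simp
  rw [this, killed_map_neg measurableSet_Iic, Measure.map_apply (by fun_prop) MeasurableSet.univ,
    Set.preimage_univ]

theorem sum_exitLaw_univ {S : Set ℝ} (hS : MeasurableSet S) (N : ℕ) :
    ∑ n ∈ Finset.range N, exitLaw ζ S n Set.univ + killed ζ S N Set.univ = 1 := by
  induction N with
  | zero => simp [killed]
  | succ N ih =>
    rw [← ih, Finset.sum_range_succ, add_assoc, add_comm (exitLaw ζ S N _)]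
    congr 1
    rw [← Measure.add_apply, ← killed_conv hS, Measure.conv,
      Measure.map_apply (by fun_prop) MeasurableSet.univ]
    simp [← Set.univ_prod_univ]

theorem ladderLaw_univ {S : Set ℝ} (hS : MeasurableSet S)
    (h : Tendsto (fun n => killed ζ S n Set.univ) atTop (𝓝 0)) : ladderLaw ζ S Set.univ = 1 := by
  rw [ladderLaw, Measure.sum_apply _ MeasurableSet.univ]
  have h1 := (ENNReal.summable (f := fun n => exitLaw ζ S n Set.univ)).hasSum.tendsto_sum_nat
  have h2 := h1.add h
  simp only [sum_exitLaw_univ hS, add_zero] at h2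
  exact (tendsto_nhds_unique tendsto_const_nhds h2).symm

theorem isProbabilityMeasure_ladderLaw_Iic (h : IsCentered ζ) :
    IsProbabilityMeasure (ladderLaw ζ (Set.Iic 0)) :=
  ⟨ladderLaw_univ measurableSet_Iic (tendsto_killed_Iic h)⟩

theorem isProbabilityMeasure_ladderLaw_Ioi (h : IsCentered ζ) :
    IsProbabilityMeasure (ladderLaw ζ (Set.Ioi 0)) :=
  ⟨ladderLaw_univ measurableSet_Ioi (tendsto_killed_Ioi h)⟩

end Mass

/-! ### Linear growth of the Green measures. -/

section Growth

theorem measure_Icc_le_of_window {m : Measure ℝ} {ε c : ℝ} (hε : 0 < ε)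
    (h : ∀ x, m (Set.Icc (x - ε) x) ≤ ENNReal.ofReal c) :
    ∃ C : ℝ, 0 < C ∧ ∀ x L : ℝ, 0 ≤ L → m (Set.Icc x (x + L)) ≤ ENNReal.ofReal (C * (1 + L)) := by
  refine ⟨(|c| + 1) * (1 + 1 / ε), by positivity, fun x L hL => ?_⟩
  set N := ⌊L / ε⌋₊ + 1 with hN
  have hcov : Set.Icc x (x + L) ⊆ ⋃ k ∈ Finset.range N,
      Set.Icc (x + (k + 1) * ε - ε) (x + (k + 1) * ε) := by
    intro y hy
    have h0 : 0 ≤ (y - x) / ε := div_nonneg (by linarith [hy.1]) hε.le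
    simp only [Set.mem_iUnion, Finset.mem_range]
    refine ⟨⌊(y - x) / ε⌋₊, ?_, ?_, ?_⟩
    · rw [hN, Nat.lt_succ_iff]
      exact Nat.floor_le_floor (by gcongr; linarith [hy.2])
    · have := Nat.floor_le h0
      rw [le_div_iff₀ hε] at this
      linarith
    · have := Nat.lt_floor_add_one ((y - x) / ε)
      rw [div_lt_iff₀ hε] at this
      linarith
  have hN' : (N : ℝ) ≤ 1 + L / ε := by
    have := Nat.floor_le (div_nonneg hL hε.le)
    rw [hN]; push_cast; linarith
  calc m (Set.Icc x (x + L)) ≤ ∑ k ∈ Finset.range N,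
        m (Set.Icc (x + (k + 1) * ε - ε) (x + (k + 1) * ε)) :=
        (measure_mono hcov).trans (measure_biUnion_finset_le _ _)
    _ ≤ ∑ _k ∈ Finset.range N, ENNReal.ofReal c := Finset.sum_le_sum fun k _ => h _
    _ = ENNReal.ofReal (N * c) := by
        rw [Finset.sum_const, Finset.card_range, nsmul_eq_mul, ENNReal.ofReal_mul (by positivity),
          ENNReal.ofReal_natCast]
    _ ≤ _ := by
        refine ENNReal.ofReal_le_ofReal ?_
        have h1 : (1 + L / ε) ≤ (1 + 1 / ε) * (1 + L) := by
          have : 0 ≤ 1 / ε := by positivity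
          have e : L / ε = 1 / ε * L := by ring
          rw [e]; nlinarith
        calc (N : ℝ) * c ≤ N * (|c| + 1) := by gcongr; linarith [le_abs_self c]
          _ ≤ (1 + L / ε) * (|c| + 1) := by gcongr
          _ ≤ (1 + 1 / ε) * (1 + L) * (|c| + 1) := by gcongr
          _ = _ := by ring

variable {ζ : Measure ℝ} [IsProbabilityMeasure ζ]

omit [IsProbabilityMeasure ζ] in
theorem green_Ioi_Iio : green ζ (Set.Ioi 0) (Set.Iio 0) = 0 := by
  rw [green, Measure.sum_apply _ measurableSet_Iio]
  simp [killed_Ioi_Iio]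

omit [IsProbabilityMeasure ζ] in
theorem ladderLaw_Iic_Iic : ladderLaw ζ (Set.Iic 0) (Set.Iic 0) = 0 := by
  rw [ladderLaw, Measure.sum_apply _ measurableSet_Iic]
  simp [exitLaw_Iic_Iic]

omit [IsProbabilityMeasure ζ] in
theorem ladderLaw_Ioi_Ioi : ladderLaw ζ (Set.Ioi 0) (Set.Ioi 0) = 0 := by
  rw [ladderLaw, Measure.sum_apply _ measurableSet_Ioi]
  simp [exitLaw_Ioi_Ioi]

theorem restrict_le_ladderLaw (S : Set ℝ) : ζ.restrict Sᶜ ≤ ladderLaw ζ S := by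
  have h : ζ.restrict Sᶜ = exitLaw ζ S 0 := by simp [exitLaw, killed]
  rw [h]
  exact Measure.le_sum _ 0

theorem exists_green_Ioi_Icc_le (h : IsCentered ζ) : ∃ C : ℝ, 0 < C ∧
    ∀ x L : ℝ, 0 ≤ L → green ζ (Set.Ioi 0) (Set.Icc x (x + L)) ≤ ENNReal.ofReal (C * (1 + L)) := by
  obtain ⟨ε, hε, hpos⟩ := h.exists_Ioi_pos
  have := isProbabilityMeasure_ladderLaw_Iic h
  have hG : 0 < ladderLaw ζ (Set.Iic 0) (Set.Ioi ε) := by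
    refine lt_of_lt_of_le ?_ (restrict_le_ladderLaw _ _)
    rw [Measure.restrict_apply measurableSet_Ioi, Set.compl_Iic,
      Set.inter_eq_left.2 (Set.Ioi_subset_Ioi hε.le)]
    exact hpos
  refine measure_Icc_le_of_window (c := (ladderLaw ζ (Set.Iic 0) (Set.Ioi ε))⁻¹.toReal) hε
    fun x => ?_
  rw [ENNReal.ofReal_toReal (ENNReal.inv_ne_top.2 hG.ne'), ← one_div,
    ENNReal.le_div_iff_mul_le (Or.inl hG.ne') (Or.inl (measure_ne_top _ _))]
  exact window_bound_sum rfl (fun n => killed_Ioi_succ_eq n)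
    (show ladderLaw ζ (Set.Iic 0) Set.univ ≤ 1 from prob_le_one)
    (measure_mono_null Set.Iio_subset_Iic_self ladderLaw_Iic_Iic) x ε

/-- The window bound applied after the reflection t ↦ -t. The descending ladder heights may charge
`0`, which is why that bound only asks for nonnegative steps. -/
theorem exists_green_Iic_Icc_le (h : IsCentered ζ) : ∃ C : ℝ, 0 < C ∧
    ∀ L : ℝ, 0 ≤ L → green ζ (Set.Iic 0) (Set.Icc (-L) 0) ≤ ENNReal.ofReal (C * (1 + L)) := by
  obtain ⟨ε, hε, hpos⟩ := h.map_neg.exists_Ioi_pos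
  have := isProbabilityMeasure_ladderLaw_Ioi h
  have hneg : Measurable fun t : ℝ => -t := measurable_neg
  set k : ℕ → Measure ℝ := fun n => (killed ζ (Set.Iic 0) n).map fun t => -t with hk
  set e : ℕ → Measure ℝ := fun n => (exitLaw ζ (Set.Ioi 0) n).map fun t => -t with he
  have hk0 : k 0 = Measure.dirac 0 := by simp [hk, killed]
  have hsum : Measure.sum k = (green ζ (Set.Iic 0)).map fun t => -t :=
    (Measure.map_sum hneg.aemeasurable).symm
  have hsume : Measure.sum e = (ladderLaw ζ (Set.Ioi 0)).map fun t => -t :=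
    (Measure.map_sum hneg.aemeasurable).symm
  have : IsProbabilityMeasure (Measure.sum e) := by
    rw [hsume]; exact Measure.isProbabilityMeasure_map hneg.aemeasurable
  have hks : ∀ n, k (n + 1) = ∑ p ∈ antidiagonal n, e p.1 ∗ k p.2 := by
    intro n
    simp only [hk, he, killed_Iic_succ_eq]
    rw [← Measure.mapₗ_apply_of_measurable hneg, map_sum,
      ← Finset.Nat.sum_antidiagonal_swap]
    refine Finset.sum_congr rfl fun p _ => ?_
    rw [Measure.mapₗ_apply_of_measurable hneg, Measure.map_neg_conv, Measure.conv_comm]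
    rfl
  have he0 : Measure.sum e (Set.Iio 0) = 0 := by
    rw [hsume, Measure.map_apply hneg measurableSet_Iio]
    refine measure_mono_null (fun t ht => ?_) (ladderLaw_Ioi_Ioi (ζ := ζ))
    simpa using ht
  have hG : 0 < Measure.sum e (Set.Ioi ε) := by
    rw [hsume, Measure.map_apply hneg measurableSet_Ioi]
    refine lt_of_lt_of_le ?_ (restrict_le_ladderLaw _ _)
    rw [Measure.restrict_apply (measurableSet_Ioi.preimage hneg), Set.compl_Ioi,
      Set.inter_eq_left.2]
    · rwa [Measure.map_apply hneg measurableSet_Ioi] at hpos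
    · intro t ht
      simp only [Set.mem_preimage, Set.mem_Ioi, Set.mem_Iic] at *
      linarith
  obtain ⟨C, hC, hCb⟩ := measure_Icc_le_of_window (m := Measure.sum k)
    (c := (Measure.sum e (Set.Ioi ε))⁻¹.toReal) hε fun x => by
      rw [ENNReal.ofReal_toReal (ENNReal.inv_ne_top.2 hG.ne'), ← one_div,
        ENNReal.le_div_iff_mul_le (Or.inl hG.ne') (Or.inl (measure_ne_top _ _))]
      exact window_bound_sum hk0 hks prob_le_one he0 x ε
  refine ⟨C, hC, fun L hL => ?_⟩
  have := hCb 0 L hL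
  rw [hsum, Measure.map_apply hneg measurableSet_Icc] at this
  convert this using 2
  ext t
  simp only [Set.mem_Icc, Set.mem_preimage]
  constructor <;> rintro ⟨h1, h2⟩ <;> constructor <;> linarith

/-- A finite total mass would exceed itself by 1, by the renewal equation with a probability step
law. -/
theorem green_Ioi_univ (h : IsCentered ζ) : green ζ (Set.Ioi 0) Set.univ = ∞ := by
  have := isProbabilityMeasure_ladderLaw_Iic h
  by_contra hne
  have h1 := congrArg (fun m => m Set.univ) (green_Ioi_eq (ζ := ζ))
  simp only [Measure.add_apply] at h1
  have h2 : (ladderLaw ζ (Set.Iic 0) ∗ green ζ (Set.Ioi 0)) Set.univ =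
      green ζ (Set.Ioi 0) Set.univ := by
    rw [Measure.conv, Measure.map_apply (by fun_prop) MeasurableSet.univ, Set.preimage_univ,
      ← Set.univ_prod_univ, Measure.prod_prod, measure_univ, one_mul]
  rw [h2, show (Measure.dirac (0 : ℝ)) Set.univ = 1 from measure_univ] at h1
  have h3 : (0 : ℝ≥0∞) + green ζ (Set.Ioi 0) Set.univ = 1 + green ζ (Set.Ioi 0) Set.univ := by
    rw [zero_add]; exact h1
  exact zero_ne_one ((ENNReal.add_left_inj hne).1 h3)

theorem measure_Iic_lt_top {m : Measure ℝ} {C : ℝ} (h0 : m (Set.Iio 0) = 0)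
    (hC : ∀ x L : ℝ, 0 ≤ L → m (Set.Icc x (x + L)) ≤ ENNReal.ofReal (C * (1 + L))) (x : ℝ) :
    m (Set.Iic x) < ∞ := by
  calc m (Set.Iic x) ≤ m (Set.Iio 0 ∪ Set.Icc 0 (0 + |x|)) := by
        refine measure_mono fun y hy => ?_
        rcases lt_or_ge y 0 with h0 | h0
        · exact Or.inl h0
        · exact Or.inr ⟨h0, by rw [zero_add]; exact le_trans hy (le_abs_self x)⟩
    _ ≤ 0 + ENNReal.ofReal (C * (1 + |x|)) :=
        (measure_union_le _ _).trans (add_le_add h0.le (hC 0 _ (abs_nonneg x)))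
    _ < ∞ := by rw [zero_add]; exact ENNReal.ofReal_lt_top

theorem green_Ioi_Iic_lt_top (h : IsCentered ζ) (x : ℝ) : green ζ (Set.Ioi 0) (Set.Iic x) < ∞ := by
  obtain ⟨C, -, hC⟩ := exists_green_Ioi_Icc_le h
  exact measure_Iic_lt_top green_Ioi_Iio hC x

end Growth

/-! ### The invariant measure: existence and uniqueness. -/

section Invariant

variable (ζ : Measure ℝ) [IsProbabilityMeasure ζ]

/-- The occupation measure of an excursion of the chain `Y ↦ max (Y + z) 0` away from `0`. -/
noncomputable def excursionMeasure : Measure ℝ≥0 := (green ζ (Set.Ioi 0)).map Real.toNNReal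

variable {ζ}

theorem bind_lindleyKernel_apply (π : Measure ℝ≥0) {s : Set ℝ≥0} (hs : MeasurableSet s) :
    π.bind (lindleyKernel ζ) s = ∫⁻ y, lindleyKernel ζ y s ∂π :=
  Measure.bind_apply hs (lindleyKernel ζ).aemeasurable

/-- One step of the chain is a free step followed by the positive part, so the chain can be handled
by convolutions on the line. -/
theorem bind_lindleyKernel (m : Measure ℝ) [SFinite m] (hm : m (Set.Iio 0) = 0) :
    (m.map Real.toNNReal).bind (lindleyKernel ζ) = (m ∗ ζ).map Real.toNNReal := by
  ext s hs
  rw [bind_lindleyKernel_apply _ hs, lintegral_map ((lindleyKernel ζ).measurable_coe hs)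
    (by fun_prop), Measure.map_apply (by fun_prop) hs,
    ← lintegral_indicator_one (hs.preimage measurable_real_toNNReal),
    Measure.lintegral_conv (measurable_one.indicator (hs.preimage measurable_real_toNNReal))]
  have h0 : ∀ᵐ x ∂m, 0 ≤ x := by
    rw [ae_iff]; simpa [Set.Iio] using hm
  refine lintegral_congr_ae ?_
  filter_upwards [h0] with x hx
  have hf : Measurable fun t : ℝ => ((x.toNNReal : ℝ) + t).toNNReal := by fun_prop
  rw [lindleyKernel_apply, Measure.map_apply hf hs, ← lintegral_indicator_one (hs.preimage hf)]
  refine lintegral_congr fun t => ?_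
  change s.indicator (1 : ℝ≥0 → ℝ≥0∞) ((x.toNNReal : ℝ) + t).toNNReal =
    s.indicator (1 : ℝ≥0 → ℝ≥0∞) (x + t).toNNReal
  rw [Real.coe_toNNReal x hx]

theorem green_conv (S : Set ℝ) (hS : MeasurableSet S) : green ζ S ∗ ζ =
    Measure.sum (fun n => killed ζ S (n + 1)) + ladderLaw ζ S := by
  rw [ladderLaw, Measure.sum_add_sum, green]
  unfold Measure.conv
  rw [Measure.prod_sum_left, Measure.map_sum (by fun_prop)]
  congr 1
  ext1 n
  exact killed_conv hS n

omit [IsProbabilityMeasure ζ] in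
theorem green_eq_dirac_add (S : Set ℝ) : green ζ S =
    Measure.dirac 0 + Measure.sum (fun n => killed ζ S (n + 1)) := by
  ext s hs
  rw [green, Measure.sum_apply _ hs, tsum_eq_zero_add' ENNReal.summable, Measure.add_apply,
    Measure.sum_apply _ hs]
  rfl

theorem ladderLaw_Ioi_map (h : IsCentered ζ) :
    (ladderLaw ζ (Set.Ioi 0)).map Real.toNNReal = Measure.dirac 0 := by
  have := isProbabilityMeasure_ladderLaw_Ioi h
  have h0 : Real.toNNReal =ᵐ[ladderLaw ζ (Set.Ioi 0)] fun _ => 0 := by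
    refine measure_mono_null (fun t ht => ?_) (ladderLaw_Ioi_Ioi (ζ := ζ))
    simp only [Set.mem_compl_iff, Set.mem_ofPred_eq, Real.toNNReal_eq_zero, not_le] at ht
    exact ht
  rw [Measure.map_congr h0, Measure.map_const, measure_univ, one_smul]

/-- One step turns the occupation measure into its positive-time part plus the exit law. The
positive part map sends the exit law, a probability measure on `(-∞, 0]`, to the missing Dirac mass
at `0`. -/
theorem invariant_excursionMeasure (h : IsCentered ζ) :
    (lindleyKernel ζ).Invariant (excursionMeasure ζ) := by
  rw [Kernel.Invariant, excursionMeasure, bind_lindleyKernel _ green_Ioi_Iio,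
    green_conv _ measurableSet_Ioi, Measure.map_add _ _ (by fun_prop), ladderLaw_Ioi_map h]
  conv_rhs => rw [green_eq_dirac_add, Measure.map_add _ _ (by fun_prop),
    Measure.map_dirac' (by fun_prop), Real.toNNReal_zero]
  rw [add_comm]

omit [IsProbabilityMeasure ζ] in
theorem excursionMeasure_Icc (x : ℝ≥0) :
    excursionMeasure ζ (Set.Icc 0 x) = green ζ (Set.Ioi 0) (Set.Iic x) := by
  rw [excursionMeasure, Measure.map_apply (by fun_prop) measurableSet_Icc]
  congr 1
  ext t
  simp [Real.toNNReal_le_iff_le_coe]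

theorem excursionMeasure_Icc_lt_top (h : IsCentered ζ) (x : ℝ≥0) :
    excursionMeasure ζ (Set.Icc 0 x) < ∞ := by
  rw [excursionMeasure_Icc]
  exact green_Ioi_Iic_lt_top h x

theorem excursionMeasure_univ (h : IsCentered ζ) : excursionMeasure ζ Set.univ = ∞ := by
  rw [excursionMeasure, Measure.map_apply (by fun_prop) MeasurableSet.univ, Set.preimage_univ,
    green_Ioi_univ h]

theorem sigmaFinite_excursionMeasure (h : IsCentered ζ) : SigmaFinite (excursionMeasure ζ) := by
  have : IsLocallyFiniteMeasure (excursionMeasure ζ) := by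
    refine ⟨fun x => ⟨Set.Iic (x + 1), Iic_mem_nhds (by simp), ?_⟩⟩
    have := excursionMeasure_Icc_lt_top h (x + 1)
    rwa [← bot_eq_zero, Set.Icc_bot] at this
  infer_instance

omit [IsProbabilityMeasure ζ] in
theorem excursionMeasure_singleton_zero : excursionMeasure ζ {0} = 1 := by
  rw [excursionMeasure, Measure.map_apply (by fun_prop) (measurableSet_singleton _),
    green_eq_dirac_add, Measure.add_apply, Measure.dirac_apply' _
    ((measurableSet_singleton _).preimage measurable_real_toNNReal)]
  have : Measure.sum (fun n => killed ζ (Set.Ioi 0) (n + 1)) (Real.toNNReal ⁻¹' {0}) = 0 := by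
    rw [Measure.sum_apply _ ((measurableSet_singleton _).preimage measurable_real_toNNReal),
      ENNReal.tsum_eq_zero]
    intro n
    rw [killed, Measure.restrict_apply
      ((measurableSet_singleton _).preimage measurable_real_toNNReal)]
    convert measure_empty (μ := killed ζ (Set.Ioi 0) n ∗ ζ)
    ext t
    simp
  rw [this]
  simp

/-- Iterating the equation keeps alive the mass that starts at `0`: by induction on N, the
occupation measure of the first N times, weighted by the atom, stays below `m`. -/
theorem smul_green_le {m : Measure ℝ} [SFinite m]
    (hm : m.restrict (Set.Ioi 0) = (m ∗ ζ).restrict (Set.Ioi 0)) :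
    m {0} • green ζ (Set.Ioi 0) ≤ m := by
  have hr : m.restrict (Set.Ioi 0) + m.restrict (Set.Ioi 0)ᶜ = m :=
    Measure.restrict_add_restrict_compl measurableSet_Ioi
  have ha : m {0} • Measure.dirac 0 ≤ m.restrict (Set.Ioi 0)ᶜ := by
    refine Measure.le_iff.2 fun s hs => ?_
    rw [Measure.smul_apply, Measure.dirac_apply' _ hs, Measure.restrict_apply hs, smul_eq_mul]
    by_cases h0 : (0 : ℝ) ∈ s
    · simp only [h0, Set.indicator_of_mem, Pi.one_apply, mul_one]
      exact measure_mono (by simpa using h0)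
    · simp [h0]
  generalize m {0} = a at ha
  have key : ∀ N, a • ∑ n ∈ Finset.range N, killed ζ (Set.Ioi 0) n ≤ m := by
    intro N
    induction N with
    | zero => simpa using Measure.zero_le m
    | succ N ih =>
      have h1 : ∑ n ∈ Finset.range N, killed ζ (Set.Ioi 0) (n + 1) =
          ((∑ n ∈ Finset.range N, killed ζ (Set.Ioi 0) n) ∗ ζ).restrict (Set.Ioi 0) := by
        rw [Measure.conv_comm, conv_finset_sum, ← Measure.restrictₗ_apply, map_sum]
        refine Finset.sum_congr rfl fun n _ => ?_
        rw [killed, Measure.conv_comm]; rfl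
      rw [Finset.sum_range_succ', h1, smul_add, ← Measure.restrict_smul, ← Measure.conv_smul_left]
      refine (add_le_add (Measure.restrict_mono le_rfl (Measure.conv_mono ih le_rfl)) ha).trans ?_
      rw [← hm, hr]
  refine Measure.le_iff.2 fun s hs => ?_
  rw [Measure.smul_apply, green, Measure.sum_apply _ hs, ENNReal.tsum_eq_iSup_nat, smul_eq_mul,
    ENNReal.mul_iSup]
  refine iSup_le fun N => ?_
  have := key N s
  rwa [Measure.smul_apply, Measure.coe_finsetSum, Finset.sum_apply] at this

theorem restrict_Ioi_of_invariant {π : Measure ℝ≥0} [SFinite π]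
    (hπ : (lindleyKernel ζ).Invariant π) :
    (π.map ((↑) : ℝ≥0 → ℝ)).restrict (Set.Ioi 0) =
      (π.map ((↑) : ℝ≥0 → ℝ) ∗ ζ).restrict (Set.Ioi 0) := by
  have h0 : (π.map ((↑) : ℝ≥0 → ℝ)) (Set.Iio 0) = 0 := by
    rw [Measure.map_apply (by fun_prop) measurableSet_Iio]
    convert measure_empty (μ := π)
    ext y; simp
  have h1 : (π.map ((↑) : ℝ≥0 → ℝ)).map Real.toNNReal = π := by
    rw [Measure.map_map (by fun_prop) (by fun_prop)]
    convert Measure.map_id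
    ext y; simp
  have h2 := bind_lindleyKernel (ζ := ζ) _ h0
  rw [h1, hπ.def] at h2
  ext s hs
  rw [Measure.restrict_apply hs, Measure.restrict_apply hs]
  have hs' := hs.inter (measurableSet_Ioi (a := (0 : ℝ)))
  conv_lhs => rw [h2, Measure.map_map (by fun_prop) (by fun_prop),
    Measure.map_apply (by fun_prop) hs']
  congr 1
  ext t
  simp only [Set.mem_preimage, Function.comp_apply, Set.mem_inter_iff, Set.mem_Ioi,
    Real.coe_toNNReal']
  rcases lt_or_ge 0 t with ht | ht
  · rw [max_eq_left ht.le]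
  · rw [max_eq_right ht]; simp [not_lt.2 ht]

theorem smul_excursionMeasure_le {π : Measure ℝ≥0} [SFinite π]
    (hπ : (lindleyKernel ζ).Invariant π) : π {0} • excursionMeasure ζ ≤ π := by
  have h1 : (π.map ((↑) : ℝ≥0 → ℝ)).map Real.toNNReal = π := by
    rw [Measure.map_map (by fun_prop) (by fun_prop)]
    convert Measure.map_id
    ext y; simp
  have h2 : (π.map ((↑) : ℝ≥0 → ℝ)) {0} = π {0} := by
    rw [Measure.map_apply (by fun_prop) (measurableSet_singleton _)]
    congr 1
    ext y; simp
  have h3 := Measure.map_mono (smul_green_le (restrict_Ioi_of_invariant hπ))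
    measurable_real_toNNReal
  rwa [h1, h2, Measure.map_smul] at h3

/-- If `[0, nε]` is null, no point of `[0, (n + 1)ε]` can carry mass, since steps below -ε have
positive probability and would send that mass into `[0, nε]`. -/
theorem eq_zero_of_invariant (h : IsCentered ζ) {π : Measure ℝ≥0}
    (hπ : (lindleyKernel ζ).Invariant π) (h0 : π {0} = 0) : π = 0 := by
  obtain ⟨ε, hε, hpos⟩ := h.map_neg.exists_Ioi_pos
  rw [Measure.map_apply measurable_neg measurableSet_Ioi] at hpos
  have key : ∀ n : ℕ, π (Set.Iic (n * ε.toNNReal)) = 0 := by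
    intro n
    induction n with
    | zero => simpa [Set.Iic, le_zero_iff] using h0
    | succ n ih =>
      have h1 := bind_lindleyKernel_apply (ζ := ζ) π (s := Set.Iic (n * ε.toNNReal))
        measurableSet_Iic
      rw [hπ.def, ih, eq_comm, lintegral_eq_zero_iff
        ((lindleyKernel ζ).measurable_coe measurableSet_Iic)] at h1
      refine measure_mono_null (fun y hy => ?_) h1
      simp only [Set.mem_compl_iff, Set.mem_ofPred_eq, Pi.zero_apply]
      rw [lindleyKernel_apply, Measure.map_apply (by fun_prop) measurableSet_Iic]
      refine (lt_of_lt_of_le hpos (measure_mono fun t ht => ?_)).ne'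
      simp only [Set.mem_preimage, Set.mem_Ioi, Set.mem_Iic] at ht hy ⊢
      rw [Real.toNNReal_le_iff_le_coe]
      have hy' : (y : ℝ) ≤ ((n + 1 : ℕ) * ε.toNNReal : ℝ≥0) := NNReal.coe_le_coe.2 hy
      push_cast [Real.coe_toNNReal _ hε.le] at hy' ⊢
      linarith
  rw [← Measure.measure_univ_eq_zero]
  have : (Set.univ : Set ℝ≥0) = ⋃ n : ℕ, Set.Iic (n * ε.toNNReal) := by
    ext y
    simp only [Set.mem_univ, Set.mem_iUnion, Set.mem_Iic, true_iff]
    obtain ⟨n, hn⟩ := exists_nat_ge (y / ε.toNNReal)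
    exact ⟨n, (div_le_iff₀ (Real.toNNReal_pos.2 hε)).1 hn⟩
  rw [this, measure_iUnion_null_iff]
  exact key

theorem eq_smul_excursionMeasure (h : IsCentered ζ) {π : Measure ℝ≥0} [SigmaFinite π]
    (hπ : (lindleyKernel ζ).Invariant π) : ∃ a : ℝ≥0, π = a • excursionMeasure ζ := by
  have := sigmaFinite_excursionMeasure h
  have ha : π {0} ≠ ∞ := (measure_singleton_lt_top).ne
  set a : ℝ≥0 := (π {0}).toNNReal with hadef
  have ha' : (a : ℝ≥0∞) = π {0} := ENNReal.coe_toNNReal ha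
  refine ⟨a, ?_⟩
  have hle : a • excursionMeasure ζ ≤ π := by
    have := smul_excursionMeasure_le hπ
    rwa [← ha'] at this
  set ρ := a • excursionMeasure ζ with hρ
  have : SigmaFinite ρ := by rw [hρ]; infer_instance
  have hac : ρ ≪ π := Measure.absolutelyContinuous_of_le hle
  set f := ρ.rnDeriv π
  have hf1 : f ≤ᵐ[π] 1 := Measure.rnDeriv_le_one_of_le hle
  have hf : π.withDensity f = ρ := Measure.withDensity_rnDeriv_eq _ _ hac
  -- The remainder of `π` is built from a Radon–Nikodym derivative, since both measures may be
  -- infinite.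
  set π' := π.withDensity (1 - f) with hπ'
  have hdec : ρ + π' = π := by
    rw [← hf, hπ', ← withDensity_add_left (Measure.measurable_rnDeriv _ _)]
    conv_rhs => rw [← withDensity_one (μ := π)]
    refine withDensity_congr_ae ?_
    filter_upwards [hf1] with x hx
    simp only [Pi.add_apply, Pi.sub_apply, Pi.one_apply] at hx ⊢
    exact add_tsub_cancel_of_le hx
  have hρinv : ρ.bind (lindleyKernel ζ) = ρ := by
    ext s hs
    rw [bind_lindleyKernel_apply _ hs, hρ, lintegral_smul_measure, Measure.smul_apply,
      ← bind_lindleyKernel_apply _ hs, (invariant_excursionMeasure h).def]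
  have hπ'inv : π'.bind (lindleyKernel ζ) = π' := by
    rw [← Measure.add_right_inj ρ, hdec]
    conv_rhs => rw [← hπ.def, ← hdec]
    ext s hs
    rw [Measure.add_apply, bind_lindleyKernel_apply _ hs, bind_lindleyKernel_apply _ hs,
      lintegral_add_measure, ← bind_lindleyKernel_apply (ζ := ζ) ρ hs, hρinv]
  have h0 : π' {0} = 0 := by
    have h1 := congrArg (fun m => m {0}) hdec
    simp only [Measure.add_apply] at h1
    rw [hρ, Measure.smul_apply, excursionMeasure_singleton_zero, ← ha', ENNReal.smul_def,
      smul_eq_mul, mul_one] at h1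
    have h2 : (a : ℝ≥0∞) + π' {0} = a + 0 := by rw [h1, add_zero]
    exact (ENNReal.add_right_inj ENNReal.coe_ne_top).1 h2
  rw [← hdec, eq_zero_of_invariant h hπ'inv h0, add_zero]

end Invariant

/-! ### From the random variables to the laws: the walk and its ladder height. -/

section Past

/-- The Markov property in integral form: an increment independent of the past is integrated out on
a past event. -/
theorem setLIntegral_indep {Ω β : Type*} [MeasurableSpace β] {m : MeasurableSpace Ω}
    [mΩ : MeasurableSpace Ω] {P : Measure Ω} [IsProbabilityMeasure P] (hm : m ≤ mΩ)
    {ζ : Measure ℝ} [IsProbabilityMeasure ζ]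
    {Z : Ω → ℝ} (hZ : Measurable Z) (hlaw : P.map Z = ζ)
    (hind : Indep m (MeasurableSpace.comap Z inferInstance) P)
    {X : Ω → β} (hX : Measurable[m] X) {E : Set Ω} (hE : MeasurableSet[m] E)
    {g : β × ℝ → ℝ≥0∞} (hg : Measurable g) :
    ∫⁻ ω in E, g (X ω, Z ω) ∂P = ∫⁻ ω in E, ∫⁻ t, g (X ω, t) ∂ζ ∂P := by
  -- The indicator of `E` is carried as a second coordinate, so that independence of one pair from
  -- `Z` suffices.
  set W : Ω → β × ℝ≥0∞ := fun ω => (X ω, E.indicator (fun _ => 1) ω)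
  have hWm : Measurable[m] W := hX.prodMk
    ((measurable_const : Measurable[m] fun _ : Ω => (1 : ℝ≥0∞)).indicator hE)
  have hW : Measurable W := hWm.mono hm le_rfl
  have hWZ : IndepFun W Z P :=
    (IndepFun_iff_Indep W Z P).2 (indep_of_indep_of_le_left hind hWm.comap_le)
  have hmap := (indepFun_iff_map_prod_eq_prod_map_map hW.aemeasurable hZ.aemeasurable).1 hWZ
  have hg' : Measurable fun p : (β × ℝ≥0∞) × ℝ => p.1.2 * g (p.1.1, p.2) := by fun_prop
  have hind1 : ∀ (ω : Ω) (c : ℝ≥0∞),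
    E.indicator (fun _ => 1) ω * c = E.indicator (fun _ => c) ω := by
    intro ω c
    by_cases h : ω ∈ E <;> simp [h]
  rw [← lintegral_indicator (hm _ hE), ← lintegral_indicator (hm _ hE)]
  calc ∫⁻ ω, E.indicator (fun ω => g (X ω, Z ω)) ω ∂P
      = ∫⁻ ω, (W ω).2 * g ((W ω).1, Z ω) ∂P := by
        refine lintegral_congr fun ω => ?_
        rw [hind1 ω]
        by_cases h : ω ∈ E <;> simp [h, W]
    _ = ∫⁻ p, p.1.2 * g (p.1.1, p.2) ∂(P.map fun ω => (W ω, Z ω)) :=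
        (lintegral_map hg' (hW.prodMk hZ)).symm
    _ = ∫⁻ w, ∫⁻ t, w.2 * g (w.1, t) ∂ζ ∂(P.map W) := by
        rw [hmap, hlaw, lintegral_prod _ hg'.aemeasurable]
    _ = ∫⁻ ω, ∫⁻ t, (W ω).2 * g ((W ω).1, t) ∂ζ ∂P :=
        lintegral_map hg'.lintegral_prod_right' hW
    _ = _ := by
        refine lintegral_congr fun ω => ?_
        by_cases h : ω ∈ E <;> simp [h, W]

variable {Ω : Type*} [mΩ : MeasurableSpace Ω] {P : Measure Ω} [IsProbabilityMeasure P]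

/-- The σ-algebra generated by the first `n` increments. -/
@[reducible]
def past (z : ℕ → Ω → ℝ) (n : ℕ) : MeasurableSpace Ω :=
  ⨆ i ∈ {i : ℕ | i < n}, MeasurableSpace.comap (z i) inferInstance

variable {z : ℕ → Ω → ℝ}

omit mΩ in
theorem measurable_past {i n : ℕ} (h : i < n) : Measurable[past z n] (z i) :=
  Measurable.mono (comap_measurable (z i)) (le_iSup₂_of_le (f := fun i (_ : i ∈ {i : ℕ | i < n}) =>
    MeasurableSpace.comap (z i) inferInstance) i h le_rfl) le_rfl

omit mΩ in
theorem past_mono {m n : ℕ} (h : m ≤ n) : past z m ≤ past z n :=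
  biSup_mono fun _ hi => lt_of_lt_of_le hi h

theorem past_le (hz : ∀ n, Measurable (z n)) (n : ℕ) : past z n ≤ mΩ :=
  iSup₂_le fun i _ => (hz i).comap_le

omit [IsProbabilityMeasure P] in
theorem indep_past (hz : ∀ n, Measurable (z n)) (hind : iIndepFun z P) (n : ℕ) :
    Indep (past z n) (MeasurableSpace.comap (z n) inferInstance) P := by
  have h := indep_iSup_of_disjoint (fun i => (hz i).comap_le) hind.iIndep
    (S := {i : ℕ | i < n}) (T := {n}) (by simp)
  simpa [past] using h

omit mΩ in
theorem measurable_walk_past (n : ℕ) : Measurable[past z n] (walk z n) := by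
  unfold walk
  exact Finset.measurable_fun_sum _ fun i hi => measurable_past (Finset.mem_range.1 hi)

omit mΩ in
theorem walk_succ (n : ℕ) (ω : Ω) : walk z (n + 1) ω = walk z n ω + z n ω :=
  Finset.sum_range_succ _ _

theorem measurable_walk (hz : ∀ n, Measurable (z n)) (n : ℕ) : Measurable (walk z n) :=
  (measurable_walk_past n).mono (past_le hz n) le_rfl

/-- The event that the walk is in `S` at the times `1, …, n`. -/
def stays (z : ℕ → Ω → ℝ) (S : Set ℝ) (n : ℕ) : Set Ω :=
  {ω | ∀ k, 1 ≤ k → k ≤ n → walk z k ω ∈ S}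

omit mΩ in
theorem measurableSet_stays {S : Set ℝ} (hS : MeasurableSet S) (n : ℕ) :
    MeasurableSet[past z n] (stays z S n) := by
  have : stays z S n = ⋂ k ∈ Set.Icc 1 n, walk z k ⁻¹' S := by
    ext ω; simp [stays]
  rw [this]
  refine MeasurableSet.biInter (Set.to_countable _) fun k hk => ?_
  exact past_mono hk.2 _ (measurable_walk_past k hS)

omit mΩ in
theorem stays_succ (S : Set ℝ) (n : ℕ) :
    stays z S (n + 1) = stays z S n ∩ walk z (n + 1) ⁻¹' S := by
  ext ω
  simp only [stays, Set.mem_ofPred_eq, Set.mem_inter_iff, Set.mem_preimage]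
  constructor
  · exact fun h => ⟨fun k h1 h2 => h k h1 (by omega), h _ (by omega) le_rfl⟩
  · rintro ⟨h1, h2⟩ k hk1 hk2
    rcases Nat.lt_or_ge k (n + 1) with h | h
    · exact h1 k hk1 (by omega)
    · have : k = n + 1 := le_antisymm hk2 h
      rwa [this]

variable {ζ : Measure ℝ} [IsProbabilityMeasure ζ]

theorem setLIntegral_walk_succ (hz : ∀ n, Measurable (z n)) (hind : iIndepFun z P)
    (hlaw : ∀ n, P.map (z n) = ζ) {S : Set ℝ} (hS : MeasurableSet S) (n : ℕ)
    (ih : ∀ f : ℝ → ℝ≥0∞, Measurable f →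
      ∫⁻ ω in stays z S n, f (walk z n ω) ∂P = ∫⁻ x, f x ∂(killed ζ S n))
    {T : Set ℝ} (hT : MeasurableSet T) {f : ℝ → ℝ≥0∞} (hf : Measurable f) :
    ∫⁻ ω in stays z S n ∩ walk z (n + 1) ⁻¹' T, f (walk z (n + 1) ω) ∂P =
      ∫⁻ x, f x ∂((killed ζ S n ∗ ζ).restrict T) := by
  have hfT := hf.indicator hT
  have hTm : MeasurableSet (walk z (n + 1) ⁻¹' T) := measurable_walk hz (n + 1) hT
  calc _ = ∫⁻ ω in stays z S n, T.indicator f (walk z n ω + z n ω) ∂P := by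
        rw [Set.inter_comm, ← Measure.restrict_restrict hTm, ← lintegral_indicator hTm]
        refine lintegral_congr fun ω => ?_
        rw [← walk_succ]
        rfl
    _ = ∫⁻ ω in stays z S n, ∫⁻ t, T.indicator f (walk z n ω + t) ∂ζ ∂P :=
        setLIntegral_indep (past_le hz n) (hz n) (hlaw n) (indep_past hz hind n)
          (measurable_walk_past n) (measurableSet_stays hS n)
          (g := fun p : ℝ × ℝ => T.indicator f (p.1 + p.2)) (by fun_prop)
    _ = ∫⁻ x, ∫⁻ t, T.indicator f (x + t) ∂ζ ∂(killed ζ S n) :=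
        ih _ (Measurable.lintegral_prod_right' (f := fun p : ℝ × ℝ => T.indicator f (p.1 + p.2))
          (by fun_prop))
    _ = _ := by rw [← Measure.lintegral_conv hfT, lintegral_indicator hT]

theorem setLIntegral_walk (hz : ∀ n, Measurable (z n)) (hind : iIndepFun z P)
    (hlaw : ∀ n, P.map (z n) = ζ) {S : Set ℝ} (hS : MeasurableSet S) (n : ℕ) :
    ∀ f : ℝ → ℝ≥0∞, Measurable f →
      ∫⁻ ω in stays z S n, f (walk z n ω) ∂P = ∫⁻ x, f x ∂(killed ζ S n) := by
  induction n with
  | zero =>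
    intro f hf
    have : stays z S 0 = Set.univ := by
      refine Set.eq_univ_of_forall fun ω k h1 h2 => ?_
      omega
    simp [this, killed, walk, lintegral_dirac' _ hf]
  | succ n ih =>
    intro f hf
    rw [stays_succ]
    exact setLIntegral_walk_succ hz hind hlaw hS n ih hS hf

/-- The event that `n + 1` is the first strictly ascending ladder time. -/
def firstLadder (z : ℕ → Ω → ℝ) (n : ℕ) : Set Ω :=
  stays z (Set.Iic 0) n ∩ walk z (n + 1) ⁻¹' (Set.Iic 0)ᶜ

theorem setLIntegral_firstLadder (hz : ∀ n, Measurable (z n)) (hind : iIndepFun z P)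
    (hlaw : ∀ n, P.map (z n) = ζ) (n : ℕ) {f : ℝ → ℝ≥0∞} (hf : Measurable f) :
    ∫⁻ ω in firstLadder z n, f (walk z (n + 1) ω) ∂P = ∫⁻ x, f x ∂(exitLaw ζ (Set.Iic 0) n) :=
  setLIntegral_walk_succ hz hind hlaw measurableSet_Iic n
    (setLIntegral_walk hz hind hlaw measurableSet_Iic n) measurableSet_Iic.compl hf

omit mΩ in
theorem ladderTime_eq {n : ℕ} {ω : Ω} (hω : ω ∈ firstLadder z n) : ladderTime z ω = n + 1 := by
  have h1 : 0 < walk z (n + 1) ω := by simpa using hω.2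
  refine le_antisymm (Nat.sInf_le ⟨by omega, h1⟩) ?_
  have hne : {k : ℕ | 1 ≤ k ∧ 0 < walk z k ω}.Nonempty := ⟨n + 1, by omega, h1⟩
  obtain ⟨h2, h3⟩ := Nat.sInf_mem hne
  by_contra hlt
  rw [not_le] at hlt
  exact absurd (hω.1 (ladderTime z ω) h2 (by omega)) (not_le.2 h3)

theorem measurableSet_firstLadder (hz : ∀ n, Measurable (z n)) (n : ℕ) :
    MeasurableSet (firstLadder z n) :=
  (past_le hz n _ (measurableSet_stays measurableSet_Iic n)).inter
    (measurable_walk hz (n + 1) measurableSet_Iic.compl)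

omit mΩ in
theorem pairwise_disjoint_firstLadder : Pairwise (Function.onFun Disjoint (firstLadder z)) := by
  intro m n hmn
  rw [Function.onFun, Set.disjoint_left]
  intro ω h1 h2
  have := (ladderTime_eq h1).symm.trans (ladderTime_eq h2)
  omega

theorem ae_mem_firstLadder (h : IsCentered ζ) (hz : ∀ n, Measurable (z n)) (hind : iIndepFun z P)
    (hlaw : ∀ n, P.map (z n) = ζ) : ∀ᵐ ω ∂P, ω ∈ ⋃ n, firstLadder z n := by
  have hm := MeasurableSet.iUnion (measurableSet_firstLadder hz)
  have h1 : P (⋃ n, firstLadder z n) = 1 := by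
    rw [measure_iUnion pairwise_disjoint_firstLadder (measurableSet_firstLadder hz),
      ← ladderLaw_univ measurableSet_Iic (tendsto_killed_Iic h), ladderLaw,
      Measure.sum_apply _ MeasurableSet.univ]
    refine tsum_congr fun n => ?_
    have := setLIntegral_firstLadder hz hind hlaw n (f := 1) measurable_one
    simpa using this
  exact (prob_compl_eq_zero_iff hm).2 h1

theorem ae_exists_walk_pos (h : IsCentered ζ) (hz : ∀ n, Measurable (z n)) (hind : iIndepFun z P)
    (hlaw : ∀ n, P.map (z n) = ζ) : ∀ᵐ ω ∂P, ∃ n : ℕ, 1 ≤ n ∧ 0 < walk z n ω := by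
  filter_upwards [ae_mem_firstLadder h hz hind hlaw] with ω hω
  obtain ⟨n, hn⟩ := Set.mem_iUnion.1 hω
  exact ⟨n + 1, by omega, by simpa using hn.2⟩

omit mΩ in
theorem ladderHeight_eq {n : ℕ} {ω : Ω} (hω : ω ∈ firstLadder z n) :
    ladderHeight z ω = walk z (n + 1) ω := by
  rw [ladderHeight, ladderTime_eq hω]

theorem aemeasurable_ladderHeight (h : IsCentered ζ) (hz : ∀ n, Measurable (z n))
    (hind : iIndepFun z P) (hlaw : ∀ n, P.map (z n) = ζ) : AEMeasurable (ladderHeight z) P := by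
  rw [← Measure.restrict_eq_self_of_ae_mem (ae_mem_firstLadder h hz hind hlaw),
    aemeasurable_iUnion_iff]
  intro n
  refine (measurable_walk hz (n + 1)).aemeasurable.congr ?_
  filter_upwards [ae_restrict_mem (measurableSet_firstLadder hz n)] with ω hω
  exact (ladderHeight_eq hω).symm

/-- Split according to the value of the ladder time: on `firstLadder z n` the height is the walk at
time `n + 1`, whose law there is the n-th exit law. -/
theorem map_ladderHeight (h : IsCentered ζ) (hz : ∀ n, Measurable (z n))
    (hind : iIndepFun z P) (hlaw : ∀ n, P.map (z n) = ζ) :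
    P.map (ladderHeight z) = ladderLaw ζ (Set.Iic 0) := by
  refine Measure.ext_of_lintegral _ fun f hf => ?_
  rw [lintegral_map' hf.aemeasurable (aemeasurable_ladderHeight h hz hind hlaw), ladderLaw,
    lintegral_sum_measure]
  conv_lhs => rw [← Measure.restrict_eq_self_of_ae_mem (ae_mem_firstLadder h hz hind hlaw)]
  rw [lintegral_iUnion (measurableSet_firstLadder hz) pairwise_disjoint_firstLadder]
  refine tsum_congr fun n => ?_
  rw [← setLIntegral_firstLadder hz hind hlaw n hf]
  exact setLIntegral_congr_fun (measurableSet_firstLadder hz n) fun ω hω => by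
    rw [ladderHeight_eq hω]

end Past

/-! ### Recurrence of the chain. -/

section Recurrence

variable {ζ : Measure ℝ} [IsProbabilityMeasure ζ]

/-- The probability that the chain started at `y` is in `C` at the times `0, …, n`. -/
noncomputable def stayProb (ζ : Measure ℝ) (C : Set ℝ≥0) : ℕ → ℝ≥0 → ℝ≥0∞
  | 0, y => C.indicator 1 y
  | n + 1, y => C.indicator (fun y => ∫⁻ t, stayProb ζ C n ((y : ℝ) + t).toNNReal ∂ζ) y

theorem measurable_stayProb {C : Set ℝ≥0} (hC : MeasurableSet C) (n : ℕ) :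
    Measurable (stayProb ζ C n) := by
  induction n with
  | zero => exact measurable_one.indicator hC
  | succ n ih =>
    refine Measurable.indicator ?_ hC
    exact Measurable.lintegral_prod_right'
      (f := fun p : ℝ≥0 × ℝ => stayProb ζ C n ((p.1 : ℝ) + p.2).toNNReal) (by fun_prop)

theorem stayProb_le_one (C : Set ℝ≥0) (n : ℕ) (y : ℝ≥0) : stayProb ζ C n y ≤ 1 := by
  induction n generalizing y with
  | zero => exact Set.indicator_le_self' (fun _ _ => zero_le) y
  | succ n ih =>
    refine (Set.indicator_le_self' (fun _ _ => zero_le) y).trans ?_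
    calc _ ≤ ∫⁻ _t, 1 ∂ζ := lintegral_mono fun t => ih _
      _ = 1 := by simp

theorem antitone_stayProb (C : Set ℝ≥0) (y : ℝ≥0) : Antitone fun n => stayProb ζ C n y := by
  refine antitone_nat_of_succ_le fun n => ?_
  induction n generalizing y with
  | zero =>
    refine Set.indicator_le_indicator ?_
    calc _ ≤ ∫⁻ _t, 1 ∂ζ := lintegral_mono fun t => stayProb_le_one _ _ _
      _ = 1 := by simp
  | succ n ih => exact Set.indicator_le_indicator (lintegral_mono fun t => ih _)

omit [IsProbabilityMeasure ζ] in
theorem stayProb_succ_le (C : Set ℝ≥0) (n : ℕ) (y : ℝ≥0) :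
    stayProb ζ C (n + 1) y ≤ ∫⁻ t, stayProb ζ C n ((y : ℝ) + t).toNNReal ∂ζ :=
  Set.indicator_le_self' (fun _ _ => zero_le) y

/-- Within m steps from `y`, either the unreflected walk stays nonnegative, or the chain is at `0`
at some time with at least N steps left. -/
theorem stayProb_add_le (C : Set ℝ≥0) (N m : ℕ) (y : ℝ≥0) :
    stayProb ζ C (N + m) y ≤ reflectedLaw ζ m (Set.Iic (y : ℝ)) + stayProb ζ C N 0 := by
  induction m generalizing y with
  | zero =>
    rw [reflectedLaw_zero_Iic (NNReal.coe_nonneg y)]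
    exact (stayProb_le_one _ _ _).trans le_self_add
  | succ m ih =>
    rw [reflectedLaw_succ_Iic _ (NNReal.coe_nonneg y)]
    calc stayProb ζ C (N + m + 1) y ≤ ∫⁻ t, stayProb ζ C (N + m) ((y : ℝ) + t).toNNReal ∂ζ :=
          stayProb_succ_le C (N + m) y
      _ ≤ ∫⁻ t, (reflectedLaw ζ m (Set.Iic ((y : ℝ) + t)) + stayProb ζ C N 0) ∂ζ := by
          refine lintegral_mono fun t => ?_
          rcases le_total 0 ((y : ℝ) + t) with h | h
          · have := ih ((y : ℝ) + t).toNNReal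
            rwa [Real.coe_toNNReal _ h] at this
          · rw [Real.toNNReal_of_nonpos h]
            exact (antitone_stayProb C 0 (Nat.le_add_right N m)).trans le_add_self
      _ = _ := by
          rw [lintegral_add_right _ measurable_const]
          simp

theorem iInf_stayProb_le (h : IsCentered ζ) (C : Set ℝ≥0) (y : ℝ≥0) :
    ⨅ n, stayProb ζ C n y ≤ ⨅ n, stayProb ζ C n 0 := by
  refine le_iInf fun N => ?_
  have h1 : Tendsto (fun m => reflectedLaw ζ m (Set.Iic (y : ℝ)) + stayProb ζ C N 0) atTop
      (𝓝 (0 + stayProb ζ C N 0)) := (tendsto_reflectedLaw_Iic h y).add tendsto_const_nhds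
  rw [zero_add] at h1
  exact ge_of_tendsto h1 (Eventually.of_forall fun m =>
    (iInf_le _ (N + m)).trans (stayProb_add_le C N m y))

theorem iInf_stayProb_le_lintegral {C : Set ℝ≥0} (hC : MeasurableSet C) (y : ℝ≥0) :
    ⨅ n, stayProb ζ C n y ≤ ∫⁻ t, ⨅ n, stayProb ζ C n ((y : ℝ) + t).toNNReal ∂ζ := by
  rw [lintegral_iInf (f := fun n t => stayProb ζ C n ((y : ℝ) + t).toNNReal)
    (fun n => (measurable_stayProb hC n).comp (by fun_prop))
    (fun m n hmn t => antitone_stayProb C _ hmn)]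
  · exact le_iInf fun n => (iInf_le _ (n + 1)).trans (stayProb_succ_le C n y)
  · refine ne_top_of_le_ne_top ENNReal.one_ne_top ?_
    calc _ ≤ ∫⁻ _t, 1 ∂ζ := lintegral_mono fun t => stayProb_le_one _ _ _
      _ = 1 := by simp

/-- Follow an excursion from `0` for n steps. Where it has ended, the avoidance probability is at
most its value at `0`; where it has not, it is evaluated at the current position. -/
theorem iInf_stayProb_zero_le (h : IsCentered ζ) {C : Set ℝ≥0} (hC : MeasurableSet C) (n : ℕ) :
    ⨅ k, stayProb ζ C k 0 ≤
      ∫⁻ x, ⨅ k, stayProb ζ C k x.toNNReal ∂(killed ζ (Set.Ioi 0) n) +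
        (⨅ k, stayProb ζ C k 0) *
          ∑ k ∈ Finset.range n, exitLaw ζ (Set.Ioi 0) k Set.univ := by
  set a := ⨅ k, stayProb ζ C k 0 with ha
  have hm : Measurable fun y => ⨅ k, stayProb ζ C k y :=
    Measurable.iInf fun n => measurable_stayProb hC n
  have hm' : Measurable fun x : ℝ => ⨅ k, stayProb ζ C k x.toNNReal :=
    hm.comp measurable_real_toNNReal
  induction n with
  | zero => simp [killed, lintegral_dirac' _ hm', ha]
  | succ n ih =>
    refine ih.trans ?_
    rw [Finset.sum_range_succ, mul_add, add_comm (a * _), ← add_assoc]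
    gcongr
    calc ∫⁻ x, ⨅ k, stayProb ζ C k x.toNNReal ∂(killed ζ (Set.Ioi 0) n)
        ≤ ∫⁻ x, ∫⁻ t, ⨅ k, stayProb ζ C k (x + t).toNNReal ∂ζ ∂(killed ζ (Set.Ioi 0) n) := by
          refine lintegral_mono_ae ?_
          have : ∀ᵐ x ∂(killed ζ (Set.Ioi 0) n), 0 ≤ x := by
            rw [ae_iff]
            have := killed_Ioi_Iio (ζ := ζ) n
            simpa [Set.Iio] using this
          filter_upwards [this] with x hx
          have := iInf_stayProb_le_lintegral (ζ := ζ) hC x.toNNReal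
          rwa [Real.coe_toNNReal x hx] at this
      _ = ∫⁻ x, ⨅ k, stayProb ζ C k x.toNNReal ∂(killed ζ (Set.Ioi 0) n ∗ ζ) :=
          (Measure.lintegral_conv hm').symm
      _ = ∫⁻ x, ⨅ k, stayProb ζ C k x.toNNReal ∂(killed ζ (Set.Ioi 0) (n + 1)) +
          ∫⁻ x, ⨅ k, stayProb ζ C k x.toNNReal ∂(exitLaw ζ (Set.Ioi 0) n) := by
          rw [killed_conv measurableSet_Ioi, lintegral_add_measure]
      _ ≤ _ := by
          gcongr
          rw [← lintegral_const]
          exact lintegral_mono fun x => iInf_stayProb_le h C _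

/-- Let `a` be the avoidance probability from `0`, the largest over all starting points. At some
time n an excursion is in `O` with positive probability, and this mass contributes nothing to `a`;
since all masses add up to 1, `a` times a positive number is at most 0. -/
theorem iInf_stayProb_eq_zero (h : IsCentered ζ) {O : Set ℝ≥0} (hO : MeasurableSet O)
    (hpos : 0 < excursionMeasure ζ O) (y : ℝ≥0) : ⨅ n, stayProb ζ Oᶜ n y = 0 := by
  refine le_antisymm ((iInf_stayProb_le h _ y).trans ?_) zero_le
  have hO' : MeasurableSet (Real.toNNReal ⁻¹' O) := measurable_real_toNNReal hO
  obtain ⟨n, hn⟩ : ∃ n, killed ζ (Set.Ioi 0) n (Real.toNNReal ⁻¹' O) ≠ 0 := by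
    by_contra! hc
    rw [excursionMeasure, Measure.map_apply (by fun_prop) hO, green, Measure.sum_apply _ hO'] at hpos
    simp [hc] at hpos
  set a := ⨅ k, stayProb ζ Oᶜ k 0 with ha
  have ha1 : a ≠ ∞ :=
    ne_top_of_le_ne_top ENNReal.one_ne_top ((iInf_le _ 0).trans (stayProb_le_one _ _ _))
  set μ := killed ζ (Set.Ioi 0) n
  set e := ∑ k ∈ Finset.range n, exitLaw ζ (Set.Ioi 0) k Set.univ
  have h1 : e + μ Set.univ = 1 := sum_exitLaw_univ measurableSet_Ioi n
  have h2 : a ≤ ∫⁻ x, ⨅ k, stayProb ζ Oᶜ k x.toNNReal ∂μ + a * e :=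
    iInf_stayProb_zero_le h hO.compl n
  have h3 : ∫⁻ x, ⨅ k, stayProb ζ Oᶜ k x.toNNReal ∂μ ≤ a * μ (Real.toNNReal ⁻¹' O)ᶜ := by
    rw [← lintegral_indicator_const hO'.compl]
    refine lintegral_mono fun x => ?_
    by_cases hx : x.toNNReal ∈ O
    · refine (iInf_le _ 0).trans ?_
      simp [stayProb, hx]
    · rw [Set.indicator_of_mem (by simpa using hx)]
      exact iInf_stayProb_le h _ _
  have h4 : a * μ (Real.toNNReal ⁻¹' O) + (a * μ (Real.toNNReal ⁻¹' O)ᶜ + a * e) ≤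
      0 + (a * μ (Real.toNNReal ⁻¹' O)ᶜ + a * e) := by
    rw [zero_add, ← mul_add, ← mul_add, ← add_assoc, measure_add_measure_compl hO',
      add_comm (μ Set.univ), h1, mul_one]
    rw [mul_add]
    exact h2.trans (add_le_add h3 le_rfl)
  have he : e ≠ ∞ := ne_top_of_le_ne_top ENNReal.one_ne_top (h1 ▸ le_self_add)
  have h5 := (ENNReal.add_le_add_iff_right (ENNReal.add_ne_top.2
    ⟨ENNReal.mul_ne_top ha1 (measure_ne_top _ _), ENNReal.mul_ne_top ha1 he⟩)).1 h4
  rcases mul_eq_zero.1 (le_antisymm h5 zero_le) with h6 | h6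
  · exact h6.le
  · exact absurd h6 hn

variable {Ω : Type*} [mΩ : MeasurableSpace Ω] {P : Measure Ω} [IsProbabilityMeasure P]
  {z : ℕ → Ω → ℝ}

omit mΩ in
theorem measurable_lindleyChain_past (y : ℝ≥0) (n : ℕ) :
    Measurable[past z n] (lindleyChain z (fun _ => y) n) := by
  induction n with
  | zero => exact measurable_const
  | succ n ih =>
    have h1 : Measurable[past z (n + 1)] (lindleyChain z (fun _ => y) n) :=
      ih.mono (past_mono n.le_succ) le_rfl
    have h2 : Measurable[past z (n + 1)] (z n) := measurable_past n.lt_succ_self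
    exact (h1.coe_nnreal_real.add h2).real_toNNReal

/-- Repeatedly integrating out one increment trades one unit of the remaining horizon in `stayProb`
for one more time in the event. -/
theorem prob_lindleyChain_stay (hz : ∀ n, Measurable (z n)) (hind : iIndepFun z P)
    (hlaw : ∀ n, P.map (z n) = ζ) {C : Set ℝ≥0} (hC : MeasurableSet C) (y : ℝ≥0) (m N : ℕ) :
    P {ω | ∀ k ≤ N, lindleyChain z (fun _ => y) (m + k) ω ∈ C} =
      ∫⁻ ω, stayProb ζ C N (lindleyChain z (fun _ => y) m ω) ∂P := by
  set Y := lindleyChain z (fun _ => y)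
  set A : ℕ → Set Ω := fun j => {ω | ∀ k ≤ j, Y (m + k) ω ∈ C} with hA
  have hYm : ∀ n, Measurable[past z n] (Y n) := measurable_lindleyChain_past y
  have hAm : ∀ j, MeasurableSet[past z (m + j)] (A j) := by
    intro j
    have : A j = ⋂ k ∈ Set.Iic j, Y (m + k) ⁻¹' C := by ext ω; simp [hA]
    rw [this]
    exact MeasurableSet.biInter (Set.to_countable _) fun k hk =>
      past_mono (by simpa using hk) _ (hYm (m + k) hC)
  have hAm' : ∀ j, MeasurableSet (A j) := fun j => past_le hz _ _ (hAm j)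
  have hAC : ∀ j, ∀ ω ∈ A j, Y (m + j) ω ∈ C := fun j ω hω => hω j le_rfl
  have hAsucc : ∀ j, A (j + 1) = Y (m + j + 1) ⁻¹' C ∩ A j := by
    intro j
    ext ω
    simp only [hA, Set.mem_ofPred_eq, Set.mem_inter_iff, Set.mem_preimage]
    constructor
    · exact fun h => ⟨h (j + 1) le_rfl, fun k hk => h k (by omega)⟩
    · rintro ⟨h1, h2⟩ k hk
      rcases Nat.lt_or_ge k (j + 1) with h | h
      · exact h2 k (by omega)
      · rw [le_antisymm hk h]; exact h1
  have hstep : ∀ i j, ∫⁻ ω in A j, stayProb ζ C (i + 1) (Y (m + j) ω) ∂P =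
      ∫⁻ ω in A (j + 1), stayProb ζ C i (Y (m + (j + 1)) ω) ∂P := by
    intro i j
    calc _ = ∫⁻ ω in A j, ∫⁻ t, stayProb ζ C i ((Y (m + j) ω : ℝ) + t).toNNReal ∂ζ ∂P := by
          refine setLIntegral_congr_fun (hAm' j) fun ω hω => ?_
          simp only [stayProb, Set.indicator_of_mem (hAC j ω hω)]
      _ = ∫⁻ ω in A j, stayProb ζ C i ((Y (m + j) ω : ℝ) + z (m + j) ω).toNNReal ∂P :=
          (setLIntegral_indep (past_le hz _) (hz _) (hlaw _) (indep_past hz hind (m + j))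
            (hYm (m + j)) (hAm j)
            (g := fun p : ℝ≥0 × ℝ => stayProb ζ C i ((p.1 : ℝ) + p.2).toNNReal)
            ((measurable_stayProb hC i).comp (by fun_prop))).symm
      _ = _ := by
          have hYC : MeasurableSet (Y (m + j + 1) ⁻¹' C) := past_le hz _ _ (hYm _ hC)
          rw [hAsucc, ← Measure.restrict_restrict hYC, ← lintegral_indicator hYC]
          refine lintegral_congr fun ω => ?_
          change stayProb ζ C i (Y (m + j + 1) ω) = _
          by_cases hω : Y (m + j + 1) ω ∈ C
          · rw [Set.indicator_of_mem (by exact hω)]; rfl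
          · rw [Set.indicator_of_notMem (by exact hω)]
            cases i <;> simp [stayProb, hω]
  have hall : ∀ i j, ∫⁻ ω in A j, stayProb ζ C i (Y (m + j) ω) ∂P = P (A (j + i)) := by
    intro i
    induction i with
    | zero =>
      intro j
      rw [add_zero, ← setLIntegral_one]
      refine setLIntegral_congr_fun (hAm' j) fun ω hω => ?_
      simp [stayProb, hAC j ω hω]
    | succ i ih =>
      intro j
      rw [hstep, ih]
      congr 2; ring
  have h0 := hall N 0
  rw [zero_add] at h0
  rw [← h0, ← lintegral_indicator (hAm' 0)]
  refine lintegral_congr fun ω => ?_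
  by_cases hω : ω ∈ A 0
  · rw [Set.indicator_of_mem hω]; rfl
  · rw [Set.indicator_of_notMem hω]
    have : Y m ω ∉ C := fun hc => hω fun k hk => by
      rw [Nat.le_zero.1 hk]; exact hc
    cases N <;> simp [stayProb, this]

theorem ae_frequently_lindleyChain_const (h : IsCentered ζ) (hz : ∀ n, Measurable (z n))
    (hind : iIndepFun z P) (hlaw : ∀ n, P.map (z n) = ζ) {O : Set ℝ≥0} (hO : MeasurableSet O)
    (hpos : 0 < excursionMeasure ζ O) (y : ℝ≥0) :
    ∀ᵐ ω ∂P, ∃ᶠ n in atTop, lindleyChain z (fun _ => y) n ω ∈ O := by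
  have key : ∀ m, P {ω | ∀ k, lindleyChain z (fun _ => y) (m + k) ω ∈ Oᶜ} = 0 := by
    intro m
    have hY : Measurable (lindleyChain z (fun _ => y) m) :=
      (measurable_lindleyChain_past y m).mono (past_le hz m) le_rfl
    have h1 : P {ω | ∀ k, lindleyChain z (fun _ => y) (m + k) ω ∈ Oᶜ} ≤
        ⨅ N, ∫⁻ ω, stayProb ζ Oᶜ N (lindleyChain z (fun _ => y) m ω) ∂P := by
      refine le_iInf fun N => ?_
      rw [← prob_lindleyChain_stay hz hind hlaw hO.compl]
      exact measure_mono fun ω hω k _ => hω k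
    rw [← lintegral_iInf
      (f := fun N ω => stayProb ζ Oᶜ N (lindleyChain z (fun _ => y) m ω))
        (fun n => (measurable_stayProb hO.compl n).comp hY)
      (fun m n hmn t => antitone_stayProb _ _ hmn)] at h1
    · simpa [iInf_stayProb_eq_zero h hO hpos] using h1
    · refine ne_top_of_le_ne_top ENNReal.one_ne_top ?_
      calc _ ≤ ∫⁻ _ω, 1 ∂P := lintegral_mono fun ω => stayProb_le_one _ _ _
        _ = 1 := by simp
  have h2 : P (⋃ m, {ω | ∀ k, lindleyChain z (fun _ => y) (m + k) ω ∈ Oᶜ}) = 0 :=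
    measure_iUnion_null key
  refine measure_mono_null (fun ω hω => ?_) h2
  simp only [Set.mem_compl_iff, Set.mem_ofPred_eq, not_frequently, eventually_atTop] at hω
  obtain ⟨m, hm⟩ := hω
  exact Set.mem_iUnion.2 ⟨m, fun k => hm (m + k) (Nat.le_add_right m k)⟩

-- Transport to the canonical space, where an independent random start is handled by Fubini from
-- deterministic starts.
omit mΩ in
theorem lindleyChain_eq (Y₀ : Ω → ℝ≥0) (n : ℕ) (ω : Ω) :
    lindleyChain z Y₀ n ω =
      lindleyChain (fun k (p : ℝ≥0 × (ℕ → ℝ)) => p.2 k) Prod.fst n (Y₀ ω, fun k => z k ω) := by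
  induction n with
  | zero => rfl
  | succ n ih => rw [lindleyChain, lindleyChain, ih]

theorem ae_frequently_lindleyChain (h : IsCentered ζ) (hz : ∀ n, Measurable (z n))
    (hind : iIndepFun z P) (hlaw : ∀ n, P.map (z n) = ζ) {Y₀ : Ω → ℝ≥0} (hY₀ : Measurable Y₀)
    (hY₀ind : IndepFun Y₀ (fun ω n => z n ω) P) {O : Set ℝ≥0} (hO : MeasurableSet O)
    (hpos : 0 < excursionMeasure ζ O) :
    ∀ᵐ ω ∂P, ∃ᶠ n in atTop, lindleyChain z Y₀ n ω ∈ O := by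
  set X : ℕ → ℝ≥0 × (ℕ → ℝ) → ℝ≥0 :=
    lindleyChain (fun k (p : ℝ≥0 × (ℕ → ℝ)) => p.2 k) Prod.fst
  have hX : ∀ n, Measurable (X n) := by
    intro n
    induction n with
    | zero => exact measurable_fst
    | succ n ih =>
      exact (ih.coe_nnreal_real.add ((measurable_pi_apply n).comp measurable_snd)).real_toNNReal
  have hZ : Measurable fun ω n => z n ω := measurable_pi_lambda _ hz
  have hmap := (indepFun_iff_map_prod_eq_prod_map_map hY₀.aemeasurable hZ.aemeasurable).1 hY₀ind
  have hB : MeasurableSet {p | ∃ᶠ n in atTop, X n p ∈ O} := by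
    have : {p | ∃ᶠ n in atTop, X n p ∈ O} = ⋂ m : ℕ, ⋃ n ∈ Set.Ici m, X n ⁻¹' O := by
      ext p; simp [frequently_atTop]
    rw [this]
    exact MeasurableSet.iInter fun m => MeasurableSet.biUnion (Set.to_countable _)
      fun n _ => hX n hO
  have hae : ∀ᵐ p ∂(P.map fun ω => (Y₀ ω, fun n => z n ω)), ∃ᶠ n in atTop, X n p ∈ O := by
    have : SFinite (P.map fun ω n => z n ω) := inferInstance
    rw [hmap]
    refine (Measure.measure_prod_null hB.compl).2 (Eventually.of_forall fun y => ?_)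
    have hy : MeasurableSet (Prod.mk y ⁻¹' {p | ∃ᶠ n in atTop, X n p ∈ O}ᶜ) :=
      hB.compl.preimage (by fun_prop)
    simp only [Pi.zero_apply]
    rw [Measure.map_apply hZ hy]
    have h1 := ae_frequently_lindleyChain_const h hz hind hlaw hO hpos y
    refine measure_mono_null (fun ω hω => ?_) h1
    simp only [Set.mem_preimage, Set.mem_compl_iff, Set.mem_ofPred_eq] at hω ⊢
    intro hc
    refine hω (hc.mono fun n hn => ?_)
    rwa [lindleyChain_eq] at hn
  have h2 := ae_of_ae_map (hY₀.prodMk hZ).aemeasurable hae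
  filter_upwards [h2] with ω hω
  refine hω.mono fun n hn => ?_
  rwa [lindleyChain_eq]

end Recurrence

/-! ### Renewal measures and overshoots. -/

/-- `U` is a renewal measure of the step law `G` on `(0, ∞)`, and an interval of length `L` has
`U`-mass at most `C * (1 + L)`. -/
structure IsRenewal (G U : Measure ℝ) (C : ℝ) : Prop where
  step_pos : G (Set.Iic 0) = 0
  nonneg : U (Set.Iio 0) = 0
  eq : U = Measure.dirac 0 + G ∗ U
  pos : 0 < C
  window : ∀ x L : ℝ, 0 ≤ L → U (Set.Icc x (x + L)) ≤ ENNReal.ofReal (C * (1 + L))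

/-- The joint law of the positions in `(-∞, u]` of a renewal process and of the next steps. -/
noncomputable def stepPair (G U : Measure ℝ) (u : ℝ) : Measure (ℝ × ℝ) :=
  (U.restrict (Set.Iic u)).prod G

/-- The law of the overshoot of a renewal process over the level `u`. -/
noncomputable def overshoot (G U : Measure ℝ) (u : ℝ) : Measure ℝ :=
  ((stepPair G U u).restrict {p | u < p.1 + p.2}).map fun p => p.1 + p.2 - u

namespace IsRenewal

variable {G U : Measure ℝ} [IsProbabilityMeasure G] [SFinite U] {C : ℝ}

omit [IsProbabilityMeasure G] [SFinite U] in
theorem isFiniteMeasure_restrict (h : IsRenewal G U C) (u : ℝ) :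
    IsFiniteMeasure (U.restrict (Set.Iic u)) :=
  ⟨by rw [Measure.restrict_apply_univ]; exact measure_Iic_lt_top h.nonneg h.window u⟩

omit [SFinite U] in
theorem isFiniteMeasure_stepPair (h : IsRenewal G U C) (u : ℝ) :
    IsFiniteMeasure (stepPair G U u) := by
  have := h.isFiniteMeasure_restrict u
  unfold stepPair; infer_instance

omit [SFinite U] in
theorem isFiniteMeasure_overshoot (h : IsRenewal G U C) (u : ℝ) :
    IsFiniteMeasure (overshoot G U u) := by
  have := h.isFiniteMeasure_stepPair u
  unfold overshoot; infer_instance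

/-- A renewal position up to `u` is either the origin or reached from an earlier position by one
step; as steps are positive, that position is also at most `u`. -/
theorem restrict_Iic (h : IsRenewal G U C) {u : ℝ} (hu : 0 ≤ u) : U.restrict (Set.Iic u) =
    Measure.dirac 0 + ((stepPair G U u).map fun p => p.1 + p.2).restrict (Set.Iic u) := by
  have hadd : Measurable fun p : ℝ × ℝ => p.1 + p.2 := by fun_prop
  ext s hs
  have hs' := hs.inter (measurableSet_Iic (a := u))
  rw [Measure.restrict_apply hs, Measure.add_apply, Measure.restrict_apply hs,
    Measure.map_apply hadd hs']
  conv_lhs => rw [h.eq, Measure.add_apply, Measure.conv_comm, Measure.conv,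
    Measure.map_apply hadd hs', Measure.dirac_apply' _ hs']
  rw [Measure.dirac_apply' _ hs]
  congr 1
  · by_cases h0 : (0 : ℝ) ∈ s <;> simp [Set.indicator, hu, h0]
  · have e : stepPair G U u = (U.prod G).restrict (Set.Iic u ×ˢ Set.univ) := by
      rw [stepPair, ← Measure.prod_restrict, Measure.restrict_univ]
    rw [e, Measure.restrict_apply (hs'.preimage hadd)]
    refine measure_congr ?_
    have h0 : (U.prod G) (Set.univ ×ˢ Set.Iic 0) = 0 := by
      rw [Measure.prod_prod, h.step_pos, mul_zero]
    have h1 : ∀ᵐ p ∂(U.prod G), p ∉ (Set.univ ×ˢ Set.Iic 0 : Set (ℝ × ℝ)) :=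
      measure_eq_zero_iff_ae_notMem.1 h0
    filter_upwards [h1] with p hp
    simp only [Set.mem_prod, Set.mem_univ, true_and, Set.mem_Iic, not_le] at hp
    refine propext ⟨fun hm => ⟨hm, ?_, Set.mem_univ _⟩, fun hm => hm.1⟩
    have := hm.2
    simp only [Set.mem_Iic] at this ⊢
    linarith

/-- Telescoping along a renewal process descending from `t + u`: each visited position contributes
the one-step decrement of `Z`, and the first position below `t` is `t` minus the overshoot. With `Z
= 1` it shows that the overshoot law has mass 1. -/
theorem overshoot_identity (h : IsRenewal G U C) {Z : ℝ → ℝ} (hZ : Measurable Z) {M : ℝ}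
    (hM : ∀ y, |Z y| ≤ M) {u : ℝ} (hu : 0 ≤ u) (t : ℝ) :
    Z (t + u) = ∫ v in Set.Iic u, (Z (t + u - v) - ∫ s, Z (t + u - v - s) ∂G) ∂U +
      ∫ r, Z (t - r) ∂(overshoot G U u) := by
  have := h.isFiniteMeasure_restrict u
  have := h.isFiniteMeasure_stepPair u
  have hadd : Measurable fun p : ℝ × ℝ => p.1 + p.2 := by fun_prop
  have hi : ∀ {α : Type} [MeasurableSpace α] (μ : Measure α) [IsFiniteMeasure μ] (f : α → ℝ),
      Measurable f → Integrable (fun a => Z (f a)) μ := fun μ _ f hf =>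
    Integrable.of_bound (hZ.comp hf).aestronglyMeasurable M (Eventually.of_forall fun a => hM _)
  have hset : MeasurableSet {p : ℝ × ℝ | u < p.1 + p.2} := measurableSet_lt measurable_const hadd
  have e1 : ∫ v in Set.Iic u, Z (t + u - v) ∂U = Z (t + u) +
      ∫ p in {p : ℝ × ℝ | u < p.1 + p.2}ᶜ, Z (t + u - p.1 - p.2) ∂(stepPair G U u) := by
    rw [h.restrict_Iic hu, integral_add_measure (hi _ _ (by fun_prop)) (hi _ _ (by fun_prop)),
      integral_dirac, sub_zero, setIntegral_map (f := fun v => Z (t + u - v))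
      measurableSet_Iic (Measurable.aestronglyMeasurable (by fun_prop)) hadd.aemeasurable]
    congr 1
    have : (fun p : ℝ × ℝ => p.1 + p.2) ⁻¹' Set.Iic u = {p : ℝ × ℝ | u < p.1 + p.2}ᶜ := by
      ext p; simp
    rw [this]
    simp only [sub_sub]
  have e2 : ∫ v in Set.Iic u, ∫ s, Z (t + u - v - s) ∂G ∂U =
      ∫ p, Z (t + u - p.1 - p.2) ∂(stepPair G U u) := by
    rw [stepPair, integral_prod _ (hi _ (fun p : ℝ × ℝ => t + u - p.1 - p.2) (by fun_prop))]
  have e3 : ∫ r, Z (t - r) ∂(overshoot G U u) =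
      ∫ p in {p : ℝ × ℝ | u < p.1 + p.2}, Z (t + u - p.1 - p.2) ∂(stepPair G U u) := by
    rw [overshoot, integral_map (f := fun r => Z (t - r)) (by fun_prop)
      (Measurable.aestronglyMeasurable (by fun_prop))]
    congr 1
    ext p
    congr 1
    ring
  have i1 : Integrable (fun v => ∫ s, Z (t + u - v - s) ∂G) (U.restrict (Set.Iic u)) := by
    have := hi (stepPair G U u) (fun p : ℝ × ℝ => t + u - p.1 - p.2) (by fun_prop)
    exact this.integral_prod_left
  rw [integral_sub (hi _ _ (by fun_prop)) i1, e1, e2, e3,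
    ← integral_add_compl hset (hi (stepPair G U u) (fun p : ℝ × ℝ => t + u - p.1 - p.2)
      (by fun_prop))]
  ring

theorem isProbabilityMeasure_overshoot (h : IsRenewal G U C) {u : ℝ} (hu : 0 ≤ u) :
    IsProbabilityMeasure (overshoot G U u) := by
  have := h.isFiniteMeasure_overshoot u
  have h1 := h.overshoot_identity (Z := fun _ => 1) measurable_const (M := 1) (by simp) hu 0
  simp only [integral_const, probReal_univ, smul_eq_mul, mul_one, sub_self, mul_zero,
    zero_add] at h1
  refine ⟨?_⟩
  rw [← ENNReal.ofReal_one, h1, ofReal_measureReal]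

omit [IsProbabilityMeasure G] [SFinite U] in
theorem overshoot_Iic_zero (u : ℝ) : overshoot G U u (Set.Iic 0) = 0 := by
  rw [overshoot, Measure.map_apply (by fun_prop) measurableSet_Iic,
    Measure.restrict_apply (measurableSet_Iic.preimage (by fun_prop))]
  convert measure_empty (μ := stepPair G U u)
  ext p
  simp only [Set.mem_inter_iff, Set.mem_preimage, Set.mem_Iic, Set.mem_ofPred_eq,
    Set.mem_empty_iff_false, iff_false, not_and, not_lt]
  intro hp; linarith

/-- The steps that cross a level `u + t` from a position in `(-∞, u]`. -/
theorem setLIntegral_cross_le (h : IsRenewal G U C) (u : ℝ) {t : ℝ} (ht : 0 ≤ t) {ψ : ℝ → ℝ≥0∞}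
    (hψ : Measurable ψ) : ∫⁻ p in {p | u + t < p.1 + p.2}, ψ p.2 ∂(stepPair G U u) ≤
      ∫⁻ s in Set.Ioi t, ψ s * ENNReal.ofReal (C * (1 + s)) ∂G := by
  have := h.isFiniteMeasure_restrict u
  have hset : MeasurableSet {p : ℝ × ℝ | u + t < p.1 + p.2} :=
    measurableSet_lt measurable_const (by fun_prop)
  rw [← lintegral_indicator hset, stepPair,
    lintegral_prod_symm' _ (Measurable.indicator (f := fun p : ℝ × ℝ => ψ p.2) (by fun_prop) hset),
    ← lintegral_indicator measurableSet_Ioi]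
  refine lintegral_mono fun s => ?_
  have e : (fun v => {p : ℝ × ℝ | u + t < p.1 + p.2}.indicator (fun p => ψ p.2) (v, s)) =
      (Set.Ioi (u + t - s)).indicator fun _ => ψ s := by
    ext v
    simp only [Set.indicator, Set.mem_ofPred_eq, Set.mem_Ioi, sub_lt_iff_lt_add]
  rw [e, lintegral_indicator_const measurableSet_Ioi, Measure.restrict_apply measurableSet_Ioi]
  by_cases hs : t < s
  · rw [Set.indicator_of_mem (Set.mem_Ioi.2 hs)]
    gcongr
    -- A step of length s can cross only from a position in `[u - s, u]`; the window bound for this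
    -- interval produces the factor 1 + s.
    refine le_trans (measure_mono fun v hv => ?_) (h.window (u - s) s (by linarith))
    have h1 := hv.1
    have h2 := hv.2
    simp only [Set.mem_Ioi, Set.mem_Iic] at h1 h2
    exact ⟨by linarith, by linarith⟩
  · have : Set.Ioi (u + t - s) ∩ Set.Iic u = ∅ := by
      ext v
      simp only [Set.mem_inter_iff, Set.mem_Ioi, Set.mem_Iic, Set.mem_empty_iff_false, iff_false,
        not_and, not_le]
      intro hv; linarith
    rw [this]; simp

/-- A real form of `setLIntegral_cross_le`. -/
theorem setIntegral_cross_le (h : IsRenewal G U C) (u : ℝ) {t : ℝ} (ht : 0 ≤ t) {ψ : ℝ → ℝ}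
    (hψ : Measurable ψ) (h0 : ∀ s, 0 ≤ s → 0 ≤ ψ s) (hint : Integrable (fun s => ψ s * (1 + s)) G) :
    IntegrableOn (fun p => ψ p.2) {p : ℝ × ℝ | u + t < p.1 + p.2} (stepPair G U u) ∧
    ∫ p in {p : ℝ × ℝ | u + t < p.1 + p.2}, ψ p.2 ∂(stepPair G U u) ≤
      C * ∫ s in Set.Ioi t, ψ s * (1 + s) ∂G := by
  have hpos : ∀ᵐ s ∂G, 0 < s := by
    rw [ae_iff]; simpa [Set.Iic] using h.step_pos
  have := h.isFiniteMeasure_restrict u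
  have hpos2 : ∀ᵐ p ∂(stepPair G U u), 0 < p.2 :=
    Measure.quasiMeasurePreserving_snd.ae hpos
  have hle := h.setLIntegral_cross_le u ht (ψ := fun s => ENNReal.ofReal (ψ s)) (by fun_prop)
  have e : ∫⁻ s in Set.Ioi t, ENNReal.ofReal (ψ s) * ENNReal.ofReal (C * (1 + s)) ∂G =
      ENNReal.ofReal (C * ∫ s in Set.Ioi t, ψ s * (1 + s) ∂G) := by
    rw [← integral_const_mul, ofReal_integral_eq_lintegral_ofReal
      (hint.integrableOn.const_mul C)]
    · refine setLIntegral_congr_fun measurableSet_Ioi fun s hs => ?_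
      rw [← ENNReal.ofReal_mul (h0 s (ht.trans (Set.mem_Ioi.1 hs).le))]
      congr 1; ring
    · filter_upwards [ae_restrict_mem measurableSet_Ioi] with s hs
      have hs' : 0 ≤ s := ht.trans (Set.mem_Ioi.1 hs).le
      exact mul_nonneg h.pos.le (mul_nonneg (h0 s hs') (by linarith))
  rw [e] at hle
  have hnn : 0 ≤ᵐ[(stepPair G U u).restrict {p : ℝ × ℝ | u + t < p.1 + p.2}] fun p => ψ p.2 :=
    ae_restrict_of_ae (hpos2.mono fun p hp => h0 _ hp.le)
  have hI : IntegrableOn (fun p => ψ p.2) {p : ℝ × ℝ | u + t < p.1 + p.2} (stepPair G U u) := by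
    refine ⟨(hψ.comp measurable_snd).aestronglyMeasurable, ?_⟩
    rw [hasFiniteIntegral_iff_ofReal hnn]
    exact lt_of_le_of_lt hle ENNReal.ofReal_lt_top
  refine ⟨hI, ?_⟩
  rw [← ENNReal.ofReal_le_ofReal_iff, ofReal_integral_eq_lintegral_ofReal hI hnn]
  · exact hle
  · refine mul_nonneg h.pos.le (setIntegral_nonneg measurableSet_Ioi fun s hs => ?_)
    have hs' : 0 ≤ s := ht.trans (Set.mem_Ioi.1 hs).le
    exact mul_nonneg (h0 s hs') (by linarith)

end IsRenewal

/-! ### The renewal defect: its equation and its boundedness. -/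

/-- The difference between a renewal function and its linear asymptote. -/
noncomputable def renewalDefect (G U : Measure ℝ) (x : ℝ) : ℝ :=
  U.real (Set.Iic x) - max x 0 / ∫ s, s ∂G

theorem integral_excess {G : Measure ℝ} [IsProbabilityMeasure G]
    (hG : Integrable (fun s => s) G) (y : ℝ) :
      ∫ s, max (s - y) 0 ∂G = ∫ s, s ∂G - y + ∫ s, max (y - s) 0 ∂G := by
  have i1 : Integrable (fun s => max (y - s) 0) G :=
    ((integrable_const y).sub hG).pos_part
  have e : ∀ s, max (s - y) 0 = (s - y) + max (y - s) 0 := fun s => by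
    rcases le_total s y with hp | hp
    · rw [max_eq_right (by linarith), max_eq_left (by linarith)]; ring
    · rw [max_eq_left (by linarith), max_eq_right (by linarith)]; ring
  simp only [e]
  have i2 : Integrable (fun s => s - y) G := hG.sub (integrable_const y)
  rw [integral_add i2 i1, integral_sub hG (integrable_const y)]
  simp

theorem integral_excess_nonneg (G : Measure ℝ) (y : ℝ) : 0 ≤ ∫ s, max (s - y) 0 ∂G :=
  integral_nonneg fun _ => le_max_right _ _

namespace IsRenewal

variable {G U : Measure ℝ} [IsProbabilityMeasure G] [SFinite U] {C : ℝ}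

omit [IsProbabilityMeasure G] [SFinite U] in
theorem ae_pos (h : IsRenewal G U C) : ∀ᵐ s ∂G, 0 < s := by
  rw [ae_iff]; simpa [Set.Iic] using h.step_pos

omit [SFinite U] in
theorem mean_pos (h : IsRenewal G U C) (hG : Integrable (fun s => s) G) : 0 < ∫ s, s ∂G := by
  rw [integral_pos_iff_support_of_nonneg_ae (h.ae_pos.mono fun s hs => hs.le) hG]
  have : G (Function.support fun s : ℝ => s)ᶜ = 0 := by
    refine measure_mono_null (fun s hs => ?_) h.step_pos
    simp only [Function.mem_support, Set.mem_compl_iff, not_not] at hs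
    simp [hs]
  have h1 := prob_compl_eq_zero_iff (μ := G) (s := Function.support fun s : ℝ => s)
    (measurableSet_support measurable_id)
  rw [h1.1 this]
  exact one_pos

omit [IsProbabilityMeasure G] [SFinite U] in
theorem Iic_ne_top (h : IsRenewal G U C) (x : ℝ) : U (Set.Iic x) ≠ ∞ :=
  (measure_Iic_lt_top h.nonneg h.window x).ne

omit [IsProbabilityMeasure G] [SFinite U] in
theorem real_Iic_of_neg (h : IsRenewal G U C) {x : ℝ} (hx : x < 0) : U.real (Set.Iic x) = 0 := by
  rw [measureReal_def, measure_mono_null (Set.Iic_subset_Iio.2 hx) h.nonneg, ENNReal.toReal_zero]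

omit [IsProbabilityMeasure G] [SFinite U] in
theorem monotone_real_Iic (h : IsRenewal G U C) : Monotone fun x => U.real (Set.Iic x) :=
  fun _ b hab => ENNReal.toReal_mono (h.Iic_ne_top b) (measure_mono (Set.Iic_subset_Iic.2 hab))

theorem real_Iic_eq (h : IsRenewal G U C) {x : ℝ} (hx : 0 ≤ x) :
    U.real (Set.Iic x) = 1 + ∫ s, U.real (Set.Iic (x - s)) ∂G := by
  have h1 : U (Set.Iic x) = 1 + ∫⁻ s, U (Set.Iic (x - s)) ∂G := by
    conv_lhs => rw [h.eq, Measure.add_apply, Measure.conv_apply_Iic]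
    simp [hx]
  have hm : Measurable fun s => U (Set.Iic (x - s)) :=
    (show Antitone fun s => U (Set.Iic (x - s)) from
      fun a b hab => measure_mono (Set.Iic_subset_Iic.2 (by linarith))).measurable
  have h2 : ∫⁻ s, U (Set.Iic (x - s)) ∂G ≠ ∞ := by
    have := h.Iic_ne_top x
    rw [h1] at this
    exact (ENNReal.add_ne_top.1 this).2
  rw [measureReal_def, h1, ENNReal.toReal_add ENNReal.one_ne_top h2, ENNReal.toReal_one]
  congr 1
  exact (integral_toReal hm.aemeasurable (Eventually.of_forall fun s =>
    (h.Iic_ne_top _).lt_top)).symm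

omit [IsProbabilityMeasure G] [SFinite U] in
theorem measurable_real_Iic (h : IsRenewal G U C) : Measurable fun x => U.real (Set.Iic x) :=
  h.monotone_real_Iic.measurable

omit [IsProbabilityMeasure G] [SFinite U] in
theorem measurable_renewalDefect (h : IsRenewal G U C) : Measurable (renewalDefect G U) :=
  h.measurable_real_Iic.sub ((measurable_id.max measurable_const).div_const _)

omit [IsProbabilityMeasure G] [SFinite U] in
theorem renewalDefect_of_neg (h : IsRenewal G U C) {x : ℝ} (hx : x < 0) :
    renewalDefect G U x = 0 := by
  rw [renewalDefect, h.real_Iic_of_neg hx, max_eq_right hx.le]; simp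

omit [IsProbabilityMeasure G] [SFinite U] in
theorem integrable_of_sq (h : IsRenewal G U C) (hG : Integrable (fun s => (1 + s) ^ 2) G) :
    Integrable (fun s => s) G := by
  refine hG.mono' (by fun_prop) ?_
  filter_upwards [h.ae_pos] with s hs
  rw [Real.norm_of_nonneg hs.le]
  nlinarith

omit [IsProbabilityMeasure G] [SFinite U] in
theorem integrable_mul_of_sq (h : IsRenewal G U C) (hG : Integrable (fun s => (1 + s) ^ 2) G) :
    Integrable (fun s => s * (1 + s)) G := by
  refine hG.mono' (by fun_prop) ?_
  filter_upwards [h.ae_pos] with s hs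
  rw [Real.norm_of_nonneg (by positivity)]
  nlinarith

/-- The renewal equation of the defect: the jump 1 of the renewal function is offset by the mean of
min(s, y)/μ, leaving the mean excess. -/
theorem renewalDefect_sub (h : IsRenewal G U C) (hG : Integrable (fun s => s) G) {y : ℝ}
    (hy : 0 ≤ y) : renewalDefect G U y - ∫ s, renewalDefect G U (y - s) ∂G =
      (∫ s, max (s - y) 0 ∂G) / ∫ s, s ∂G := by
  have hμ := h.mean_pos hG
  have i1 : Integrable (fun s => max (y - s) 0 / ∫ s, s ∂G) G :=
    (((integrable_const y).sub hG).pos_part).div_const _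
  have i2 : Integrable (fun s => U.real (Set.Iic (y - s))) G := by
    refine Integrable.of_bound
      (h.measurable_real_Iic.comp (measurable_const.sub measurable_id)).aestronglyMeasurable
      (U.real (Set.Iic y)) ?_
    filter_upwards [h.ae_pos] with s hs
    rw [Real.norm_of_nonneg measureReal_nonneg]
    exact h.monotone_real_Iic (by linarith : y - s ≤ y)
  simp only [renewalDefect]
  rw [integral_sub i2 i1, h.real_Iic_eq hy, integral_div, integral_excess hG y,
    max_eq_left hy]
  field_simp
  ring

/-- The accumulated defect along a renewal process started from `t + u` and run down to `t`. -/
theorem setIntegral_excess_le (h : IsRenewal G U C) (hG : Integrable (fun s => (1 + s) ^ 2) G)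
    (u : ℝ) {t : ℝ} (ht : 0 ≤ t) :
    IntegrableOn (fun v => ∫ s, max (s - (t + u - v)) 0 ∂G) (Set.Iic u) U ∧
    ∫ v in Set.Iic u, ∫ s, max (s - (t + u - v)) 0 ∂G ∂U ≤
      C * ∫ s in Set.Ioi t, s * (1 + s) ∂G := by
  have := h.isFiniteMeasure_restrict u
  obtain ⟨h1, h2⟩ := h.setIntegral_cross_le u ht measurable_id (fun s hs => hs)
    (h.integrable_mul_of_sq hG)
  have hset : MeasurableSet {p : ℝ × ℝ | u + t < p.1 + p.2} :=
    measurableSet_lt measurable_const (by fun_prop)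
  have hpos : ∀ᵐ p ∂(stepPair G U u), p.1 ≤ u := by
    have : ∀ᵐ v ∂(U.restrict (Set.Iic u)), v ≤ u := ae_restrict_mem measurableSet_Iic
    exact Measure.quasiMeasurePreserving_fst.ae this
  have hle : ∀ᵐ p ∂(stepPair G U u), max (p.2 - (t + u - p.1)) 0 ≤
      {p : ℝ × ℝ | u + t < p.1 + p.2}.indicator (fun p => p.2) p := by
    filter_upwards [hpos] with p hp
    by_cases hm : u + t < p.1 + p.2
    · rw [Set.indicator_of_mem (by exact hm)]
      exact max_le (by linarith) (by linarith)
    · rw [Set.indicator_of_notMem (by exact hm)]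
      rw [not_lt] at hm
      exact max_le (by linarith) le_rfl
  have hi : Integrable (fun p : ℝ × ℝ => max (p.2 - (t + u - p.1)) 0) (stepPair G U u) := by
    refine ((integrable_indicator_iff hset).2 h1).mono' (by fun_prop) ?_
    filter_upwards [hle] with p hp
    rw [Real.norm_of_nonneg (le_max_right _ _)]
    exact hp
  refine ⟨hi.integral_prod_left, ?_⟩
  have e : ∫ v in Set.Iic u, ∫ s, max (s - (t + u - v)) 0 ∂G ∂U =
      ∫ p, max (p.2 - (t + u - p.1)) 0 ∂(stepPair G U u) := by
    rw [stepPair, integral_prod _ hi]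
  rw [e]
  refine le_trans ?_ h2
  simp only [id]
  rw [← integral_indicator hset]
  exact integral_mono_ae hi ((integrable_indicator_iff hset).2 h1) hle

/-- A form of Wald's identity. -/
theorem renewalDefect_eq (h : IsRenewal G U C) (hG : Integrable (fun s => (1 + s) ^ 2) G) {u : ℝ}
    (hu : 0 ≤ u) : renewalDefect G U u =
      (∫ v in Set.Iic u, ∫ s, max (s - (u - v)) 0 ∂G ∂U) / ∫ s, s ∂G := by
  have hG1 := h.integrable_of_sq hG
  have hμ := h.mean_pos hG1
  have := h.isFiniteMeasure_restrict u
  have hfin := h.isFiniteMeasure_overshoot u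
  -- The identity needs a bounded function; this truncation of y⁺ agrees with it at all positions
  -- involved, and vanishes after the crossing.
  have h1 := h.overshoot_identity (Z := fun y => min (max y 0) u)
    ((measurable_id.max measurable_const).min measurable_const) (M := u)
    (fun y => by rw [abs_of_nonneg (le_min (le_max_right _ _) hu)]; exact min_le_right _ _) hu 0
  have h2 : ∫ r, min (max (0 - r) 0) u ∂(overshoot G U u) = 0 := by
    refine integral_eq_zero_of_ae ?_
    have : ∀ᵐ r ∂(overshoot G U u), 0 < r := by
      rw [ae_iff]
      have := overshoot_Iic_zero (G := G) (U := U) u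
      simpa [Set.Iic] using this
    filter_upwards [this] with r hr
    simp only [Pi.zero_apply]
    rw [max_eq_right (by linarith), min_eq_left hu]
  rw [h2, add_zero, zero_add, max_eq_left hu, min_self] at h1
  have hU0 : ∀ᵐ v ∂U, 0 ≤ v := by
    rw [ae_iff]
    have := h.nonneg
    simpa [Set.Iio] using this
  have h3 : ∫ v in Set.Iic u, (min (max (u - v) 0) u - ∫ s, min (max (u - v - s) 0) u ∂G) ∂U =
      ∫ v in Set.Iic u, (∫ s, s ∂G - ∫ s, max (s - (u - v)) 0 ∂G) ∂U := by
    refine integral_congr_ae ?_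
    filter_upwards [ae_restrict_mem measurableSet_Iic, ae_restrict_of_ae hU0] with v hv hv0
    rw [Set.mem_Iic] at hv
    have e1 : ∫ s, min (max (u - v - s) 0) u ∂G = ∫ s, max (u - v - s) 0 ∂G := by
      refine integral_congr_ae ?_
      filter_upwards [h.ae_pos] with s hs
      exact min_eq_left (max_le (by linarith) hu)
    rw [e1, max_eq_left (by linarith), min_eq_left (by linarith),
      integral_excess hG1 (u - v)]
    ring
  obtain ⟨h4, -⟩ := h.setIntegral_excess_le hG u (le_refl 0)
  simp only [zero_add] at h4
  rw [h3, integral_sub (integrable_const _) h4] at h1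
  simp only [integral_const, smul_eq_mul, measureReal_restrict_apply_univ] at h1
  rw [renewalDefect, max_eq_left hu, eq_div_iff hμ.ne', sub_mul, div_mul_cancel₀ _ hμ.ne']
  linarith

theorem renewalDefect_nonneg (h : IsRenewal G U C) (hG : Integrable (fun s => (1 + s) ^ 2) G)
    (x : ℝ) : 0 ≤ renewalDefect G U x := by
  rcases lt_or_ge x 0 with hx | hx
  · rw [h.renewalDefect_of_neg hx]
  · rw [h.renewalDefect_eq hG hx]
    exact div_nonneg (integral_nonneg fun v => integral_excess_nonneg G _)
      (h.mean_pos (h.integrable_of_sq hG)).le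

theorem renewalDefect_le (h : IsRenewal G U C) (hG : Integrable (fun s => (1 + s) ^ 2) G)
    (x : ℝ) : renewalDefect G U x ≤ C * (∫ s in Set.Ioi 0, s * (1 + s) ∂G) / ∫ s, s ∂G := by
  have hμ := h.mean_pos (h.integrable_of_sq hG)
  rcases lt_or_ge x 0 with hx | hx
  · rw [h.renewalDefect_of_neg hx]
    refine div_nonneg (mul_nonneg h.pos.le (setIntegral_nonneg measurableSet_Ioi fun s hs => ?_))
      hμ.le
    have : 0 < s := hs
    positivity
  · rw [h.renewalDefect_eq hG hx]
    have := (h.setIntegral_excess_le hG x (le_refl 0)).2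
    simp only [zero_add] at this
    gcongr

theorem exists_abs_renewalDefect_le (h : IsRenewal G U C)
    (hG : Integrable (fun s => (1 + s) ^ 2) G) :
    ∃ M : ℝ, 0 ≤ M ∧ ∀ x, |renewalDefect G U x| ≤ M :=
  ⟨_, (h.renewalDefect_nonneg hG 0).trans (h.renewalDefect_le hG 0), fun x => by
    rw [abs_of_nonneg (h.renewalDefect_nonneg hG x)]
    exact h.renewalDefect_le hG x⟩

end IsRenewal

/-! ### Weights and the contraction of the defect. -/

/-- A submultiplicative monotone weight that is at least `1`. -/
structure IsWeight (w : ℝ → ℝ) : Prop where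
  monotone : Monotone w
  one_le : ∀ x, 1 ≤ w x
  submul : ∀ x y, w (x + y) ≤ w x * w y

namespace IsWeight

variable {w : ℝ → ℝ}

theorem pos (hw : IsWeight w) (x : ℝ) : 0 < w x := one_pos.trans_le (hw.one_le x)

theorem measurable (hw : IsWeight w) : Measurable w := hw.monotone.measurable

theorem max_le (hw : IsWeight w) (r r' : ℝ) : w (max r r') ≤ w r + w r' - 1 := by
  rcases max_cases r r' with ⟨h, _⟩ | ⟨h, _⟩ <;> rw [h]
  · linarith [hw.one_le r']
  · linarith [hw.one_le r]

end IsWeight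

/-- The shared part cancels, leaving two measures of equal mass. Instead of coupling them, the dual
form of transport is used: a constant `c` separates `g - A w` from `g + A (w - 1)`, and it cancels
because the masses agree. Keeping the excess `w - 1` separate is what makes the final factor close
to `1 - |ψ|`. -/
theorem integral_sub_le_of_common {O O' ψ : Measure ℝ} [IsProbabilityMeasure O]
    [IsProbabilityMeasure O'] (hO : ψ ≤ O) (hO' : ψ ≤ O') (h0 : O (Set.Iic 0) = 0)
    (h0' : O' (Set.Iic 0) = 0) {w g : ℝ → ℝ} (hw : IsWeight w) (hg : Measurable g) {M : ℝ}
    (hM : ∀ r, |g r| ≤ M) {A κ : ℝ} (hA : 0 ≤ A)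
    (hgw : ∀ r r', 0 < r → 0 < r' → g r - g r' ≤ A * (w r + w r' - 1))
    (hi : Integrable w O) (hi' : Integrable w O')
    (hκ : ∫ r, (w r - 1) ∂O ≤ κ) (hκ' : ∫ r, (w r - 1) ∂O' ≤ κ) :
    ∫ r, g r ∂O - ∫ r, g r ∂O' ≤ A * (1 - ψ.real Set.univ + 2 * κ) := by
  have : IsFiniteMeasure ψ := isFiniteMeasure_of_le O hO
  set ρ := O - ψ
  set ρ' := O' - ψ
  have e : ρ + ψ = O := Measure.sub_add_cancel_of_le hO
  have e' : ρ' + ψ = O' := Measure.sub_add_cancel_of_le hO'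
  have hρ : ρ ≤ O := Measure.sub_le
  have hρ' : ρ' ≤ O' := Measure.sub_le
  have : IsFiniteMeasure ρ := isFiniteMeasure_of_le O hρ
  have : IsFiniteMeasure ρ' := isFiniteMeasure_of_le O' hρ'
  have hib : ∀ (m : Measure ℝ) [IsFiniteMeasure m], Integrable g m := fun m _ =>
    Integrable.of_bound hg.aestronglyMeasurable M (Eventually.of_forall hM)
  have hmass : ∀ {m m' : Measure ℝ} [IsFiniteMeasure m] [IsProbabilityMeasure m'], m + ψ = m' →
      m.real Set.univ = 1 - ψ.real Set.univ := by
    intro m m' _ _ hm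
    have h1 : m'.real Set.univ = 1 := probReal_univ
    rw [← hm, measureReal_add_apply] at h1
    linarith
  set c := sSup ((fun r => g r - A * w r) '' Set.Ioi 0) with hc
  have hbdd : BddAbove ((fun r => g r - A * w r) '' Set.Ioi 0) := by
    refine ⟨g 1 + A * (w 1 - 1), ?_⟩
    rintro _ ⟨r, hr, rfl⟩
    have := hgw r 1 hr one_pos
    simp only
    linarith
  have hc1 : ∀ r, 0 < r → g r ≤ c + A * w r := fun r hr => by
    have := le_csSup hbdd ⟨r, hr, rfl⟩
    simp only at this
    linarith
  have hc2 : ∀ r, 0 < r → c - A * (w r - 1) ≤ g r := fun r hr => by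
    have : c ≤ g r + A * (w r - 1) := by
      refine csSup_le ⟨_, 1, Set.mem_Ioi.2 one_pos, rfl⟩ ?_
      rintro _ ⟨s, hs, rfl⟩
      have := hgw s r hs hr
      simp only
      linarith
    linarith
  have ae1 : ∀ᵐ r ∂ρ, 0 < r := by
    have : ρ (Set.Iic 0) = 0 := le_antisymm ((hρ _).trans h0.le) zero_le
    rw [ae_iff]; simpa [Set.Iic] using this
  have ae2 : ∀ᵐ r ∂ρ', 0 < r := by
    have : ρ' (Set.Iic 0) = 0 := le_antisymm ((hρ' _).trans h0'.le) zero_le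
    rw [ae_iff]; simpa [Set.Iic] using this
  have j1 : Integrable w ρ := hi.mono_measure hρ
  have j2 : Integrable w ρ' := hi'.mono_measure hρ'
  have j3 : Integrable (fun r => w r - 1) ρ := j1.sub (integrable_const 1)
  have j4 : Integrable (fun r => w r - 1) ρ' := j2.sub (integrable_const 1)
  have b1 : ∫ r, g r ∂ρ ≤ c * (1 - ψ.real Set.univ) + A * ((1 - ψ.real Set.univ) + κ) := by
    have k : ∫ r, (w r - 1) ∂ρ ≤ κ := (integral_mono_measure hρ
      (Eventually.of_forall fun r => by simpa using hw.one_le r)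
      (hi.sub (integrable_const 1))).trans hκ
    rw [integral_sub j1 (integrable_const 1)] at k
    simp only [integral_const, smul_eq_mul, mul_one, hmass e] at k
    calc ∫ r, g r ∂ρ ≤ ∫ r, (c + A * w r) ∂ρ :=
          integral_mono_ae (hib ρ) ((integrable_const c).add (j1.const_mul A))
            (ae1.mono fun r hr => hc1 r hr)
      _ = c * (1 - ψ.real Set.univ) + A * ∫ r, w r ∂ρ := by
          rw [integral_add (integrable_const c) (j1.const_mul A), integral_const_mul,
            integral_const, hmass e, smul_eq_mul, mul_comm c]
      _ ≤ _ := by gcongr; linarith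
  have b2 : c * (1 - ψ.real Set.univ) - A * κ ≤ ∫ r, g r ∂ρ' := by
    have k : ∫ r, (w r - 1) ∂ρ' ≤ κ := (integral_mono_measure hρ'
      (Eventually.of_forall fun r => by simpa using hw.one_le r)
      (hi'.sub (integrable_const 1))).trans hκ'
    calc c * (1 - ψ.real Set.univ) - A * κ
        ≤ c * (1 - ψ.real Set.univ) - A * ∫ r, (w r - 1) ∂ρ' := by gcongr
      _ = ∫ r, (c - A * (w r - 1)) ∂ρ' := by
          rw [integral_sub (integrable_const c) (j4.const_mul A), integral_const_mul,
            integral_const, hmass e', smul_eq_mul, mul_comm c]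
      _ ≤ _ := integral_mono_ae ((integrable_const c).sub (j4.const_mul A)) (hib ρ')
            (ae2.mono fun r hr => hc2 r hr)
  rw [← e, ← e', integral_add_measure (hib ρ) (hib ψ), integral_add_measure (hib ρ') (hib ψ)]
  linarith

namespace IsRenewal

variable {G U : Measure ℝ} [IsProbabilityMeasure G] [SFinite U] {C : ℝ} {w : ℝ → ℝ}

omit [IsProbabilityMeasure G] [SFinite U] in
theorem integrable_sq_of_weight (hw : IsWeight w)
    (hG : Integrable (fun s => (1 + s) ^ 2 * w s) G) : Integrable (fun s => (1 + s) ^ 2) G := by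
  refine hG.mono' (by fun_prop) (Eventually.of_forall fun s => ?_)
  rw [Real.norm_of_nonneg (sq_nonneg _)]
  exact le_mul_of_one_le_right (sq_nonneg _) (hw.one_le s)

omit [IsProbabilityMeasure G] [SFinite U] in
theorem integrable_weight (h : IsRenewal G U C) (hw : IsWeight w)
    (hG : Integrable (fun s => (1 + s) ^ 2 * w s) G) :
    Integrable (fun s => (w s - 1) * (1 + s)) G := by
  have := hw.measurable
  refine hG.mono' (Measurable.aestronglyMeasurable (by fun_prop)) ?_
  filter_upwards [h.ae_pos] with s hs
  have h1 := hw.one_le s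
  rw [Real.norm_of_nonneg (mul_nonneg (by linarith) (by linarith))]
  rw [mul_comm ((1 + s) ^ 2)]
  exact mul_le_mul (by linarith) (by nlinarith) (by linarith) (hw.pos s).le

omit [IsProbabilityMeasure G] [SFinite U] in
theorem weighted_tail (h : IsRenewal G U C) (hw : IsWeight w)
    (hG : Integrable (fun s => (1 + s) ^ 2 * w s) G) {t : ℝ} (ht : 0 ≤ t) :
    ∫ s in Set.Ioi t, s * (1 + s) ∂G ≤ (∫ s, (1 + s) ^ 2 * w s ∂G) / w t := by
  rw [le_div_iff₀ (hw.pos t), ← integral_mul_const]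
  have hG2 := h.integrable_mul_of_sq (integrable_sq_of_weight hw hG)
  calc ∫ s in Set.Ioi t, s * (1 + s) * w t ∂G ≤ ∫ s in Set.Ioi t, (1 + s) ^ 2 * w s ∂G := by
        refine setIntegral_mono_on (hG2.integrableOn.mul_const _) hG.integrableOn
          measurableSet_Ioi fun s hs => ?_
        have hs' : t < s := hs
        have : 0 < s := ht.trans_lt hs'
        have hwts := hw.monotone hs'.le
        have := hw.pos t
        gcongr
        nlinarith
    _ ≤ _ := setIntegral_le_integral hG (Eventually.of_forall fun s =>
        mul_nonneg (sq_nonneg _) (hw.pos s).le)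

theorem abs_accumulated_le (h : IsRenewal G U C) (hw : IsWeight w)
    (hG : Integrable (fun s => (1 + s) ^ 2 * w s) G) (u : ℝ) {t : ℝ} (ht : 0 ≤ t) :
    |∫ v in Set.Iic u, (renewalDefect G U (t + u - v) -
      ∫ s, renewalDefect G U (t + u - v - s) ∂G) ∂U| ≤
      C * (∫ s, (1 + s) ^ 2 * w s ∂G) / (∫ s, s ∂G) / w t := by
  have hG2 := integrable_sq_of_weight hw hG
  have hG1 := h.integrable_of_sq hG2
  have hμ := h.mean_pos hG1
  have e : ∫ v in Set.Iic u, (renewalDefect G U (t + u - v) -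
      ∫ s, renewalDefect G U (t + u - v - s) ∂G) ∂U =
      ∫ v in Set.Iic u, (∫ s, max (s - (t + u - v)) 0 ∂G) / ∫ s, s ∂G ∂U := by
    refine setIntegral_congr_fun measurableSet_Iic fun v hv => ?_
    rw [Set.mem_Iic] at hv
    exact h.renewalDefect_sub hG1 (by linarith)
  rw [e, integral_div, abs_of_nonneg (div_nonneg (integral_nonneg fun v =>
    integral_excess_nonneg G _) hμ.le), div_div, mul_comm (∫ s, s ∂G), ← div_div, mul_div_assoc]
  gcongr
  exact (h.setIntegral_excess_le hG2 u ht).2.trans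
    (mul_le_mul_of_nonneg_left (h.weighted_tail hw hG ht) h.pos.le)

/-- The overshoot never exceeds the crossing step, so crossing estimates for the step bound it
uniformly in the level. -/
theorem overshoot_weight (h : IsRenewal G U C) (hw : IsWeight w)
    (hG : Integrable (fun s => (1 + s) ^ 2 * w s) G) (u : ℝ) :
    Integrable w (overshoot G U u) ∧
      ∫ r, (w r - 1) ∂(overshoot G U u) ≤ C * ∫ s, (w s - 1) * (1 + s) ∂G := by
  have hwm := hw.measurable
  have := h.isFiniteMeasure_restrict u
  have := h.isFiniteMeasure_overshoot u
  have hi := h.integrable_weight hw hG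
  obtain ⟨h1, h2⟩ := h.setIntegral_cross_le u (le_refl 0) (ψ := fun s => w s - 1) (by fun_prop)
    (fun s _ => by linarith [hw.one_le s]) hi
  simp only [add_zero] at h1 h2
  have hset : MeasurableSet {p : ℝ × ℝ | u < p.1 + p.2} :=
    measurableSet_lt measurable_const (by fun_prop)
  have hpos : ∀ᵐ p ∂(stepPair G U u), p.1 ≤ u := by
    have : ∀ᵐ v ∂(U.restrict (Set.Iic u)), v ≤ u := ae_restrict_mem measurableSet_Iic
    exact Measure.quasiMeasurePreserving_fst.ae this
  have hle : ∀ᵐ p ∂((stepPair G U u).restrict {p | u < p.1 + p.2}),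
      w (p.1 + p.2 - u) - 1 ≤ w p.2 - 1 := by
    filter_upwards [ae_restrict_of_ae hpos] with p hp
    linarith [hw.monotone (by linarith : p.1 + p.2 - u ≤ p.2)]
  have j : Integrable (fun p : ℝ × ℝ => w (p.1 + p.2 - u) - 1)
      ((stepPair G U u).restrict {p | u < p.1 + p.2}) := by
    refine Integrable.mono' h1 (Measurable.aestronglyMeasurable (by fun_prop)) ?_
    filter_upwards [hle] with p hp
    rw [Real.norm_of_nonneg (by linarith [hw.one_le (p.1 + p.2 - u)])]
    exact hp
  have j' : Integrable (fun r => w r - 1) (overshoot G U u) := by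
    rw [overshoot, integrable_map_measure (Measurable.aestronglyMeasurable (by fun_prop))
      (by fun_prop)]
    exact j
  refine ⟨?_, ?_⟩
  · have := j'.add (integrable_const (1 : ℝ))
    refine this.congr (Eventually.of_forall fun r => ?_)
    simp
  · rw [overshoot, integral_map (f := fun r => w r - 1) (by fun_prop)
      (Measurable.aestronglyMeasurable (by fun_prop))]
    refine (integral_mono_ae j h1 hle).trans (h2.trans ?_)
    refine mul_le_mul_of_nonneg_left (setIntegral_le_integral hi ?_) h.pos.le
    filter_upwards [h.ae_pos] with s hs
    exact mul_nonneg (by linarith [hw.one_le s]) (by linarith)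

/-- Both starting points are run down to the common level t = min y y' - u₀. The accumulated terms
cost at most 2K/w(t), and the overshoot laws, sharing ψ, shrink the assumed bound;
submultiplicativity turns 1/w(t) into w(u₀)/w(min y y'). If t < 0, the bound M on the defect
suffices. -/
theorem contraction (h : IsRenewal G U C) (hw : IsWeight w)
    (hG : Integrable (fun s => (1 + s) ^ 2 * w s) G) {ψ : Measure ℝ} {u₀ : ℝ} (hu₀ : 0 ≤ u₀)
    (hψ : ∀ u, u₀ ≤ u → ψ ≤ overshoot G U u) {M : ℝ} (hM : ∀ x, |renewalDefect G U x| ≤ M)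
    {X B : ℝ} (hB : 0 ≤ B)
    (hS : ∀ y y', min y y' ≤ X →
      renewalDefect G U y - renewalDefect G U y' ≤ B / w (min y y')) (y y' : ℝ)
    (hy : min y y' ≤ X) :
    renewalDefect G U y - renewalDefect G U y' ≤
      (w u₀ * (1 - ψ.real Set.univ + 2 * (C * ∫ s, (w s - 1) * (1 + s) ∂G)) * B +
        w u₀ * (2 * (C * (∫ s, (1 + s) ^ 2 * w s ∂G) / (∫ s, s ∂G)) + 2 * M)) /
        w (min y y') := by
  set Z := renewalDefect G U
  set m := min y y' with hm
  set κ := C * ∫ s, (w s - 1) * (1 + s) ∂G with hκ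
  set K := C * (∫ s, (1 + s) ^ 2 * w s ∂G) / (∫ s, s ∂G) with hK
  have hG2 := integrable_sq_of_weight hw hG
  have hμ := h.mean_pos (h.integrable_of_sq hG2)
  have hM0 : 0 ≤ M := (abs_nonneg _).trans (hM 0)
  have hK0 : 0 ≤ K := div_nonneg (mul_nonneg h.pos.le (integral_nonneg fun s =>
    mul_nonneg (sq_nonneg _) (hw.pos s).le)) hμ.le
  have hκ0 : 0 ≤ κ := by
    refine mul_nonneg h.pos.le (integral_nonneg_of_ae ?_)
    filter_upwards [h.ae_pos] with s hs
    exact mul_nonneg (by linarith [hw.one_le s]) (by linarith)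
  have := h.isProbabilityMeasure_overshoot hu₀
  have hη : ψ.real Set.univ ≤ 1 := by
    have h1 := hψ u₀ le_rfl Set.univ
    rw [measure_univ (μ := overshoot G U u₀)] at h1
    exact ENNReal.toReal_le_of_le_ofReal zero_le_one (by simpa using h1)
  have hwu := hw.pos u₀
  have hwm := hw.pos m
  rw [le_div_iff₀ hwm]
  set t := m - u₀ with ht
  rcases lt_or_ge t 0 with h0 | h0
  · have h1 : w m ≤ w u₀ := hw.monotone (by linarith)
    have h2 : Z y - Z y' ≤ 2 * M := by
      have := abs_le.1 (hM y)
      have := abs_le.1 (hM y')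
      linarith
    calc (Z y - Z y') * w m ≤ 2 * M * w m := by gcongr
      _ ≤ 2 * M * w u₀ := by gcongr
      _ ≤ _ := by
          have : 0 ≤ w u₀ * (1 - ψ.real Set.univ + 2 * κ) * B :=
            mul_nonneg (mul_nonneg hwu.le (by linarith)) hB
          nlinarith [mul_nonneg hwu.le hK0]
  · have hy1 : u₀ ≤ y - t := by linarith [min_le_left y y']
    have hy2 : u₀ ≤ y' - t := by linarith [min_le_right y y']
    have := h.isProbabilityMeasure_overshoot (hu₀.trans hy1)
    have := h.isProbabilityMeasure_overshoot (hu₀.trans hy2)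
    have hZm : Measurable Z := h.measurable_renewalDefect
    have i1 := h.overshoot_identity hZm hM (hu₀.trans hy1) t
    have i2 := h.overshoot_identity hZm hM (hu₀.trans hy2) t
    have a1 := (abs_le.1 (h.abs_accumulated_le hw hG (y - t) h0)).2
    have a2 := (abs_le.1 (h.abs_accumulated_le hw hG (y' - t) h0)).1
    rw [add_sub_cancel] at i1 i2 a1 a2
    obtain ⟨o1, o2⟩ := h.overshoot_weight hw hG (y - t)
    obtain ⟨o3, o4⟩ := h.overshoot_weight hw hG (y' - t)
    have hwt := hw.pos t
    have d := integral_sub_le_of_common (hψ _ hy1) (hψ _ hy2) (overshoot_Iic_zero _)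
      (overshoot_Iic_zero _) hw (g := fun r => Z (t - r)) (hZm.comp (by fun_prop))
      (fun r => hM _) (A := B / w t) (κ := κ) (div_nonneg hB hwt.le) (fun r r' hr hr' => by
        have hmin : min (t - r) (t - r') = t - max r r' := min_sub_sub_left t r r'
        have h1 := hS (t - r) (t - r') (by
          rw [hmin]; linarith [le_max_left r r'])
        rw [hmin] at h1
        refine h1.trans ?_
        -- By submultiplicativity, w(t) ≤ w(t - max r r') w(max r r'), and w(max r r') ≤ w(r) +
        -- w(r') - 1.
        rw [div_mul_eq_mul_div, div_le_div_iff₀ (hw.pos _) hwt, mul_assoc]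
        refine mul_le_mul_of_nonneg_left ?_ hB
        have h2 := hw.submul (t - max r r') (max r r')
        rw [sub_add_cancel] at h2
        have h3 := mul_le_mul_of_nonneg_left (hw.max_le r r') (hw.pos (t - max r r')).le
        linarith) o1 o3 o2 o4
    have hD : Z y - Z y' ≤ (2 * K + B * (1 - ψ.real Set.univ + 2 * κ)) / w t := by
      rw [add_div, mul_div_assoc, ← div_mul_eq_mul_div]
      rw [i1, i2]
      linarith
    have hsm : w m ≤ w t * w u₀ := by
      have := hw.submul t u₀
      rwa [ht, sub_add_cancel] at this
    have hnum : 0 ≤ 2 * K + B * (1 - ψ.real Set.univ + 2 * κ) :=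
      add_nonneg (by linarith) (mul_nonneg hB (by linarith))
    calc (Z y - Z y') * w m ≤ (2 * K + B * (1 - ψ.real Set.univ + 2 * κ)) / w t * w m := by gcongr
      _ ≤ (2 * K + B * (1 - ψ.real Set.univ + 2 * κ)) / w t * (w t * w u₀) := by gcongr
      _ = (2 * K + B * (1 - ψ.real Set.univ + 2 * κ)) * w u₀ := by field_simp
      _ ≤ _ := by nlinarith [mul_nonneg hwu.le hM0]

/-- Iterating the contraction gives a bound K/(1 - θ) that has forgotten the initial one; this
yields both the Cauchy property and the rate. -/
theorem exists_tendsto_rate (h : IsRenewal G U C) (hw : IsWeight w)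
    (hG : Integrable (fun s => (1 + s) ^ 2 * w s) G) {ψ : Measure ℝ} {u₀ : ℝ} (hu₀ : 0 ≤ u₀)
    (hψ : ∀ u, u₀ ≤ u → ψ ≤ overshoot G U u) (hlim : Tendsto w atTop atTop)
    (hθ : w u₀ * (1 - ψ.real Set.univ + 2 * (C * ∫ s, (w s - 1) * (1 + s) ∂G)) < 1) :
    ∃ ℓ B : ℝ, Tendsto (renewalDefect G U) atTop (𝓝 ℓ) ∧
      ∀ x, |renewalDefect G U x - ℓ| ≤ B / w x := by
  obtain ⟨M, hM0, hM⟩ := h.exists_abs_renewalDefect_le (integrable_sq_of_weight hw hG)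
  set Z := renewalDefect G U with hZ
  set θ := w u₀ * (1 - ψ.real Set.univ + 2 * (C * ∫ s, (w s - 1) * (1 + s) ∂G)) with hθd
  set K := w u₀ * (2 * (C * (∫ s, (1 + s) ^ 2 * w s ∂G) / (∫ s, s ∂G)) + 2 * M) with hK
  have hμ := h.mean_pos (h.integrable_of_sq (integrable_sq_of_weight hw hG))
  have hK0 : 0 ≤ K := by
    have : 0 ≤ ∫ s, (1 + s) ^ 2 * w s ∂G := integral_nonneg fun s =>
      mul_nonneg (sq_nonneg _) (hw.pos s).le
    have := h.pos
    have := hw.pos u₀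
    positivity
  have hθ0 : 0 ≤ θ := by
    have := h.isProbabilityMeasure_overshoot hu₀
    have hη : ψ.real Set.univ ≤ 1 := by
      have h1 := hψ u₀ le_rfl Set.univ
      rw [measure_univ (μ := overshoot G U u₀)] at h1
      exact ENNReal.toReal_le_of_le_ofReal zero_le_one (by simpa using h1)
    have hκ0 : 0 ≤ ∫ s, (w s - 1) * (1 + s) ∂G := by
      refine integral_nonneg_of_ae ?_
      filter_upwards [h.ae_pos] with s hs
      exact mul_nonneg (by linarith [hw.one_le s]) (by linarith)
    have := mul_nonneg h.pos.le hκ0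
    exact mul_nonneg (hw.pos u₀).le (by linarith)
  -- The cutoff X provides the finite starting constant 2M w(X), as w is unbounded; the limit in n
  -- no longer depends on it.
  have hiter : ∀ (X : ℝ) (n : ℕ), ∀ y y', min y y' ≤ X →
      Z y - Z y' ≤ (θ ^ n * (2 * M * w X) + K / (1 - θ)) / w (min y y') := by
    intro X n
    have hKθ : 0 ≤ K / (1 - θ) := div_nonneg hK0 (by linarith)
    induction n with
    | zero =>
      intro y y' hy
      rw [le_div_iff₀ (hw.pos _), pow_zero, one_mul]
      have h2 : Z y - Z y' ≤ 2 * M := by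
        have := abs_le.1 (hM y)
        have := abs_le.1 (hM y')
        linarith
      calc (Z y - Z y') * w (min y y') ≤ 2 * M * w (min y y') := by
            gcongr; exact (hw.pos _).le
        _ ≤ 2 * M * w X := by gcongr; exact hw.monotone hy
        _ ≤ _ := by linarith
    | succ n ih =>
      intro y y' hy
      have hB : 0 ≤ θ ^ n * (2 * M * w X) + K / (1 - θ) := by
        have := hw.pos X
        positivity
      refine (h.contraction hw hG hu₀ hψ hM hB ih y y' hy).trans (le_of_eq ?_)
      congr 1
      have : 1 - θ ≠ 0 := by linarith
      change θ * (θ ^ n * (2 * M * w X) + K / (1 - θ)) + K = _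
      field_simp
      ring
  have hfin : ∀ y y', Z y - Z y' ≤ K / (1 - θ) / w (min y y') := by
    intro y y'
    have h1 : Tendsto (fun n => (θ ^ n * (2 * M * w (min y y')) + K / (1 - θ)) / w (min y y'))
        atTop (𝓝 ((0 * (2 * M * w (min y y')) + K / (1 - θ)) / w (min y y'))) :=
      (((tendsto_pow_atTop_nhds_zero_of_lt_one hθ0 hθ).mul_const _).add_const _).div_const _
    rw [zero_mul, zero_add] at h1
    exact ge_of_tendsto h1 (Eventually.of_forall fun n => hiter _ n y y' le_rfl)
  have habs : ∀ y y', y ≤ y' → |Z y - Z y'| ≤ K / (1 - θ) / w y := by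
    intro y y' hyy
    have h1 := hfin y y'
    have h2 := hfin y' y
    rw [min_eq_left hyy] at h1
    rw [min_eq_right hyy] at h2
    exact abs_le.2 ⟨by linarith, h1⟩
  have hdec : Tendsto (fun y => K / (1 - θ) / w y) atTop (𝓝 0) := hlim.const_div_atTop _
  have hcauchy : CauchySeq Z := by
    refine Metric.cauchySeq_iff'.2 fun ε hε => ?_
    obtain ⟨N, hN⟩ := ((hdec.eventually (gt_mem_nhds hε)).and (eventually_ge_atTop 0)).exists
    refine ⟨N, fun n hn => ?_⟩
    rw [dist_comm, Real.dist_eq]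
    exact (habs N n hn).trans_lt hN.1
  obtain ⟨ℓ, hℓ⟩ := cauchySeq_tendsto_of_complete hcauchy
  refine ⟨ℓ, K / (1 - θ), hℓ, fun x => ?_⟩
  have h1 : Tendsto (fun y => |Z x - Z y|) atTop (𝓝 |Z x - ℓ|) :=
    (tendsto_const_nhds.sub hℓ).abs
  exact le_of_tendsto h1 ((eventually_ge_atTop x).mono fun y hy => habs x y hy)

end IsRenewal

/-! ### The value of the limit of the defect. -/

theorem tendsto_integral_sub_of_tendsto {f : ℝ → ℝ} (hf : Measurable f) {M ℓ : ℝ}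
    (hM : ∀ x, |f x| ≤ M) (hℓ : Tendsto f atTop (𝓝 ℓ)) (s : ℝ) :
    Tendsto (fun X => ∫ y in X - s..X, f y) atTop (𝓝 (ℓ * s)) := by
  have e : ∀ X, ∫ y in X - s..X, f y = ∫ r in (0 : ℝ)..s, f (X - r) := fun X => by
    rw [intervalIntegral.integral_comp_sub_left (fun y => f y), sub_zero]
  simp only [e]
  have : ℓ * s = ∫ _ in (0 : ℝ)..s, ℓ := by simp [mul_comm]
  rw [this]
  refine intervalIntegral.tendsto_integral_filter_of_dominated_convergence (fun _ => M)
    (Eventually.of_forall fun X =>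
      (hf.comp (measurable_const.sub measurable_id)).aestronglyMeasurable)
    (Eventually.of_forall fun X => Eventually.of_forall fun r _ => hM _) (by simp) ?_
  refine Eventually.of_forall fun r _ => hℓ.comp ?_
  simpa [sub_eq_add_neg] using tendsto_atTop_add_const_right atTop (-r) tendsto_id

theorem integral_excess_eq {s X : ℝ} (hs : 0 ≤ s) (hX : s ≤ X) :
    ∫ y in (0 : ℝ)..X, max (s - y) 0 = s ^ 2 / 2 := by
  have hc : Continuous fun y : ℝ => max (s - y) 0 := by fun_prop
  rw [← intervalIntegral.integral_add_adjacent_intervals (hc.intervalIntegrable 0 s)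
    (hc.intervalIntegrable s X)]
  have e1 : ∫ y in (0 : ℝ)..s, max (s - y) 0 = ∫ y in (0 : ℝ)..s, (s - y) := by
    refine intervalIntegral.integral_congr fun y hy => ?_
    rw [Set.uIcc_of_le hs] at hy
    exact max_eq_left (by linarith [hy.2])
  have e2 : ∫ y in s..X, max (s - y) 0 = ∫ y in s..X, (0 : ℝ) := by
    refine intervalIntegral.integral_congr fun y hy => ?_
    rw [Set.uIcc_of_le hX] at hy
    exact max_eq_right (by linarith [hy.1])
  rw [e1, e2, intervalIntegral.integral_comp_sub_left (fun y => y)]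
  simp

theorem abs_integral_excess_le {s X : ℝ} (hs : 0 ≤ s) (hX : 0 ≤ X) :
    |∫ y in (0 : ℝ)..X, max (s - y) 0| ≤ s ^ 2 / 2 := by
  have hc : Continuous fun y : ℝ => max (s - y) 0 := by fun_prop
  rw [abs_of_nonneg (intervalIntegral.integral_nonneg hX fun y _ => le_max_right _ _),
    ← integral_excess_eq hs (le_max_right X s)]
  exact intervalIntegral.integral_mono_interval le_rfl hX (le_max_left _ _)
    (Eventually.of_forall fun y => le_max_right _ _) (hc.intervalIntegrable _ _)

namespace IsRenewal

variable {G U : Measure ℝ} [IsProbabilityMeasure G] [SFinite U] {C : ℝ}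

/-- Integrate the renewal equation of the defect over `[0, X]`. The left side reduces to the G-mean
of the integral of Z over `[X - s, X]`, which tends to ℓμ; the right side tends to ∫ s² G(ds) /
(2μ). -/
theorem tendsto_renewalDefect_eq (h : IsRenewal G U C) (hG : Integrable (fun s => (1 + s) ^ 2) G)
    {ℓ : ℝ} (hℓ : Tendsto (renewalDefect G U) atTop (𝓝 ℓ)) :
    ℓ = (∫ s, s ^ 2 ∂G) / (2 * (∫ s, s ∂G) ^ 2) := by
  obtain ⟨M, hM0, hM⟩ := h.exists_abs_renewalDefect_le hG
  have hG1 := h.integrable_of_sq hG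
  have hG2 : Integrable (fun s => s ^ 2) G := by
    refine ((h.integrable_mul_of_sq hG).sub hG1).congr (Eventually.of_forall fun s => ?_)
    simp only [Pi.sub_apply]; ring
  have hμ := h.mean_pos hG1
  have hZm := h.measurable_renewalDefect
  have hZi : ∀ a b, IntervalIntegrable (renewalDefect G U) volume a b := fun a b => by
    rw [intervalIntegrable_iff]
    exact Measure.integrableOn_of_bounded (by simp) hZm.aestronglyMeasurable
      (Eventually.of_forall hM)
  set Z := renewalDefect G U with hZ
  set μ := ∫ s, s ∂G with hμd
  have key : ∀ X, 0 ≤ X → ∫ s, ((∫ y in X - s..X, Z y) -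
      (∫ y in (0 : ℝ)..X, max (s - y) 0) / μ) ∂G = 0 := by
    intro X hX
    have hgm : Measurable fun p : ℝ × ℝ => Z p.1 - Z (p.1 - p.2) - max (p.2 - p.1) 0 / μ := by
      fun_prop
    have hgi : Integrable (fun p : ℝ × ℝ => Z p.1 - Z (p.1 - p.2) - max (p.2 - p.1) 0 / μ)
        ((volume.restrict (Set.Ioc 0 X)).prod G) := by
      have hb : Integrable (fun p : ℝ × ℝ => 2 * M + |p.2| / μ)
          ((volume.restrict (Set.Ioc 0 X)).prod G) :=
        (integrable_const _).add ((hG1.abs.div_const μ).comp_snd _)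
      refine hb.mono' hgm.aestronglyMeasurable ?_
      have : ∀ᵐ y ∂(volume.restrict (Set.Ioc 0 X)), 0 < y :=
        (ae_restrict_mem measurableSet_Ioc).mono fun y hy => hy.1
      filter_upwards [Measure.quasiMeasurePreserving_fst.ae this] with p hp
      have a1 := hM p.1
      have a2 := hM (p.1 - p.2)
      have a3 : max (p.2 - p.1) 0 / μ ≤ |p.2| / μ := by
        gcongr
        exact max_le (by linarith [le_abs_self p.2]) (abs_nonneg _)
      have a4 : 0 ≤ max (p.2 - p.1) 0 / μ := by positivity
      rw [Real.norm_eq_abs]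
      rw [abs_le] at a1 a2 ⊢
      constructor <;> linarith
    have sw := integral_integral_swap
      (f := fun y s => Z y - Z (y - s) - max (s - y) 0 / μ) hgi
    have l0 : ∫ y in Set.Ioc 0 X, ∫ s, (Z y - Z (y - s) - max (s - y) 0 / μ) ∂G = 0 := by
      refine setIntegral_eq_zero_of_forall_eq_zero fun y hy => ?_
      have i1 : Integrable (fun s => Z (y - s)) G :=
        Integrable.of_bound (hZm.comp (measurable_const.sub measurable_id)).aestronglyMeasurable M
          (Eventually.of_forall fun s => hM _)
      have i2 : Integrable (fun s => max (s - y) 0 / μ) G :=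
        ((hG1.sub (integrable_const y)).pos_part).div_const _
      have i3 : Integrable (fun s => Z y - Z (y - s)) G := (integrable_const _).sub i1
      rw [integral_sub i3 i2, integral_sub (integrable_const _) i1,
        integral_div]
      have := h.renewalDefect_sub hG1 hy.1.le
      simp only [integral_const, probReal_univ, one_smul]
      linarith
    rw [l0] at sw
    refine Eq.trans ?_ sw.symm
    refine integral_congr_ae (h.ae_pos.mono fun s hs => ?_)
    have hc : Continuous fun y : ℝ => max (s - y) 0 / μ := by fun_prop
    have hsh : IntervalIntegrable (fun y => Z (y - s)) volume 0 X := by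
      rw [intervalIntegrable_iff]
      exact Measure.integrableOn_of_bounded (by simp)
        (hZm.comp (measurable_id.sub measurable_const)).aestronglyMeasurable
        (Eventually.of_forall fun y => hM _)
    simp only
    rw [← intervalIntegral.integral_of_le hX,
      intervalIntegral.integral_sub ((hZi _ _).sub hsh) (hc.intervalIntegrable _ _),
      intervalIntegral.integral_sub (hZi _ _) hsh, intervalIntegral.integral_div,
      intervalIntegral.integral_comp_sub_right (fun y => Z y)]
    congr 1
    -- The shift leaves an integral over negative arguments, where the defect vanishes.
    have z0 : ∫ y in 0 - s..0, Z y = 0 := by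
      rw [intervalIntegral.integral_of_le (by linarith), integral_Ioc_eq_integral_Ioo]
      exact setIntegral_eq_zero_of_forall_eq_zero fun y hy => h.renewalDefect_of_neg hy.2
    have e1 := intervalIntegral.integral_add_adjacent_intervals (hZi (0 - s) 0) (hZi 0 X)
    have e2 := intervalIntegral.integral_add_adjacent_intervals (hZi (0 - s) (X - s)) (hZi (X - s) X)
    linarith
  have lim : Tendsto (fun X => ∫ s, ((∫ y in X - s..X, Z y) -
      (∫ y in (0 : ℝ)..X, max (s - y) 0) / μ) ∂G) atTop
      (𝓝 (∫ s, (ℓ * s - s ^ 2 / 2 / μ) ∂G)) := by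
    refine tendsto_integral_filter_of_dominated_convergence (fun s => M * |s| + s ^ 2 / 2 / μ)
      ?_ ?_ ((hG1.abs.const_mul M).add ((hG2.div_const 2).div_const μ)) ?_
    · refine Eventually.of_forall fun X => Measurable.aestronglyMeasurable ?_
      have c1 : Continuous fun s => ∫ y in X - s..X, Z y := by
        have := intervalIntegral.continuous_primitive hZi 0
        have e : (fun s => ∫ y in X - s..X, Z y) =
            fun s => (∫ y in (0 : ℝ)..X, Z y) - ∫ y in (0 : ℝ)..(X - s), Z y := by
          funext s
          rw [intervalIntegral.integral_interval_sub_left (hZi _ _) (hZi _ _)]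
        rw [e]
        exact continuous_const.sub (this.comp (continuous_const.sub continuous_id))
      have c2 : Continuous fun s => ∫ y in (0 : ℝ)..X, max (s - y) 0 :=
        intervalIntegral.continuous_parametric_intervalIntegral_of_continuous' (by fun_prop) _ _
      exact (c1.sub (c2.div_const μ)).measurable
    · filter_upwards [eventually_ge_atTop 0] with X hX
      filter_upwards [h.ae_pos] with s hs
      refine (norm_sub_le _ _).trans (add_le_add ?_ ?_)
      · have := intervalIntegral.norm_integral_le_of_norm_le_const (a := X - s) (b := X)
          (f := Z) (C := M) fun y _ => hM y
        rwa [sub_sub_cancel] at this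
      · rw [Real.norm_eq_abs, abs_div, abs_of_pos hμ]
        gcongr
        exact abs_integral_excess_le hs.le hX
    · filter_upwards [h.ae_pos] with s hs
      refine (tendsto_integral_sub_of_tendsto hZm hM hℓ s).sub ?_
      refine tendsto_const_nhds.congr' ?_
      filter_upwards [eventually_ge_atTop s] with X hX
      rw [integral_excess_eq hs.le hX]
  have l2 := tendsto_nhds_unique lim (tendsto_const_nhds.congr'
    ((eventually_ge_atTop 0).mono fun X hX => (key X hX).symm))
  rw [integral_sub (hG1.const_mul ℓ) ((hG2.div_const 2).div_const μ), integral_const_mul,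
    integral_div, integral_div] at l2
  change ℓ * μ - _ = 0 at l2
  field_simp at l2 ⊢
  linarith

end IsRenewal

/-! ### Lebesgue lower bounds from convolutions. -/

theorem conv_volume_restrict_apply (m : Measure ℝ) [SFinite m] {B T : Set ℝ} (hB : MeasurableSet B)
    (hT : MeasurableSet T) : (m ∗ volume.restrict B) T = ∫⁻ x in T, m {a | x - a ∈ B} := by
  have hi : ∀ {A : Set ℝ}, MeasurableSet A → Measurable (A.indicator (1 : ℝ → ℝ≥0∞)) :=
    fun hA => measurable_one.indicator hA
  have hBi := hi hB
  have hTi := hi hT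
  calc (m ∗ volume.restrict B) T
      = ∫⁻ a, ∫⁻ b in B, T.indicator 1 (a + b) ∂volume ∂m := by
        rw [← lintegral_indicator_one hT, Measure.lintegral_conv hTi]
    _ = ∫⁻ a, ∫⁻ x, T.indicator 1 x * B.indicator 1 (x - a) ∂volume ∂m := by
        refine lintegral_congr fun a => ?_
        rw [← lintegral_indicator hB,
          ← lintegral_add_right_eq_self (fun x => T.indicator 1 x * B.indicator 1 (x - a)) a]
        refine lintegral_congr fun b => ?_
        rw [add_sub_cancel_right, add_comm b a]
        by_cases hb : b ∈ B <;> simp [hb]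
    _ = ∫⁻ x, ∫⁻ a, T.indicator 1 x * B.indicator 1 (x - a) ∂m :=
        lintegral_lintegral_swap (Measurable.aemeasurable (by fun_prop))
    _ = ∫⁻ x in T, m {a | x - a ∈ B} := by
        rw [← lintegral_indicator hT]
        refine lintegral_congr fun x => ?_
        rw [lintegral_const_mul _ (by fun_prop)]
        have : ∫⁻ a, B.indicator 1 (x - a) ∂m = m {a | x - a ∈ B} :=
          lintegral_indicator_one (hB.preimage (measurable_const.sub measurable_id))
        rw [this]
        by_cases hx : x ∈ T <;> simp [hx]

theorem smul_volume_restrict_le_conv (m : Measure ℝ) [SFinite m] {B S : Set ℝ}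
    (hB : MeasurableSet B) (hS : MeasurableSet S) {η : ℝ≥0∞}
    (h : ∀ x ∈ S, η ≤ m {a | x - a ∈ B}) : η • volume.restrict S ≤ m ∗ volume.restrict B := by
  refine Measure.le_iff.2 fun T hT => ?_
  rw [conv_volume_restrict_apply m hB hT, Measure.smul_apply, Measure.restrict_apply hT,
    smul_eq_mul, ← setLIntegral_const]
  calc ∫⁻ _ in T ∩ S, η ≤ ∫⁻ x in T ∩ S, m {a | x - a ∈ B} :=
        setLIntegral_mono' (hT.inter hS) fun x hx => h x hx.2
    _ ≤ _ := lintegral_mono_set Set.inter_subset_left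

theorem conv_univ (a b : Measure ℝ) [SFinite b] : (a ∗ b) Set.univ = a Set.univ * b Set.univ := by
  rw [Measure.conv, Measure.map_apply (by fun_prop) MeasurableSet.univ, Set.preimage_univ,
    ← Set.univ_prod_univ, Measure.prod_prod]

open scoped Pointwise in
/-- The convolution square of Lebesgue measure on a set of positive measure is bounded below by
Lebesgue measure on some interval. -/
theorem exists_smul_volume_Icc_le_conv {K : Set ℝ} (hK : IsCompact K) (hpos : 0 < volume K) :
    ∃ (η : ℝ≥0∞) (α ℓ : ℝ), η ≠ 0 ∧ 0 < ℓ ∧ η • volume.restrict (Set.Icc α (α + ℓ)) ≤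
      volume.restrict K ∗ volume.restrict K := by
  have hKm := hK.measurableSet
  -- The convolution square has density |K ∩ (x - K)| at x and total mass |K|² > 0, so this density
  -- is not identically zero.
  obtain ⟨x₀, hx₀⟩ : ∃ x₀, 0 < volume.restrict K {a | x₀ - a ∈ K} := by
    by_contra! hc
    have h1 := conv_volume_restrict_apply (volume.restrict K) hKm MeasurableSet.univ
    rw [conv_univ, lintegral_congr (g := fun _ => 0) fun x => nonpos_iff_eq_zero.1 (hc x)] at h1
    simp [hpos.ne'] at h1
  set K' := {a | x₀ - a ∈ K} ∩ K with hK'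
  have hcl : IsClosed {a | x₀ - a ∈ K} := hK.isClosed.preimage (by fun_prop)
  have hc' : IsCompact K' := hK.inter_left hcl
  rw [Measure.restrict_apply hcl.measurableSet] at hx₀
  have hfin : volume K' ≠ ∞ := hc'.measure_lt_top.ne
  -- Continuity of translation: for small shifts, more than half of `K'` overlaps its translate,
  -- which bounds the density below near x₀.
  have hev := eventually_nhds_zero_measure_vadd_sdiff_lt (μ := (volume : Measure ℝ)) hc'
    hc'.isClosed (ε := volume K' / 2) (ENNReal.half_pos hx₀.ne').ne'
  obtain ⟨ε, hε, hball⟩ := Metric.eventually_nhds_iff.1 hev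
  refine ⟨volume K' / 2, x₀ - ε / 2, ε, (ENNReal.half_pos hx₀.ne').ne', hε,
    smul_volume_restrict_le_conv _ hKm measurableSet_Icc fun x hx => ?_⟩
  have hg := hball (y := x - x₀) (by
    rw [dist_zero_right, Real.norm_eq_abs, abs_lt]
    constructor <;> linarith [hx.1, hx.2])
  have hxm : MeasurableSet {a | x - a ∈ K} := hKm.preimage (measurable_const.sub measurable_id)
  rw [Measure.restrict_apply hxm]
  have hsub : ((x - x₀) +ᵥ K') ∩ K' ⊆ {a | x - a ∈ K} ∩ K := by
    rintro _ ⟨⟨k, hk, rfl⟩, hk'⟩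
    refine ⟨?_, hk'.2⟩
    have : x - (x - x₀ + k) = x₀ - k := by ring
    simpa [vadd_eq_add, this] using hk.1
  refine le_trans ?_ (measure_mono hsub)
  have h1 := measure_inter_add_sdiff ((x - x₀) +ᵥ K') hc'.measurableSet (μ := volume)
  rw [measure_vadd] at h1
  have h2 : volume K' ≤ volume (((x - x₀) +ᵥ K') ∩ K') + volume K' / 2 := by
    rw [← h1]; gcongr; rw [h1]; exact hg.le
  rw [← ENNReal.add_halves (volume K')] at h2
  refine (ENNReal.add_le_add_iff_right (ENNReal.div_ne_top hfin two_ne_zero)).1 ?_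
  rw [ENNReal.add_halves] at h2 ⊢
  exact h2

/-- The density is a trapezoid of height ℓ on an interval of length L + ℓ; trimming ℓ/4 at each end
leaves height at least ℓ/4. Each convolution thus lengthens the interval by ℓ/2. -/
theorem smul_volume_Icc_le_conv_Icc {α β ℓ L : ℝ} (hℓ : 0 ≤ ℓ) (hL : ℓ ≤ L) :
    ENNReal.ofReal (ℓ / 4) •
        volume.restrict (Set.Icc (α + β + ℓ / 4) (α + β + ℓ / 4 + (L + ℓ / 2))) ≤
      volume.restrict (Set.Icc α (α + ℓ)) ∗ volume.restrict (Set.Icc β (β + L)) := by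
  refine smul_volume_restrict_le_conv _ measurableSet_Icc measurableSet_Icc fun x hx => ?_
  have e : {a | x - a ∈ Set.Icc β (β + L)} = Set.Icc (x - β - L) (x - β) := by
    ext a
    simp only [Set.mem_Icc, Set.mem_ofPred_eq]
    constructor <;> rintro ⟨h1, h2⟩ <;> constructor <;> linarith
  rw [e, Measure.restrict_apply measurableSet_Icc, Set.Icc_inter_Icc, Real.volume_Icc]
  refine ENNReal.ofReal_le_ofReal ?_
  obtain ⟨h1, h2⟩ := hx
  rcases max_cases (x - β - L) α with ⟨h, _⟩ | ⟨h, _⟩ <;>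
    rcases min_cases (x - β) (α + ℓ) with ⟨h', _⟩ | ⟨h', _⟩ <;> rw [h, h'] <;> linarith

/-- A nonzero absolutely continuous measure is bounded below by a multiple of Lebesgue measure on
some compact set of positive measure. -/
theorem exists_smul_volume_restrict_le {m : Measure ℝ} [SigmaFinite m] (hm : m ≪ volume)
    (h0 : m ≠ 0) : ∃ (c : ℝ≥0∞) (K : Set ℝ), c ≠ 0 ∧ IsCompact K ∧ 0 < volume K ∧
      c • volume.restrict K ≤ m := by
  set f := m.rnDeriv volume
  have hf : Measurable f := Measure.measurable_rnDeriv _ _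
  have hmf : volume.withDensity f = m := Measure.withDensity_rnDeriv_eq _ _ hm
  obtain ⟨n, hn⟩ : ∃ n : ℕ, 0 < volume {x | ((n : ℝ≥0∞) + 1)⁻¹ ≤ f x} := by
    by_contra! hc
    refine h0 ?_
    rw [← hmf, withDensity_eq_zero_iff hf.aemeasurable, Filter.EventuallyEq, ae_iff]
    refine measure_mono_null (t := ⋃ n : ℕ, {x | ((n : ℝ≥0∞) + 1)⁻¹ ≤ f x}) (fun x hx => ?_)
      (measure_iUnion_null fun n => nonpos_iff_eq_zero.1 (hc n))
    obtain ⟨n, hn⟩ := ENNReal.exists_inv_nat_lt (a := f x) (by simpa using hx)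
    refine Set.mem_iUnion.2 ⟨n, le_trans ?_ hn.le⟩
    exact ENNReal.inv_le_inv.2 le_self_add
  have hE : MeasurableSet {x | ((n : ℝ≥0∞) + 1)⁻¹ ≤ f x} := measurableSet_le measurable_const hf
  obtain ⟨K, hKE, hK, hKpos⟩ := hE.exists_lt_isCompact hn
  refine ⟨((n : ℝ≥0∞) + 1)⁻¹, K, by simp, hK, hKpos, ?_⟩
  refine Measure.le_iff.2 fun T hT => ?_
  rw [← hmf, withDensity_apply _ hT, Measure.smul_apply, Measure.restrict_apply hT,
    smul_eq_mul, ← setLIntegral_const]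
  exact (setLIntegral_mono' (hT.inter hK.measurableSet) fun x hx => hKE hx.2).trans
    (lintegral_mono_set Set.inter_subset_left)

/-! ### Spread-out renewal measures and a common part of the overshoot laws. -/

section Absorb

variable {U m m' : Measure ℝ} [SFinite U] [SFinite m] [SFinite m']

-- Absorbed measures are stable under convolution, so a density can be smoothed and widened while
-- staying absorbed by `U`.
omit [SFinite m] in
theorem conv_absorb (h : m ∗ U ≤ U) (h' : m' ∗ U ≤ U) : (m ∗ m') ∗ U ≤ U := by
  rw [Measure.conv_assoc]
  exact (Measure.conv_mono le_rfl h').trans h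

theorem exists_absorb_volume_Icc (hm : m ≪ volume) (h0 : m ≠ 0) [SigmaFinite m] (h : m ∗ U ≤ U) :
    ∃ (c : ℝ≥0∞) (α ℓ : ℝ), c ≠ 0 ∧ 0 < ℓ ∧
      (c • volume.restrict (Set.Icc α (α + ℓ))) ∗ U ≤ U := by
  obtain ⟨c, K, hc, hK, hKpos, hle⟩ := exists_smul_volume_restrict_le hm h0
  obtain ⟨η, α, ℓ, hη, hℓ, hle'⟩ := exists_smul_volume_Icc_le_conv hK hKpos
  refine ⟨c * (c * η), α, ℓ, by simp [hc, hη], hℓ, ?_⟩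
  refine le_trans (Measure.conv_mono ?_ le_rfl) (conv_absorb h h)
  refine le_trans ?_ (Measure.conv_mono hle hle)
  rw [Measure.conv_smul_left, Measure.conv_smul_right, mul_smul, mul_smul]
  gcongr

theorem exists_absorb_volume_Icc_ge (hm : m ≪ volume) (h0 : m ≠ 0) [SigmaFinite m]
    (h : m ∗ U ≤ U) (L : ℝ) : ∃ (c : ℝ≥0∞) (α ℓ : ℝ), c ≠ 0 ∧ L ≤ ℓ ∧
      (c • volume.restrict (Set.Icc α (α + ℓ))) ∗ U ≤ U := by
  obtain ⟨c, α, ℓ, hc, hℓ, hle⟩ := exists_absorb_volume_Icc hm h0 h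
  have key : ∀ k : ℕ, ∃ (d : ℝ≥0∞) (β : ℝ), d ≠ 0 ∧
      (d • volume.restrict (Set.Icc β (β + (ℓ + k * (ℓ / 2))))) ∗ U ≤ U := by
    intro k
    induction k with
    | zero => exact ⟨c, α, hc, by simpa using hle⟩
    | succ k ih =>
      obtain ⟨d, β, hd, hle''⟩ := ih
      refine ⟨c * (d * ENNReal.ofReal (ℓ / 4)), α + β + ℓ / 4, ?_, ?_⟩
      · simp [hc, hd, hℓ]
      · refine le_trans (Measure.conv_mono ?_ le_rfl) (conv_absorb hle hle'')
        rw [Measure.conv_smul_left, Measure.conv_smul_right, mul_smul, mul_smul]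
        have e : ℓ + ((k + 1 : ℕ) : ℝ) * (ℓ / 2) = ℓ + k * (ℓ / 2) + ℓ / 2 := by push_cast; ring
        rw [e]
        gcongr
        exact smul_volume_Icc_le_conv_Icc hℓ.le (by
          have : 0 ≤ (k : ℝ) * (ℓ / 2) := by positivity
          linarith)
  obtain ⟨k, hk⟩ := exists_nat_ge (L / (ℓ / 2))
  obtain ⟨d, β, hd, hle'⟩ := key k
  rw [div_le_iff₀ (by linarith)] at hk
  exact ⟨d, β, _, hd, by linarith, hle'⟩

end Absorb

namespace IsRenewal

variable {G U : Measure ℝ} [IsProbabilityMeasure G] [SFinite U] {C : ℝ}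

/-- Since the defect is bounded by M, a window of length L' has mass at least L'/μ - 2M. -/
theorem one_le_window (h : IsRenewal G U C) (hG : Integrable (fun s => (1 + s) ^ 2) G) :
    ∃ L, 0 ≤ L ∧ ∀ L' x, L ≤ L' → L' ≤ x → 1 ≤ U (Set.Icc (x - L') x) := by
  obtain ⟨M, hM0, hM⟩ := h.exists_abs_renewalDefect_le hG
  have hμ := h.mean_pos (h.integrable_of_sq hG)
  refine ⟨(1 + 2 * M) * ∫ s, s ∂G, by positivity, fun L' x hL' hx => ?_⟩
  have hL0 : 0 ≤ L' := le_trans (by positivity) hL'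
  have h1 := (abs_le.1 (hM x)).1
  have h2 := (abs_le.1 (hM (x - L'))).2
  rw [renewalDefect, max_eq_left (by linarith)] at h1 h2
  rw [← le_div_iff₀ hμ] at hL'
  rw [sub_div] at h2
  have h3 : U.real (Set.Iic (x - L')) + 1 ≤ U.real (Set.Iic x) := by linarith
  have h4 : U (Set.Iic x) ≤ U (Set.Iic (x - L')) + U (Set.Icc (x - L') x) := by
    refine le_trans (measure_mono fun y hy => ?_) (measure_union_le _ _)
    rcases le_total y (x - L') with hyx | hyx
    · exact Or.inl hyx
    · exact Or.inr ⟨hyx, hy⟩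
  rw [measureReal_def, measureReal_def] at h3
  rw [← ENNReal.add_le_add_iff_left (h.Iic_ne_top (x - L'))]
  refine le_trans ?_ h4
  rw [← ENNReal.toReal_le_toReal (by simp [h.Iic_ne_top]) (h.Iic_ne_top x),
    ENNReal.toReal_add (h.Iic_ne_top _) ENNReal.one_ne_top, ENNReal.toReal_one]
  exact h3

/-- A renewal measure that absorbs a nonzero absolutely continuous measure is bounded below by a
multiple of Lebesgue measure near infinity. -/
theorem exists_smul_volume_Ici_le (h : IsRenewal G U C) (hG : Integrable (fun s => (1 + s) ^ 2) G)
    {m : Measure ℝ} [SigmaFinite m] (hm : m ≪ volume) (h0 : m ≠ 0) (hU : m ∗ U ≤ U) :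
    ∃ (c : ℝ≥0∞) (x₀ : ℝ), c ≠ 0 ∧ 0 ≤ x₀ ∧ c • volume.restrict (Set.Ici x₀) ≤ U := by
  obtain ⟨L, hL0, hL⟩ := h.one_le_window hG
  obtain ⟨c, α, ℓ, hc, hℓ, hle⟩ := exists_absorb_volume_Icc_ge hm h0 hU L
  -- For x ≥ α + ℓ the window `[x - α - ℓ, x - α]` lies in `[0, ∞)` and is long enough to have
  -- `U`-mass at least 1.
  refine ⟨c, max 0 (α + ℓ), hc, le_max_left _ _, le_trans ?_ hle⟩
  rw [Measure.conv_smul_left, Measure.conv_comm]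
  gcongr
  rw [← one_smul ℝ≥0∞ (volume.restrict (Set.Ici (max 0 (α + ℓ))))]
  refine smul_volume_restrict_le_conv _ measurableSet_Icc measurableSet_Ici fun x hx => ?_
  have hx' : α + ℓ ≤ x := (le_max_right _ _).trans hx
  refine (hL ℓ (x - α) hℓ (by linarith)).trans (measure_mono fun a ha => ?_)
  exact ⟨by linarith [ha.2], by linarith [ha.1]⟩

/-- Fix `[b, L]` charged by `G`. A step s in it produces an overshoot in `(0, b]` exactly from
positions in `(u - s, u - s + b]`; for u ≥ x₀ + L these lie below u and where `U` dominates Lebesgue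
measure. The resulting lower bound does not depend on u. -/
theorem exists_le_overshoot (h : IsRenewal G U C) {c : ℝ≥0∞} {x₀ : ℝ} (hc : c ≠ 0) (hx₀ : 0 ≤ x₀)
    (hU : c • volume.restrict (Set.Ici x₀) ≤ U) :
    ∃ (ψ : Measure ℝ) (u₀ : ℝ), 0 ≤ u₀ ∧ 0 < ψ.real Set.univ ∧
      ∀ u, u₀ ≤ u → ψ ≤ overshoot G U u := by
  obtain ⟨n, hn⟩ : ∃ n : ℕ, 0 < G (Set.Icc ((n : ℝ) + 1)⁻¹ (n + 1)) := by
    by_contra! hcon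
    have hall : G Set.univ = 0 := by
      refine measure_mono_null (t := Set.Iic 0 ∪ ⋃ n : ℕ, Set.Icc ((n : ℝ) + 1)⁻¹ (n + 1))
        (fun x _ => ?_) (measure_union_null h.step_pos
          (measure_iUnion_null fun n => nonpos_iff_eq_zero.1 (hcon n)))
      rcases le_or_gt x 0 with hx | hx
      · exact Or.inl hx
      · obtain ⟨n, hn⟩ := exists_nat_ge (max x x⁻¹)
        refine Or.inr (Set.mem_iUnion.2 ⟨n, ?_, ?_⟩)
        · exact inv_le_of_inv_le₀ hx (by linarith [le_max_right x x⁻¹])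
        · linarith [le_max_left x x⁻¹]
    simp at hall
  set b := ((n : ℝ) + 1)⁻¹
  set L : ℝ := n + 1
  have hb : 0 < b := by positivity
  have hle : ∀ u, x₀ + L ≤ u →
      (c * G (Set.Icc b L)) • volume.restrict (Set.Ioc 0 b) ≤ overshoot G U u := by
    intro u hu
    refine Measure.le_iff.2 fun A hA => ?_
    set A' := A ∩ Set.Ioc 0 b
    have hA' : MeasurableSet A' := hA.inter measurableSet_Ioc
    have hset : MeasurableSet {p : ℝ × ℝ | u < p.1 + p.2} :=
      measurableSet_lt measurable_const (by fun_prop)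
    have hpre : MeasurableSet ((fun p : ℝ × ℝ => p.1 + p.2 - u) ⁻¹' A') :=
      hA'.preimage (by fun_prop)
    calc ((c * G (Set.Icc b L)) • volume.restrict (Set.Ioc 0 b)) A
        = ∫⁻ _ in Set.Icc b L, c * volume A' ∂G := by
          rw [Measure.smul_apply, Measure.restrict_apply hA, smul_eq_mul, setLIntegral_const]
          ring
      _ ≤ ∫⁻ s in Set.Icc b L,
            U.restrict (Set.Iic u) ((fun v => (v, s)) ⁻¹' ((fun p => p.1 + p.2 - u) ⁻¹' A')) ∂G := by
          refine setLIntegral_mono' measurableSet_Icc fun s hs => ?_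
          have hm : MeasurableSet ((fun v : ℝ => v + (s - u)) ⁻¹' A') :=
            hA'.preimage (by fun_prop)
          have e : (fun v => (v, s)) ⁻¹' ((fun p : ℝ × ℝ => p.1 + p.2 - u) ⁻¹' A') =
              (fun v : ℝ => v + (s - u)) ⁻¹' A' := by
            ext v; simp [add_sub_assoc]
          rw [e, Measure.restrict_apply hm, Set.inter_eq_self_of_subset_left (fun v hv => by
            have := hv.2.2
            rw [Set.mem_Iic]; linarith [hs.1])]
          refine le_trans ?_ (hU _)
          rw [Measure.smul_apply, Measure.restrict_apply hm, smul_eq_mul,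
            Set.inter_eq_self_of_subset_left (fun v hv => by
              have := hv.2.1
              rw [Set.mem_Ici]; linarith [hs.2]), measure_preimage_add_right]
      _ ≤ ∫⁻ s, U.restrict (Set.Iic u)
            ((fun v => (v, s)) ⁻¹' ((fun p => p.1 + p.2 - u) ⁻¹' A')) ∂G :=
          setLIntegral_le_lintegral _ _
      _ = stepPair G U u ((fun p => p.1 + p.2 - u) ⁻¹' A') :=
          (Measure.prod_apply_symm hpre).symm
      _ ≤ overshoot G U u A := by
          rw [overshoot, Measure.map_apply (by fun_prop) hA,
            Measure.restrict_apply (hA.preimage (by fun_prop))]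
          refine measure_mono fun p hp => ⟨hp.1, ?_⟩
          have := hp.2.1
          simp only [Set.mem_ofPred_eq]
          linarith
  refine ⟨(c * G (Set.Icc b L)) • volume.restrict (Set.Ioc 0 b), x₀ + L, by positivity, ?_, hle⟩
  have h1 := hle _ le_rfl Set.univ
  have := h.isFiniteMeasure_overshoot (x₀ + L)
  refine ENNReal.toReal_pos ?_ (h1.trans_lt (measure_lt_top _ _)).ne
  simp [hc, hn.ne', hb]

end IsRenewal

/-! ### Convolution powers, as killed laws without killing. -/

section Powers

variable {m : Measure ℝ} [IsFiniteMeasure m]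

theorem isFiniteMeasure_killed_univ (n : ℕ) : IsFiniteMeasure (killed m Set.univ n) := by
  induction n with
  | zero => unfold killed; infer_instance
  | succ n ih => unfold killed; infer_instance

theorem killed_univ_mono {m' : Measure ℝ} [IsFiniteMeasure m'] (hle : m ≤ m') (n : ℕ) :
    killed m Set.univ n ≤ killed m' Set.univ n := by
  induction n with
  | zero => exact le_rfl
  | succ n ih =>
    simp only [killed, Measure.restrict_univ]
    exact Measure.conv_mono ih hle

theorem killed_univ_apply_univ (n : ℕ) : killed m Set.univ n Set.univ = m Set.univ ^ n := by
  induction n with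
  | zero => simp [killed]
  | succ n ih => rw [killed, Measure.restrict_univ, conv_univ, ih, pow_succ]

theorem killed_univ_absorb {U : Measure ℝ} [SFinite U] (h : m ∗ U ≤ U) (n : ℕ) :
    killed m Set.univ n ∗ U ≤ U := by
  induction n with
  | zero => simp [killed]
  | succ n ih =>
    have := isFiniteMeasure_killed_univ (m := m) n
    rw [killed, Measure.restrict_univ]
    exact conv_absorb ih h

end Powers

theorem map_walk {Ω : Type*} [MeasurableSpace Ω] {P : Measure Ω} [IsProbabilityMeasure P]
    {z : ℕ → Ω → ℝ} {ζ : Measure ℝ} [IsProbabilityMeasure ζ] (hz : ∀ n, Measurable (z n))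
    (hind : iIndepFun z P) (hlaw : ∀ n, P.map (z n) = ζ) (n : ℕ) :
    P.map (walk z n) = killed ζ Set.univ n := by
  refine Measure.ext_of_lintegral _ fun f hf => ?_
  rw [lintegral_map hf (measurable_walk hz n),
    ← setLIntegral_walk hz hind hlaw MeasurableSet.univ n f hf]
  have : stays z Set.univ n = Set.univ := by simp [stays]
  rw [this, Measure.restrict_univ]

/-! ### Moments of the ladder height. -/

section Moments

variable {ζ : Measure ℝ} [IsProbabilityMeasure ζ]

omit [IsProbabilityMeasure ζ] in
theorem green_Iic_Ioi : green ζ (Set.Iic 0) (Set.Ioi 0) = 0 := by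
  rw [green, Measure.sum_apply _ measurableSet_Ioi]
  simp [killed_Iic_Ioi]

/-- The ladder height is x + t, with x ≤ 0 the position before the crossing step t. A crossing
requires x > -t, and the height is at most t. -/
theorem lintegral_ladderLaw_le {φ : ℝ → ℝ≥0∞} (hφ : Monotone φ) :
    ∫⁻ s, φ s ∂(ladderLaw ζ (Set.Iic 0)) ≤
      ∫⁻ t in Set.Ioi 0, φ t * green ζ (Set.Iic 0) (Set.Icc (-t) 0) ∂ζ := by
  have hφm := hφ.measurable
  set ψ := (Set.Ioi (0 : ℝ)).indicator φ with hψ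
  have hψm : Measurable ψ := hφm.indicator measurableSet_Ioi
  have hae : ∀ᵐ x ∂(green ζ (Set.Iic 0)), x ≤ 0 := by
    rw [ae_iff]; simpa [Set.Ioi] using green_Iic_Ioi (ζ := ζ)
  have e : ∫⁻ s, φ s ∂(ladderLaw ζ (Set.Iic 0)) =
      ∫⁻ x, ∫⁻ t, ψ (x + t) ∂ζ ∂(green ζ (Set.Iic 0)) := by
    rw [ladderLaw, lintegral_sum_measure, green, lintegral_sum_measure]
    refine tsum_congr fun n => ?_
    rw [exitLaw, Set.compl_Iic, ← lintegral_indicator measurableSet_Ioi,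
      Measure.lintegral_conv hψm]
  rw [e, lintegral_lintegral_swap (Measurable.aemeasurable (by fun_prop)),
    ← lintegral_indicator measurableSet_Ioi]
  refine lintegral_mono fun t => ?_
  rcases le_or_gt t 0 with ht | ht
  · refine le_of_eq_of_le (lintegral_congr_ae (g := fun _ => 0) ?_) (by simp)
    filter_upwards [hae] with x hx
    simp only [hψ]
    rw [Set.indicator_of_notMem]
    rw [Set.mem_Ioi, not_lt]; linarith
  · rw [Set.indicator_of_mem (Set.mem_Ioi.2 ht), ← setLIntegral_const,
      ← lintegral_indicator measurableSet_Icc]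
    refine lintegral_mono_ae ?_
    filter_upwards [hae] with x hx
    by_cases hxt : 0 < x + t
    · rw [Set.indicator_of_mem (show x ∈ Set.Icc (-t) 0 from ⟨by linarith, hx⟩), hψ,
        Set.indicator_of_mem (Set.mem_Ioi.2 hxt)]
      exact hφ (by linarith)
    · rw [hψ, Set.indicator_of_notMem (by simpa using hxt)]
      exact zero_le

/-- The Green mass of `[-t, 0]` is at most C(1 + t); this costs the ladder height one power relative
to the step. -/
theorem integrable_ladderLaw (h : IsCentered ζ) {w : ℝ → ℝ} (hw : Monotone w) (hw0 : ∀ x, 0 ≤ w x)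
    (hi : IntegrableOn (fun t => (1 + t) ^ 3 * w t) (Set.Ioi 0) ζ) :
    Integrable (fun s => (1 + s) ^ 2 * w s) (ladderLaw ζ (Set.Iic 0)) := by
  obtain ⟨C, hC, hle⟩ := exists_green_Iic_Icc_le h
  have hwm := hw.measurable
  have hae : ∀ᵐ s ∂(ladderLaw ζ (Set.Iic 0)), 0 < s := by
    rw [ae_iff]; simpa [Set.Iic] using ladderLaw_Iic_Iic (ζ := ζ)
  have hmono : Monotone fun s => ENNReal.ofReal ((1 + max s 0) ^ 2 * w s) := by
    intro a b hab
    refine ENNReal.ofReal_le_ofReal (mul_le_mul ?_ (hw hab) (hw0 _) (by positivity))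
    gcongr
  refine ⟨Measurable.aestronglyMeasurable (by fun_prop), ?_⟩
  rw [hasFiniteIntegral_iff_norm]
  calc ∫⁻ s, ENNReal.ofReal ‖(1 + s) ^ 2 * w s‖ ∂(ladderLaw ζ (Set.Iic 0))
      = ∫⁻ s, ENNReal.ofReal ((1 + max s 0) ^ 2 * w s) ∂(ladderLaw ζ (Set.Iic 0)) := by
        refine lintegral_congr_ae (hae.mono fun s hs => ?_)
        simp only
        rw [max_eq_left hs.le, Real.norm_of_nonneg (mul_nonneg (sq_nonneg _) (hw0 s))]
    _ ≤ _ := lintegral_ladderLaw_le hmono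
    _ ≤ ∫⁻ t in Set.Ioi 0, ENNReal.ofReal C * ENNReal.ofReal ‖(1 + t) ^ 3 * w t‖ ∂ζ := by
        refine setLIntegral_mono' measurableSet_Ioi fun t ht => ?_
        rw [Set.mem_Ioi] at ht
        rw [max_eq_left ht.le, ← ENNReal.ofReal_mul hC.le]
        refine (mul_le_mul_right (hle t ht.le) _).trans ?_
        rw [← ENNReal.ofReal_mul (mul_nonneg (sq_nonneg _) (hw0 t)),
          Real.norm_of_nonneg (mul_nonneg (by positivity) (hw0 t))]
        exact ENNReal.ofReal_le_ofReal (le_of_eq (by ring))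
    _ = ENNReal.ofReal C * ∫⁻ t in Set.Ioi 0, ENNReal.ofReal ‖(1 + t) ^ 3 * w t‖ ∂ζ :=
        lintegral_const_mul _ (by fun_prop)
    _ < ∞ := ENNReal.mul_lt_top ENNReal.ofReal_lt_top
        ((hasFiniteIntegral_iff_norm _).1 hi.2)

theorem isRenewal_green (h : IsCentered ζ) :
    ∃ C, IsRenewal (ladderLaw ζ (Set.Iic 0)) (green ζ (Set.Ioi 0)) C := by
  obtain ⟨C, hC, hle⟩ := exists_green_Ioi_Icc_le h
  exact ⟨C, ladderLaw_Iic_Iic, green_Ioi_Iio, green_Ioi_eq, hC, hle⟩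

end Moments

/-! ### Flattened weights, polynomial and exponential. -/

theorem IsRenewal.exists_tendsto_rate_of_family {G U : Measure ℝ} [IsProbabilityMeasure G]
    [SFinite U] {C : ℝ} (h : IsRenewal G U C) {w : ℕ → ℝ → ℝ} (hw : ∀ n, IsWeight (w n))
    (hle : ∀ n x, w n x ≤ w 0 x) (hone : ∀ x, Tendsto (fun n => w n x) atTop (𝓝 1))
    (htop : ∀ n, Tendsto (w n) atTop atTop)
    (hG : Integrable (fun s => (1 + s) ^ 2 * w 0 s) G) {ψ : Measure ℝ} {u₀ : ℝ} (hu₀ : 0 ≤ u₀)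
    (hψ0 : 0 < ψ.real Set.univ) (hψ : ∀ u, u₀ ≤ u → ψ ≤ overshoot G U u) :
    ∃ (n : ℕ) (ℓ B : ℝ), Tendsto (renewalDefect G U) atTop (𝓝 ℓ) ∧
      ∀ x, |renewalDefect G U x - ℓ| ≤ B / w n x := by
  have h1 : Tendsto (fun n => ∫ s, (w n s - 1) * (1 + s) ∂G) atTop
    (𝓝 (∫ s, (1 - 1) * (1 + s) ∂G)) := by
    have hm : ∀ n, Measurable (w n) := fun n => (hw n).measurable
    refine tendsto_integral_of_dominated_convergence (fun s => (w 0 s - 1) * (1 + s))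
      (fun n => Measurable.aestronglyMeasurable (by fun_prop)) (h.integrable_weight (hw 0) hG)
      (fun n => h.ae_pos.mono fun s hs => ?_) (Eventually.of_forall fun s =>
        ((hone s).sub_const 1).mul_const _)
    have := (hw n).one_le s
    rw [Real.norm_of_nonneg (mul_nonneg (by linarith) (by linarith))]
    exact mul_le_mul_of_nonneg_right (by linarith [hle n s]) (by linarith)
  have h2 : Tendsto (fun n => w n u₀ * (1 - ψ.real Set.univ +
      2 * (C * ∫ s, (w n s - 1) * (1 + s) ∂G))) atTop (𝓝 (1 * (1 - ψ.real Set.univ +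
      2 * (C * ∫ s, (1 - 1) * (1 + s) ∂G)))) :=
    (hone u₀).mul (((h1.const_mul C).const_mul 2).const_add _)
  simp only [sub_self, zero_mul, integral_zero, mul_zero, add_zero, one_mul] at h2
  obtain ⟨n, hn⟩ := (h2.eventually (gt_mem_nhds (by linarith : 1 - ψ.real Set.univ < 1))).exists
  have hGn : Integrable (fun s => (1 + s) ^ 2 * w n s) G := by
    have := (hw n).measurable
    refine hG.mono' (Measurable.aestronglyMeasurable (by fun_prop))
      (Eventually.of_forall fun s => ?_)
    rw [Real.norm_of_nonneg (mul_nonneg (sq_nonneg _) ((hw n).pos s).le)]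
    exact mul_le_mul_of_nonneg_left (hle n s) (sq_nonneg _)
  exact ⟨n, h.exists_tendsto_rate (hw n) hGn hu₀ hψ (htop n) hn⟩

/-- A function on `[0, ∞)` whose rescalings are weights that tend to `1`. -/
structure IsProfile (f : ℝ → ℝ) : Prop where
  mono : ∀ x y, 0 ≤ x → x ≤ y → f x ≤ f y
  zero : f 0 = 1
  submul : ∀ x y, 0 ≤ x → 0 ≤ y → f (x + y) ≤ f x * f y
  cont : ContinuousAt f 0
  tendsto : Tendsto f atTop atTop

/-- The rescaling of a profile by `n + 1`, extended to the line. -/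
noncomputable def rescaled (f : ℝ → ℝ) (n : ℕ) (x : ℝ) : ℝ := f (max x 0 / (n + 1))

namespace IsProfile

variable {f : ℝ → ℝ}

theorem one_le (hf : IsProfile f) {x : ℝ} (hx : 0 ≤ x) : 1 ≤ f x := by
  rw [← hf.zero]; exact hf.mono 0 x le_rfl hx

theorem isWeight (hf : IsProfile f) (n : ℕ) : IsWeight (rescaled f n) where
  monotone x y hxy := hf.mono _ _ (by positivity) (by gcongr)
  one_le x := hf.one_le (by positivity)
  submul x y := by
    refine le_trans (hf.mono _ (max x 0 / (n + 1) + max y 0 / (n + 1)) (by positivity) ?_)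
      (hf.submul _ _ (by positivity) (by positivity))
    rw [← add_div]
    gcongr
    exact max_le (add_le_add (le_max_left _ _) (le_max_left _ _)) (by positivity)

theorem rescaled_le (hf : IsProfile f) (n : ℕ) (x : ℝ) : rescaled f n x ≤ rescaled f 0 x := by
  refine hf.mono _ _ (by positivity) ?_
  rw [Nat.cast_zero, zero_add, div_one]
  exact div_le_self (le_max_right _ _) (by linarith [n.cast_nonneg (α := ℝ)])

theorem tendsto_rescaled_one (hf : IsProfile f) (x : ℝ) :
    Tendsto (fun n => rescaled f n x) atTop (𝓝 1) := by
  have h1 : Tendsto (fun n : ℕ => max x 0 / ((n : ℝ) + 1)) atTop (𝓝 0) :=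
    (tendsto_natCast_atTop_atTop.atTop_add tendsto_const_nhds).const_div_atTop _
  have h2 := hf.cont.tendsto.comp h1
  rwa [hf.zero] at h2

theorem tendsto_rescaled_atTop (hf : IsProfile f) (n : ℕ) : Tendsto (rescaled f n) atTop atTop :=
  hf.tendsto.comp ((tendsto_atTop_mono (fun x => le_max_left x 0) tendsto_id).atTop_div_const
    (by positivity))

end IsProfile

theorem isProfile_rpow {q : ℝ} (hq : 0 < q) : IsProfile fun x => (1 + x) ^ q where
  mono x y hx hxy := Real.rpow_le_rpow (by linarith) (by linarith) hq.le
  zero := by simp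
  submul x y hx hy := by
    rw [← Real.mul_rpow (by linarith) (by linarith)]
    exact Real.rpow_le_rpow (by linarith) (by nlinarith [mul_nonneg hx hy]) hq.le
  cont := ContinuousAt.rpow_const (by fun_prop) (Or.inr hq.le)
  tendsto := (tendsto_rpow_atTop hq).comp (tendsto_atTop_add_const_left _ _ tendsto_id)

theorem isProfile_exp {b : ℝ} (hb : 0 < b) : IsProfile fun x => Real.exp (b * x) where
  mono x y _ hxy := Real.exp_le_exp.2 (by gcongr)
  zero := by simp
  submul x y _ _ := by rw [← Real.exp_add, ← mul_add]
  cont := by fun_prop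
  tendsto := Real.tendsto_exp_atTop.comp (tendsto_id.const_mul_atTop hb)

theorem integrableOn_rpow {ζ : Measure ℝ} [IsProbabilityMeasure ζ] {ξ : ℝ} (hξ : 3 < ξ)
    (hi : Integrable (fun t => (max t 0) ^ ξ) ζ) : IntegrableOn
      (fun t => (1 + t) ^ 3 * rescaled (fun x => (1 + x) ^ (ξ - 3)) 0 t) (Set.Ioi 0) ζ := by
  have hm : Measurable (rescaled (fun x => (1 + x) ^ (ξ - 3)) 0) := by
    unfold rescaled; fun_prop
  refine Integrable.mono' (((integrable_const (1 : ℝ)).add hi).const_mul (2 ^ ξ)).integrableOn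
    (Measurable.aestronglyMeasurable (by fun_prop)) ?_
  filter_upwards [ae_restrict_mem measurableSet_Ioi] with t ht
  rw [Set.mem_Ioi] at ht
  simp only [rescaled, Nat.cast_zero, zero_add, div_one, max_eq_left ht.le, Pi.add_apply]
  rw [Real.norm_of_nonneg (by positivity), ← Real.rpow_natCast, ← Real.rpow_add (by linarith)]
  have e : ((3 : ℕ) : ℝ) + (ξ - 3) = ξ := by push_cast; ring
  rw [e]
  have h0 : 0 ≤ t ^ ξ := by positivity
  rcases le_total t 1 with h | h
  · calc (1 + t) ^ ξ ≤ 2 ^ ξ := Real.rpow_le_rpow (by linarith) (by linarith) (by linarith)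
      _ ≤ _ := le_mul_of_one_le_right (by positivity) (by linarith)
  · calc (1 + t) ^ ξ ≤ (2 * t) ^ ξ := Real.rpow_le_rpow (by linarith) (by linarith) (by linarith)
      _ = 2 ^ ξ * t ^ ξ := Real.mul_rpow (by norm_num) ht.le
      _ ≤ _ := by gcongr; linarith

/-- Half of the exponential moment serves as the weight; the other half absorbs the cubic factor. -/
theorem integrableOn_exp {ζ : Measure ℝ} {b : ℝ} (hb : 0 < b)
    (hi : Integrable (fun t => Real.exp (b * t)) ζ) : IntegrableOn
      (fun t => (1 + t) ^ 3 * rescaled (fun x => Real.exp (b / 2 * x)) 0 t) (Set.Ioi 0) ζ := by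
  have hm : Measurable (rescaled (fun x => Real.exp (b / 2 * x)) 0) := by
    unfold rescaled; fun_prop
  refine Integrable.mono' (hi.const_mul (6 * (2 / b) ^ 3 * Real.exp (b / 2))).integrableOn
    (Measurable.aestronglyMeasurable (by fun_prop)) ?_
  filter_upwards [ae_restrict_mem measurableSet_Ioi] with t ht
  rw [Set.mem_Ioi] at ht
  simp only [rescaled, Nat.cast_zero, zero_add, div_one, max_eq_left ht.le]
  rw [Real.norm_of_nonneg (by positivity)]
  have h1 := Real.pow_div_factorial_le_exp (b / 2 * (1 + t)) (by positivity) 3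
  have h2 : (1 + t) ^ 3 ≤ 6 * (2 / b) ^ 3 * Real.exp (b / 2 * (1 + t)) := by
    rw [mul_pow, div_le_iff₀ (by positivity)] at h1
    have e : (1 + t) ^ 3 = (2 / b) ^ 3 * ((b / 2) ^ 3 * (1 + t) ^ 3) := by field_simp
    rw [e]
    refine (mul_le_mul_of_nonneg_left h1 (by positivity)).trans (le_of_eq ?_)
    simp [Nat.factorial]; ring
  calc (1 + t) ^ 3 * Real.exp (b / 2 * t)
      ≤ 6 * (2 / b) ^ 3 * Real.exp (b / 2 * (1 + t)) * Real.exp (b / 2 * t) := by gcongr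
    _ = 6 * (2 / b) ^ 3 * Real.exp (b / 2) * Real.exp (b * t) := by
        rw [mul_assoc, mul_assoc (6 * (2 / b) ^ 3), ← Real.exp_add, ← Real.exp_add]
        congr 2; ring

/-! ### The asymptotics of the invariant measure. -/

section Asymptotics

variable {Ω : Type*} [MeasurableSpace Ω] {P : Measure Ω} [IsProbabilityMeasure P]
  {ζ : Measure ℝ} [IsProbabilityMeasure ζ] {z : ℕ → Ω → ℝ}

theorem isLadderRatio_div (h : IsCentered ζ) (hz : ∀ n, Measurable (z n)) (hind : iIndepFun z P)
    (hlaw : ∀ n, P.map (z n) = ζ) (hi : Integrable (fun s => s) (ladderLaw ζ (Set.Iic 0)))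
    (hi2 : Integrable (fun s => s ^ 2) (ladderLaw ζ (Set.Iic 0)))
    (hpos : 0 < ∫ s, s ∂(ladderLaw ζ (Set.Iic 0))) :
    IsLadderRatio P z ((∫ s, s ^ 2 ∂(ladderLaw ζ (Set.Iic 0))) /
      (2 * ∫ s, s ∂(ladderLaw ζ (Set.Iic 0)))) := by
  have hm := aemeasurable_ladderHeight h hz hind hlaw
  rw [← map_ladderHeight h hz hind hlaw] at hi hi2 hpos ⊢
  have e1 : ∫ s, s ∂(P.map (ladderHeight z)) = ∫ ω, ladderHeight z ω ∂P :=
    integral_map hm (by fun_prop)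
  have e2 : ∫ s, s ^ 2 ∂(P.map (ladderHeight z)) = ∫ ω, ladderHeight z ω ^ 2 ∂P :=
    integral_map hm (by fun_prop)
  rw [e1] at hpos
  rw [e1, e2]
  exact ⟨ae_exists_walk_pos h hz hind hlaw, (integrable_map_measure (by fun_prop) hm).1 hi,
    (integrable_map_measure (by fun_prop) hm).1 hi2, hpos, rfl⟩

/-- Here duality turns the distribution function of the invariant measure into a renewal function;
hence the slope is 1/μ and the intercept is the limit of the defect. -/
theorem exists_excursionMeasure_rate (h : IsCentered ζ) (hz : ∀ n, Measurable (z n))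
    (hind : iIndepFun z P) (hlaw : ∀ n, P.map (z n) = ζ) {n₀ : ℕ} (hn₀ : HasPDF (walk z n₀) P volume)
    {f : ℝ → ℝ} (hf : IsProfile f)
    (hi : IntegrableOn (fun t => (1 + t) ^ 3 * rescaled f 0 t) (Set.Ioi 0) ζ) :
    ∃ c d ε B : ℝ, 0 < c ∧ 0 < ε ∧
      (∀ x : ℝ≥0, |(excursionMeasure ζ).real (Set.Icc 0 x) - (c * x + d)| ≤ B / f (ε * x)) ∧
      IsLadderRatio P z (d / c) := by
  set G := ladderLaw ζ (Set.Iic 0)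
  set U := green ζ (Set.Ioi 0)
  have : IsProbabilityMeasure G := isProbabilityMeasure_ladderLaw_Iic h
  obtain ⟨C, hr⟩ : ∃ C, IsRenewal G U C := isRenewal_green h
  have hw := hf.isWeight
  have hG : Integrable (fun s => (1 + s) ^ 2 * rescaled f 0 s) G :=
    integrable_ladderLaw h (hw 0).monotone (fun x => ((hw 0).pos x).le) hi
  have hG2 := IsRenewal.integrable_sq_of_weight (hw 0) hG
  have hG1 := hr.integrable_of_sq hG2
  have hμ := hr.mean_pos hG1
  -- The law of n₀ successive positive steps: it is dominated by the law of the walk at time n₀,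
  -- hence absolutely continuous, and absorbed by `U`, since a positive first step is itself a
  -- ladder height.
  set m := killed (ζ.restrict (Set.Ioi 0)) Set.univ n₀
  have : IsFiniteMeasure m := isFiniteMeasure_killed_univ n₀
  have hmle : m ≤ P.map (walk z n₀) := by
    rw [map_walk hz hind hlaw]
    exact killed_univ_mono Measure.restrict_le_self n₀
  have hm : m ≪ volume := (Measure.absolutelyContinuous_of_le hmle).trans hn₀.absolutelyContinuous
  have hm0 : m ≠ 0 := by
    obtain ⟨δ, hδ, hpos⟩ := h.exists_Ioi_pos
    rw [← Measure.measure_univ_ne_zero, killed_univ_apply_univ, Measure.restrict_apply_univ]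
    exact pow_ne_zero _ (hpos.trans_le (measure_mono (Set.Ioi_subset_Ioi hδ.le))).ne'
  have hmU : m ∗ U ≤ U := by
    refine killed_univ_absorb ?_ n₀
    have h1 : ζ.restrict (Set.Ioi 0) ≤ G := by
      have := restrict_le_ladderLaw (ζ := ζ) (Set.Iic 0)
      rwa [Set.compl_Iic] at this
    refine (Measure.conv_mono h1 le_rfl).trans ?_
    conv_rhs => rw [hr.eq]
    exact Measure.le_add_left le_rfl
  obtain ⟨c, x₀, hc, hx₀, hle⟩ := hr.exists_smul_volume_Ici_le hG2 hm hm0 hmU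
  obtain ⟨ψ, u₀, hu₀, hψ0, hψ⟩ := hr.exists_le_overshoot hc hx₀ hle
  obtain ⟨n, ℓ, B, hℓ, hB⟩ := hr.exists_tendsto_rate_of_family hw hf.rescaled_le
    hf.tendsto_rescaled_one hf.tendsto_rescaled_atTop hG hu₀ hψ0 hψ
  refine ⟨(∫ s, s ∂G)⁻¹, ℓ, ((n : ℝ) + 1)⁻¹, B, inv_pos.2 hμ, by positivity, fun x => ?_, ?_⟩
  · have h1 := hB x
    rw [renewalDefect, rescaled, max_eq_left x.coe_nonneg, div_eq_inv_mul, div_eq_inv_mul (x : ℝ)] at h1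
    rw [measureReal_def, excursionMeasure_Icc, ← measureReal_def, ← sub_sub]
    exact h1
  · have hsq : Integrable (fun s => s ^ 2) G := by
      refine ((hr.integrable_mul_of_sq hG2).sub hG1).congr (Eventually.of_forall fun s => ?_)
      simp only [Pi.sub_apply]; ring
    have e : ℓ / (∫ s, s ∂G)⁻¹ = (∫ s, s ^ 2 ∂G) / (2 * ∫ s, s ∂G) := by
      rw [hr.tendsto_renewalDefect_eq hG2 hℓ]
      field_simp
    rw [e]
    exact isLadderRatio_div h hz hind hlaw hG1 hsq hμ

end Asymptotics

/-! ### The main theorem. -/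

theorem theorem4p1 {Ω : Type*} [MeasurableSpace Ω] (P : Measure Ω) [IsProbabilityMeasure P]
    (ζ : Measure ℝ) [IsProbabilityMeasure ζ]
    -- `ζ` is centered with positive and finite variance
    (hζ_sq : Integrable (fun t : ℝ => t ^ 2) ζ)
    (hζ_pos : 0 < ∫ t, t ^ 2 ∂ζ)
    (hζ_mean : ∫ t, t ∂ζ = 0)
    -- `z` is an i.i.d. sequence with law `ζ`
    (z : ℕ → Ω → ℝ) (hz_meas : ∀ n, Measurable (z n))
    (hz_indep : iIndepFun z P) (hz_law : ∀ n, P.map (z n) = ζ) :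
    ∃ ν : Measure ℝ≥0,
      -- `ν` is the unique nonzero invariant measure, up to a multiplicative constant
      ν ≠ 0 ∧ (lindleyKernel ζ).Invariant ν ∧
      (∀ π : Measure ℝ≥0, SigmaFinite π → (lindleyKernel ζ).Invariant π →
        ∃ a : ℝ≥0, π = a • ν) ∧
      -- `ν` is locally finite and infinite
      (∀ x : ℝ≥0, ν (Set.Icc 0 x) < ∞) ∧
      ν Set.univ = ∞ ∧
      -- recurrence, whatever the starting point
      (∀ Y₀ : Ω → ℝ≥0, Measurable Y₀ → IndepFun Y₀ (fun ω n => z n ω) P →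
        ∀ O : Set ℝ≥0, IsOpen O → 0 < ν O →
          ∀ᵐ ω ∂P, ∃ᶠ n in atTop, lindleyChain z Y₀ n ω ∈ O) ∧
      -- asymptotics, if some partial sum of the increments has a density
      ((∃ n₀ : ℕ, 1 ≤ n₀ ∧ HasPDF (walk z n₀) P volume) →
        -- under a moment of order `ξ > 3` of the positive part
        (∀ ξ : ℝ, 3 < ξ → Integrable (fun t : ℝ => (max t 0) ^ ξ) ζ →
          ∃ c d : ℝ, 0 < c ∧
            (fun x : ℝ≥0 => ν.real (Set.Icc 0 x) - (c * x + d))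
              =O[atTop] (fun x : ℝ≥0 => 1 / (x : ℝ) ^ (ξ - 3)) ∧
            IsLadderRatio P z (d / c)) ∧
        -- under an exponential moment
        ((∃ b : ℝ, 0 < b ∧ Integrable (fun t : ℝ => Real.exp (b * t)) ζ) →
          ∃ c d δ : ℝ, 0 < c ∧ 0 < δ ∧
            (fun x : ℝ≥0 => ν.real (Set.Icc 0 x) - (c * x + d))
              =O[atTop] (fun x : ℝ≥0 => Real.exp (-δ * x)) ∧
            IsLadderRatio P z (d / c))) := by
  have h : IsCentered ζ := ⟨hζ_sq, hζ_pos, hζ_mean⟩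
  refine ⟨excursionMeasure ζ, fun h0 => ?_, invariant_excursionMeasure h,
    fun π _ hπ => eq_smul_excursionMeasure h hπ, excursionMeasure_Icc_lt_top h,
    excursionMeasure_univ h, fun Y₀ hY₀ hind O hO hpos =>
      ae_frequently_lindleyChain h hz_meas hz_indep hz_law hY₀ hind hO.measurableSet hpos, ?_⟩
  · have := excursionMeasure_univ h
    simp [h0] at this
  rintro ⟨n₀, -, hn₀⟩
  refine ⟨fun ξ hξ hi => ?_, ?_⟩
  · obtain ⟨c, d, ε, B, hc, hε, hB, hr⟩ := exists_excursionMeasure_rate h hz_meas hz_indep hz_law hn₀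
      (isProfile_rpow (sub_pos.2 hξ)) (integrableOn_rpow hξ hi)
    refine ⟨c, d, hc, IsBigO.of_bound (B / ε ^ (ξ - 3)) ?_, hr⟩
    -- Evaluating the bound at x = 0, where the profile equals 1, gives the sign of B, needed to
    -- pass from (1 + εx) to εx in the denominator.
    have hB0 : 0 ≤ B := by
      have := (abs_nonneg _).trans (hB 0)
      simpa using this
    filter_upwards [eventually_gt_atTop 0] with x hx
    have hx' : (0 : ℝ) < x := hx
    rw [Real.norm_eq_abs, Real.norm_of_nonneg (by positivity), div_mul_div_comm, mul_one,
      ← Real.mul_rpow hε.le hx'.le]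
    refine (hB x).trans ?_
    have : 0 < (ε * (x : ℝ)) ^ (ξ - 3) := by positivity
    gcongr
    linarith
  · rintro ⟨b, hb, hi⟩
    obtain ⟨c, d, ε, B, hc, hε, hB, hr⟩ := exists_excursionMeasure_rate h hz_meas hz_indep hz_law hn₀
      (isProfile_exp (half_pos hb)) (integrableOn_exp hb hi)
    refine ⟨c, d, b / 2 * ε, hc, by positivity, IsBigO.of_bound B
      (Eventually.of_forall fun x => ?_), hr⟩
    rw [Real.norm_eq_abs, Real.norm_of_nonneg (Real.exp_pos _).le, neg_mul, Real.exp_neg,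
      ← div_eq_mul_inv, mul_assoc]
    exact hB x
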